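/- Let $(V,\xi=\ker\alpha)$ be a closed connected contact manifold of dimension $2n+1$ with contact form $\alpha$ and Reeb vector field $R_\alpha$, and let $(M^{2n},\omega)$ be a closed symplectic manifold. Let $\pi\colon (V,\alpha)\to(M,\omega)$ be a prequantization: $\pi^*\omega=d\alpha$, and the flow of $R_\alpha$ is a free action of $S^1=\mathbb{R}/\hbar\mathbb{Z}$ on $V$ (for some $\hbar>0$) making $\pi$ a smooth principal $S^1$-bundle. Let $\widetilde{\mathrm{Cont}}_0(V)$ be the universal cover of the identity component of the group of contactomorphisms, i.e. the group of smooth contact isotopies based at the identity modulo homotopy with fixed end points. For a smooth function $h$ on $[0,1]\times V$ let $\widetilde\phi_h\in\widetilde{\mathrm{Cont}}_0(V)$ be the class of the unique contact isotopy $\{\phi^t\}$ with $\phi^0=\mathrm{id}$ and $\alpha(\partial_t\phi^t)=h_t\circ\phi^t$. Write $\widetilde\phi\preceq\widetilde\psi$ if $\widetilde\phi^{-1}\widetilde\psi=\widetilde\phi_h$ for some $h\ge 0$. Let $\mu\colon\widetilde{\mathrm{Cont}}_0(V)\to\mathbb{R}$ be a monotone quasi-morphism, that is, a function, not identically zero,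 such that $|\mu(ab)-\mu(a)-\mu(b)|\le D$ for all $a,b$ and some constant $D>0$, $\mu(a^k)=k\mu(a)$ for all $a$ and all $k\in\mathbb{Z}$, and $\mu(a)\le\mu(b)$ whenever $a\preceq b$. A closed subset $Y\subset V$ is called $\mu$-subheavy if $\mu(\widetilde\phi_h)=0$ for every $h\in C^\infty(V)$ with $h|_Y=0$, and $\mu$-superheavy if $\mu(\widetilde\phi_h)>0$ for every $h\in C^\infty(V)$ with $h|_Y>0$. Let $\widetilde{\mathrm{Ham}}(M)$ be the universal cover of the Hamiltonian group of $M$ (Hamiltonian isotopies based at the identity modulo homotopy with fixed end points), and let $\widetilde\phi_F\in\widetilde{\mathrm{Ham}}(M)$ be the class of the isotopy generated by the smooth Hamiltonian $F\colon[0,1]\times M\to\mathbb{R}$, where $\iota_{X_{F_t}}\omega=-dF_t$. Put $\mathrm{Vol}(M)=\int_M\omega^n$, let $\pi^*\colon\widetilde{\mathrm{Ham}}(M)\to\widetilde{\mathrm{Cont}}_0(V)$ be given by $\pi^*(\widetilde\phi_F)=\widetilde\phi_{\sigma(F)}$ with $\sigma(F)_t=F_t\circ\pi-\frac{1}{\mathrm{Vol}(M)}\int_MF_t\,\omega^n$,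 and let $$\mu_M=-\frac{\mathrm{Vol}(M)}{\mu(\widetilde\phi_1)}\,\mu\circ\pi^*\colon\widetilde{\mathrm{Ham}}(M)\to\mathbb{R},\qquad \zeta(H)=\frac{\int_MH\,\omega^n-\mu_M(\widetilde\phi_H)}{\mathrm{Vol}(M)}\quad(H\in C^\infty(M)),$$ where $\widetilde\phi_1$ is generated by the constant function $1$, i.e. by the Reeb flow. A nonempty closed subset $X\subset M$ is called $\zeta$-superheavy if $\min_XH\le\zeta(H)\le\max_XH$ for all $H\in C^\infty(M)$. Then: 1. if $Y\subset V$ is $\mu$-subheavy, then $\pi(Y)\subset M$ is $\zeta$-superheavy; 2. if $X\subset M$ is $\zeta$-superheavy, then $\pi^{-1}(X)\subset V$ is $\mu$-superheavy. -/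

import Mathlib

open scoped Manifold ContDiff

noncomputable section

namespace Prequant

/-! ### Differential forms on manifolds -/

/-- Euclidean space of dimension `m`, the model space of the `m`-dimensional manifolds. -/
abbrev Euc (m : ℕ) : Type := EuclideanSpace ℝ (Fin m)

/-- A (not necessarily smooth) field of alternating `k`-forms on the `m`-manifold `X`. -/
abbrev Form (m : ℕ) (X : Type*) [TopologicalSpace X] [ChartedSpace (Euc m) X] (k : ℕ) :=
  (x : X) → (TangentSpace (𝓡 m) x) [⋀^Fin k]→L[ℝ] ℝ

section Forms

variable {m k : ℕ} {X : Type*} [TopologicalSpace X] [ChartedSpace (Euc m) X]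

/-- The expression of a form in the preferred chart around `c`, that is, its pullback by the
inverse of the chart. Only the values on the (open) target of the chart matter. -/
def Form.inChart (θ : Form m X k) (c : X) : Euc m → (Euc m) [⋀^Fin k]→L[ℝ] ℝ := fun y =>
  (θ ((extChartAt (𝓡 m) c).symm y)).compContinuousLinearMap
    (mfderiv 𝓘(ℝ, Euc m) (𝓡 m) (extChartAt (𝓡 m) c).symm y)

/-- Smoothness of a form. -/
def Form.IsSmooth (θ : Form m X k) : Prop :=
  ∀ c : X, ContDiffOn ℝ ∞ (θ.inChart c) (extChartAt (𝓡 m) c).target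

/-- The exterior derivative, computed at `x` in the preferred chart around `x`. -/
def Form.d (θ : Form m X k) : Form m X (k + 1) := fun x =>
  (extDeriv (θ.inChart x) (extChartAt (𝓡 m) x x)).compContinuousLinearMap
    (mfderiv (𝓡 m) 𝓘(ℝ, Euc m) (extChartAt (𝓡 m) x) x)

/-- `α` is a contact form: a smooth, nowhere vanishing 1-form such that `dα` is nondegenerate
on the hyperplane field `ker α`. -/
structure IsContactForm (α : Form m X 1) : Prop where
  smooth : α.IsSmooth
  ne_zero : ∀ x, α x ≠ 0
  nondegenerate : ∀ x (u : TangentSpace (𝓡 m) x), α x ![u] = 0 →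
    (∀ v : TangentSpace (𝓡 m) x, α x ![v] = 0 → α.d x ![u, v] = 0) → u = 0

/-- `Ω` is a symplectic form: a smooth, closed, nondegenerate 2-form. -/
structure IsSymplecticForm (Ω : Form m X 2) : Prop where
  smooth : Ω.IsSmooth
  closed : Ω.d = 0
  nondegenerate : ∀ x (u : TangentSpace (𝓡 m) x),
    (∀ v : TangentSpace (𝓡 m) x, Ω x ![u, v] = 0) → u = 0

end Forms

/-! ### Smooth families of diffeomorphisms -/

/-- A smooth family of diffeomorphisms of `X`, parametrized by the normed space `P`. -/
structure DiffeoFamily (m : ℕ) (P : Type*) [NormedAddCommGroup P] [NormedSpace ℝ P]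
    (X : Type*) [TopologicalSpace X] [ChartedSpace (Euc m) X] where
  toFun : P → X → X
  invFun : P → X → X
  left_inv : ∀ p x, invFun p (toFun p x) = x
  right_inv : ∀ p x, toFun p (invFun p x) = x
  smooth_toFun : ContMDiff (𝓘(ℝ, P).prod (𝓡 m)) (𝓡 m) ∞ (fun q : P × X => toFun q.1 q.2)
  smooth_invFun : ContMDiff (𝓘(ℝ, P).prod (𝓡 m)) (𝓡 m) ∞ (fun q : P × X => invFun q.1 q.2)

namespace DiffeoFamily

variable {m : ℕ} {P : Type*} [NormedAddCommGroup P] [NormedSpace ℝ P]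
  {X : Type*} [TopologicalSpace X] [ChartedSpace (Euc m) X]

theorem ext_toFun {φ ψ : DiffeoFamily m P X} (h : ∀ p x, φ.toFun p x = ψ.toFun p x) : φ = ψ := by
  obtain ⟨f, g, h1, h2, h3, h4⟩ := φ
  obtain ⟨f', g', h1', h2', h3', h4'⟩ := ψ
  have e : f = f' := funext fun p => funext fun x => h p x
  subst e
  have e : g = g' := funext fun p => funext fun x => by
    rw [← h1' p (g p x), h2]
  subst e
  rfl

/-- Families of diffeomorphisms form a group under parameterwise composition. -/
instance : Group (DiffeoFamily m P X) where
  mul φ ψ :=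
    { toFun := fun p x => φ.toFun p (ψ.toFun p x)
      invFun := fun p x => ψ.invFun p (φ.invFun p x)
      left_inv := fun p x => by rw [φ.left_inv, ψ.left_inv]
      right_inv := fun p x => by rw [ψ.right_inv, φ.right_inv]
      smooth_toFun := φ.smooth_toFun.comp (contMDiff_fst.prodMk ψ.smooth_toFun)
      smooth_invFun := ψ.smooth_invFun.comp (contMDiff_fst.prodMk φ.smooth_invFun) }
  one :=
    { toFun := fun _ x => x
      invFun := fun _ x => x
      left_inv := fun _ _ => rfl
      right_inv := fun _ _ => rfl
      smooth_toFun := contMDiff_snd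
      smooth_invFun := contMDiff_snd }
  inv φ :=
    { toFun := φ.invFun
      invFun := φ.toFun
      left_inv := φ.right_inv
      right_inv := φ.left_inv
      smooth_toFun := φ.smooth_invFun
      smooth_invFun := φ.smooth_toFun }
  mul_assoc _ _ _ := ext_toFun fun _ _ => rfl
  one_mul _ := ext_toFun fun _ _ => rfl
  mul_one _ := ext_toFun fun _ _ => rfl
  inv_mul_cancel φ := ext_toFun fun p x => φ.left_inv p x

theorem mul_toFun (φ ψ : DiffeoFamily m P X) (p : P) (x : X) :
    (φ * ψ).toFun p x = φ.toFun p (ψ.toFun p x) := rfl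

theorem one_toFun (p : P) (x : X) : (1 : DiffeoFamily m P X).toFun p x = x := rfl

theorem inv_toFun (φ : DiffeoFamily m P X) (p : P) (x : X) :
    (φ⁻¹).toFun p x = φ.invFun p x := rfl

theorem smooth_apply (φ : DiffeoFamily m P X) (p : P) :
    ContMDiff (𝓡 m) (𝓡 m) ∞ (φ.toFun p) :=
  φ.smooth_toFun.comp (contMDiff_const.prodMk contMDiff_id)

/-- The velocity `∂ₜ φₜ(x)`, a tangent vector at `φₜ(x)`. -/
def velocity (φ : DiffeoFamily m ℝ X) (t : ℝ) (x : X) : TangentSpace (𝓡 m) (φ.toFun t x) :=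
  mfderiv 𝓘(ℝ, ℝ) (𝓡 m) (fun τ : ℝ => φ.toFun τ x) t (1 : ℝ)

/-- The restriction of a two-parameter family to a fixed value of the first parameter. -/
def slice (Φ : DiffeoFamily m (ℝ × ℝ) X) (s : ℝ) : DiffeoFamily m ℝ X where
  toFun t := Φ.toFun (s, t)
  invFun t := Φ.invFun (s, t)
  left_inv t := Φ.left_inv (s, t)
  right_inv t := Φ.right_inv (s, t)
  smooth_toFun := Φ.smooth_toFun.comp
    (((contMDiff_const.prodMk_space contMDiff_fst)).prodMk contMDiff_snd)
  smooth_invFun := Φ.smooth_invFun.comp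
    (((contMDiff_const.prodMk_space contMDiff_fst)).prodMk contMDiff_snd)

/-- A path of diffeomorphisms, viewed as a two-parameter family independent of the first
parameter. -/
def unslice (φ : DiffeoFamily m ℝ X) : DiffeoFamily m (ℝ × ℝ) X where
  toFun p := φ.toFun p.2
  invFun p := φ.invFun p.2
  left_inv p := φ.left_inv p.2
  right_inv p := φ.right_inv p.2
  smooth_toFun := φ.smooth_toFun.comp
    (((contDiff_snd.contMDiff).comp contMDiff_fst).prodMk contMDiff_snd)
  smooth_invFun := φ.smooth_invFun.comp
    (((contDiff_snd.contMDiff).comp contMDiff_fst).prodMk contMDiff_snd)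

end DiffeoFamily

/-! ### The universal cover of the identity component of the contactomorphism group -/

section Contact

variable {m : ℕ} {V : Type*} [TopologicalSpace V] [ChartedSpace (Euc m) V]

/-- `f^* α = c α` for a positive function `c`: the map `f` preserves the cooriented hyperplane
field `ker α`. -/
def PreservesContact (α : Form m V 1) (f : V → V) : Prop :=
  ∀ x, ∃ c : ℝ, 0 < c ∧ ∀ v : TangentSpace (𝓡 m) x,
    α (f x) ![mfderiv (𝓡 m) (𝓡 m) f x v] = c * α x ![v]

theorem PreservesContact.id (α : Form m V 1) : PreservesContact α (fun x => x) := fun x =>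
  ⟨1, one_pos, fun v => by
    have : mfderiv (𝓡 m) (𝓡 m) (fun x : V => x) x = ContinuousLinearMap.id ℝ _ := mfderiv_id
    rw [this, one_mul]; rfl⟩

theorem PreservesContact.comp {α : Form m V 1} {f g : V → V} (hf : PreservesContact α f)
    (hg : PreservesContact α g) (sf : ContMDiff (𝓡 m) (𝓡 m) ∞ f)
    (sg : ContMDiff (𝓡 m) (𝓡 m) ∞ g) : PreservesContact α (fun x => f (g x)) := fun x => by
  obtain ⟨c, hc, h⟩ := hf (g x)
  obtain ⟨c', hc', h'⟩ := hg x
  refine ⟨c * c', mul_pos hc hc', fun v => ?_⟩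
  have key := mfderiv_comp_apply (I := 𝓡 m) (I' := 𝓡 m) (I'' := 𝓡 m) x
    ((sf (g x)).mdifferentiableAt (by simp)) ((sg x).mdifferentiableAt (by simp)) v
  have e : α (f (g x)) ![mfderiv (𝓡 m) (𝓡 m) (fun x => f (g x)) x v]
      = α (f (g x)) ![mfderiv (𝓡 m) (𝓡 m) f (g x) (mfderiv (𝓡 m) (𝓡 m) g x v)] :=
    congrArg (fun w : Euc m => α (f (g x)) ![w]) key
  rw [e, h, h', mul_assoc]

theorem PreservesContact.of_inverse {α : Form m V 1} {f g : V → V} (hf : PreservesContact α f)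
    (sf : ContMDiff (𝓡 m) (𝓡 m) ∞ f) (sg : ContMDiff (𝓡 m) (𝓡 m) ∞ g)
    (hfg : ∀ x, f (g x) = x) : PreservesContact α g := fun x => by
  obtain ⟨c, hc, h⟩ := hf (g x)
  refine ⟨c⁻¹, inv_pos.2 hc, fun v => ?_⟩
  have key := mfderiv_comp_apply (I := 𝓡 m) (I' := 𝓡 m) (I'' := 𝓡 m) x
    ((sf (g x)).mdifferentiableAt (by simp)) ((sg x).mdifferentiableAt (by simp)) v
  have hid : f ∘ g = fun x => x := funext hfg
  have h1 := h (mfderiv (𝓡 m) (𝓡 m) g x v)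
  have e : α (f (g x)) ![mfderiv (𝓡 m) (𝓡 m) f (g x) (mfderiv (𝓡 m) (𝓡 m) g x v)]
      = α x ![v] := by
    have e1 : (mfderiv (𝓡 m) (𝓡 m) f (g x) (mfderiv (𝓡 m) (𝓡 m) g x v) : Euc m) = v := by
      refine key.symm.trans ?_
      rw [hid]
      have : mfderiv (𝓡 m) (𝓡 m) (fun x : V => x) x = ContinuousLinearMap.id ℝ _ := mfderiv_id
      rw [this]; rfl
    have e2 : ∀ (y : V), y = x → ∀ w : Euc m, w = v →
        α y ![(w : TangentSpace (𝓡 m) y)] = α x ![v] := by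
      rintro y rfl w rfl; rfl
    exact e2 _ (hfg x) _ e1
  rw [e] at h1
  rw [h1, inv_mul_cancel_left₀ hc.ne']

/-- The group of contact isotopies based at the identity, under pointwise composition. An isotopy
over the time interval `[0,1]` is given with a smooth extension to all times; only its restriction
to `[0,1]` matters in the quotient below. -/
def contactPaths (α : Form m V 1) : Subgroup (DiffeoFamily m ℝ V) where
  carrier := {φ | (∀ x, φ.toFun 0 x = x) ∧ ∀ t, PreservesContact α (φ.toFun t)}
  mul_mem' := fun {φ ψ} hφ hψ => ⟨fun x => by rw [DiffeoFamily.mul_toFun, hψ.1, hφ.1],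
    fun t => (hφ.2 t).comp (hψ.2 t) (φ.smooth_apply t) (ψ.smooth_apply t)⟩
  one_mem' := ⟨fun _ => rfl, fun _ => PreservesContact.id α⟩
  inv_mem' := fun {φ} hφ => ⟨fun x => by
      have := φ.left_inv 0 x
      rw [hφ.1] at this
      exact this,
    fun t => (hφ.2 t).of_inverse (φ.smooth_apply t) ((φ⁻¹).smooth_apply t) (φ.right_inv t)⟩

/-- `Φ` is a homotopy, with fixed end points, through contact isotopies based at the identity, from
the constant isotopy to the loop `φ`. -/
structure IsContraction (α : Form m V 1) (φ : DiffeoFamily m ℝ V)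
    (Φ : DiffeoFamily m (ℝ × ℝ) V) : Prop where
  contact : ∀ p, PreservesContact α (Φ.toFun p)
  start : ∀ s ∈ Set.Icc (0 : ℝ) 1, ∀ x, Φ.toFun (s, 0) x = x
  finish : ∀ s ∈ Set.Icc (0 : ℝ) 1, ∀ x, Φ.toFun (s, 1) x = x
  bottom : ∀ t ∈ Set.Icc (0 : ℝ) 1, ∀ x, Φ.toFun (0, t) x = x
  top : ∀ t ∈ Set.Icc (0 : ℝ) 1, ∀ x, Φ.toFun (1, t) x = φ.toFun t x

/-- The subgroup of contractible loops of contactomorphisms. -/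
def contractibleLoops (α : Form m V 1) : Subgroup (contactPaths α) where
  carrier := {φ | ∃ Φ : DiffeoFamily m (ℝ × ℝ) V, IsContraction α (φ : DiffeoFamily m ℝ V) Φ}
  mul_mem' := by
    rintro φ ψ ⟨Φ, hΦ⟩ ⟨Ψ, hΨ⟩
    refine ⟨Φ * Ψ, fun p => (hΦ.contact p).comp (hΨ.contact p) (Φ.smooth_apply p)
      (Ψ.smooth_apply p), ?_, ?_, ?_, ?_⟩
    · intro s hs x; rw [DiffeoFamily.mul_toFun, hΨ.start s hs, hΦ.start s hs]
    · intro s hs x; rw [DiffeoFamily.mul_toFun, hΨ.finish s hs, hΦ.finish s hs]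
    · intro s hs x; rw [DiffeoFamily.mul_toFun, hΨ.bottom s hs, hΦ.bottom s hs]
    · intro s hs x; rw [DiffeoFamily.mul_toFun, hΨ.top s hs, hΦ.top s hs]; rfl
  one_mem' := ⟨1, fun _ => PreservesContact.id α, fun _ _ _ => rfl, fun _ _ _ => rfl,
    fun _ _ _ => rfl, fun _ _ _ => rfl⟩
  inv_mem' := by
    rintro φ ⟨Φ, hΦ⟩
    have aux : ∀ p x y, Φ.toFun p x = y → (Φ⁻¹).toFun p y = x := by
      rintro p x y rfl; exact Φ.left_inv p x
    refine ⟨Φ⁻¹, fun p => (hΦ.contact p).of_inverse (Φ.smooth_apply p)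
      ((Φ⁻¹).smooth_apply p) (Φ.right_inv p), ?_, ?_, ?_, ?_⟩
    · intro s hs x; exact aux _ _ _ (hΦ.start s hs x)
    · intro s hs x; exact aux _ _ _ (hΦ.finish s hs x)
    · intro s hs x; exact aux _ _ _ (hΦ.bottom s hs x)
    · intro s hs x
      refine aux _ _ _ ?_
      rw [hΦ.top s hs]
      exact (φ : DiffeoFamily m ℝ V).right_inv s x

instance contractibleLoops_normal (α : Form m V 1) : (contractibleLoops α).Normal where
  conj_mem := by
    rintro φ ⟨Φ, hΦ⟩ ψ
    have hc : ∀ p, PreservesContact α ((ψ : DiffeoFamily m ℝ V).unslice.toFun p) :=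
      fun p => ψ.2.2 p.2
    have hc' : ∀ p, PreservesContact α (((ψ : DiffeoFamily m ℝ V).unslice⁻¹).toFun p) :=
      fun p => (ψ⁻¹).2.2 p.2
    have aux : ∀ p x, (ψ : DiffeoFamily m ℝ V).unslice.toFun p
        (((ψ : DiffeoFamily m ℝ V).unslice⁻¹).toFun p x) = x :=
      fun p x => (ψ : DiffeoFamily m ℝ V).right_inv p.2 x
    refine ⟨(ψ : DiffeoFamily m ℝ V).unslice * Φ * (ψ : DiffeoFamily m ℝ V).unslice⁻¹,
      fun p => ((hc p).comp (hΦ.contact p) (DiffeoFamily.smooth_apply _ p)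
        (Φ.smooth_apply p)).comp (hc' p)
        (DiffeoFamily.smooth_apply ((ψ : DiffeoFamily m ℝ V).unslice * Φ) p)
        (DiffeoFamily.smooth_apply _ p), ?_, ?_, ?_, ?_⟩
    · intro s hs x; rw [DiffeoFamily.mul_toFun, DiffeoFamily.mul_toFun, hΦ.start s hs, aux]
    · intro s hs x; rw [DiffeoFamily.mul_toFun, DiffeoFamily.mul_toFun, hΦ.finish s hs, aux]
    · intro s hs x; rw [DiffeoFamily.mul_toFun, DiffeoFamily.mul_toFun, hΦ.bottom s hs, aux]
    · intro s hs x; rw [DiffeoFamily.mul_toFun, DiffeoFamily.mul_toFun, hΦ.top s hs]; rfl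

/-- The universal cover of the identity component of the group of contactomorphisms: contact
isotopies based at the identity modulo homotopy with fixed end points. -/
abbrev ContTilde (α : Form m V 1) : Type _ := contactPaths α ⧸ contractibleLoops α

/-- The contact isotopy `φ` has the contact Hamiltonian `h` with respect to the contact form `α`,
that is, `α(∂ₜ φₜ(x)) = hₜ(φₜ(x))`. -/
def HasContactHamiltonian (α : Form m V 1) (φ : contactPaths α) (h : ℝ → V → ℝ) : Prop :=
  ∀ t x, α (φ.1.toFun t x) ![φ.1.velocity t x] = h t (φ.1.toFun t x)

open Classical in
/-- The class of the contact isotopy generated by the contact Hamiltonian `h`. (On a closed contact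
manifold every smooth `h` generates exactly one contact isotopy based at the identity.) -/
def contactClass (α : Form m V 1) (h : ℝ → V → ℝ) : ContTilde α :=
  if H : ∃ φ : contactPaths α, HasContactHamiltonian α φ h then
    QuotientGroup.mk H.choose else 1

/-- `id ≼ a`: the class `a` is represented by a contact isotopy with nonnegative contact
Hamiltonian. -/
def ContTilde.Nonneg (α : Form m V 1) (a : ContTilde α) : Prop :=
  ∃ φ : contactPaths α, QuotientGroup.mk φ = a ∧
    ∀ t ∈ Set.Icc (0 : ℝ) 1, ∀ x, 0 ≤ α (φ.1.toFun t x) ![φ.1.velocity t x]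

/-- The bi-invariant relation `a ≼ b`. -/
def ContTilde.Le (α : Form m V 1) (a b : ContTilde α) : Prop :=
  ContTilde.Nonneg α (a⁻¹ * b)

/-- A nonzero homogeneous quasi-morphism on a group. -/
structure IsQuasimorphism {G : Type*} [Group G] (μ : G → ℝ) : Prop where
  bounded : ∃ D : ℝ, 0 < D ∧ ∀ a b, |μ (a * b) - μ a - μ b| ≤ D
  homogeneous : ∀ (a : G) (k : ℤ), μ (a ^ k) = k * μ a
  nonzero : ∃ a, μ a ≠ 0

/-- A monotone (nonzero, homogeneous) quasi-morphism. -/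
structure IsMonotoneQuasimorphism (α : Form m V 1) (μ : ContTilde α → ℝ) : Prop where
  quasi : IsQuasimorphism μ
  monotone : ∀ a b, ContTilde.Le α a b → μ a ≤ μ b

/-- `μ`-subheavy subsets of a contact manifold. -/
def IsSubheavy (α : Form m V 1) (μ : ContTilde α → ℝ) (Y : Set V) : Prop :=
  IsClosed Y ∧ ∀ h : C^∞⟮𝓡 m, V; ℝ⟯, (∀ y ∈ Y, h y = 0) →
    μ (contactClass α (fun _ => h)) = 0

/-- `μ`-superheavy subsets of a contact manifold. -/
def IsContactSuperheavy (α : Form m V 1) (μ : ContTilde α → ℝ) (Y : Set V) : Prop :=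
  IsClosed Y ∧ ∀ h : C^∞⟮𝓡 m, V; ℝ⟯, (∀ y ∈ Y, 0 < h y) →
    0 < μ (contactClass α (fun _ => h))

end Contact

/-! ### The universal cover of the Hamiltonian group -/

section Hamiltonian

variable {m : ℕ} {M : Type*} [TopologicalSpace M] [ChartedSpace (Euc m) M]

/-- The isotopy `f` integrates the Hamiltonian vector field `X_F` with `ι_{X_F} Ω = -dF`. -/
def IsGeneratedBy (Ω : Form m M 2) (f : DiffeoFamily m ℝ M) (F : ℝ → M → ℝ) : Prop :=
  ∀ t x (v : TangentSpace (𝓡 m) (f.toFun t x)),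
    Ω (f.toFun t x) ![f.velocity t x, v] =
      -(mfderiv (𝓡 m) 𝓘(ℝ, ℝ) (F t) (f.toFun t x) v : ℝ)

/-- A Hamiltonian isotopy based at the identity, with a Hamiltonian (not necessarily normalized)
that generates it. As in the contact case, isotopies over `[0,1]` are given with a smooth
extension to all times. -/
structure HamIsotopy (Ω : Form m M 2) where
  flow : DiffeoFamily m ℝ M
  ham : ℝ → M → ℝ
  flow_zero : ∀ x, flow.toFun 0 x = x
  smooth_ham : ContMDiff (𝓘(ℝ, ℝ).prod (𝓡 m)) 𝓘(ℝ, ℝ) ∞ (fun q : ℝ × M => ham q.1 q.2)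
  generates : IsGeneratedBy Ω flow ham

/-- The constant isotopy. -/
def HamIsotopy.const (Ω : Form m M 2) : HamIsotopy Ω where
  flow := 1
  ham := fun _ _ => 0
  flow_zero := fun _ => rfl
  smooth_ham := contMDiff_const
  generates := fun t x v => by
    have e1 : (1 : DiffeoFamily m ℝ M).velocity t x = 0 := by
      change mfderiv 𝓘(ℝ, ℝ) (𝓡 m) (fun _ : ℝ => x) t (1 : ℝ) = 0
      rw [mfderiv_const]; rfl
    rw [mfderiv_const, e1]
    rw [(Ω _).map_coord_zero (m := ![0, v]) 0 rfl]
    exact neg_zero.symm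

/-- Smooth homotopy of Hamiltonian isotopies with fixed end points: a smooth two-parameter family
`Φ (s, t)` such that each `t ↦ Φ (s, t)` is a Hamiltonian isotopy based at the identity with time
one map independent of `s`. -/
def HamHomotopic (Ω : Form m M 2) (f g : HamIsotopy Ω) : Prop :=
  ∃ (Φ : DiffeoFamily m (ℝ × ℝ) M) (K : ℝ → ℝ → M → ℝ),
    ContMDiff (𝓘(ℝ, ℝ × ℝ).prod (𝓡 m)) 𝓘(ℝ, ℝ) ∞
      (fun q : (ℝ × ℝ) × M => K q.1.1 q.1.2 q.2) ∧
    (∀ s, IsGeneratedBy Ω (Φ.slice s) (K s)) ∧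
    (∀ s ∈ Set.Icc (0 : ℝ) 1, ∀ x, Φ.toFun (s, 0) x = x) ∧
    (∀ s ∈ Set.Icc (0 : ℝ) 1, ∀ x, Φ.toFun (s, 1) x = f.flow.toFun 1 x) ∧
    (∀ t ∈ Set.Icc (0 : ℝ) 1, ∀ x, Φ.toFun (0, t) x = f.flow.toFun t x) ∧
    (∀ t ∈ Set.Icc (0 : ℝ) 1, ∀ x, Φ.toFun (1, t) x = g.flow.toFun t x)

/-- The universal cover of the Hamiltonian group: Hamiltonian isotopies based at the identity
modulo homotopy with fixed end points. -/
def HamTilde (Ω : Form m M 2) : Type _ := Quot (HamHomotopic Ω)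

open Classical in
/-- The class of the Hamiltonian isotopy generated by the Hamiltonian `F`. (On a closed symplectic
manifold every smooth `F` generates exactly one Hamiltonian isotopy based at the identity.) -/
def hamClass (Ω : Form m M 2) (F : ℝ → M → ℝ) : HamTilde Ω :=
  if H : ∃ f : HamIsotopy Ω, f.ham = F then Quot.mk _ H.choose
    else Quot.mk _ (HamIsotopy.const Ω)

end Hamiltonian

/-! ### Integration against the volume form `Ωⁿ` -/

section Integration

variable {n : ℕ} {M : Type*} [TopologicalSpace M] [ChartedSpace (Euc (2 * n)) M]

/-- The density `|Ωⁿ (e₁, …, e₂ₙ)|` in the chart around `c`. The top power of a 2-form on a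
`2n`-dimensional space evaluates on a basis to `n!` times the Pfaffian of the Gram matrix, and the
square of the Pfaffian is the determinant. -/
def volumeDensity (Ω : Form (2 * n) M 2) (c : M) (y : Euc (2 * n)) : ℝ :=
  (n.factorial : ℝ) * Real.sqrt (Matrix.det (Matrix.of fun i j : Fin (2 * n) =>
    Ω.inChart c y ![EuclideanSpace.single i (1 : ℝ), EuclideanSpace.single j (1 : ℝ)]))

variable [IsManifold (𝓡 (2 * n)) ∞ M] [T2Space M] [CompactSpace M]

variable (n M) in
/-- A smooth partition of unity subordinate to the domains of the preferred charts. -/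
def chartPartition : SmoothPartitionOfUnity M (𝓡 (2 * n)) M Set.univ :=
  (SmoothPartitionOfUnity.exists_isSubordinate_chartAt_source (𝓡 (2 * n)) M).choose

/-- `∫_M f Ωⁿ`, where `M` is oriented by `Ωⁿ`. -/
def volumeIntegral (Ω : Form (2 * n) M 2) (f : M → ℝ) : ℝ :=
  ∑ᶠ c : M, ∫ y in (extChartAt (𝓡 (2 * n)) c).target,
    chartPartition n M c ((extChartAt (𝓡 (2 * n)) c).symm y) *
      f ((extChartAt (𝓡 (2 * n)) c).symm y) * volumeDensity Ω c y

/-- `Vol(M) = ∫_M Ωⁿ`. -/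
def totalVolume (Ω : Form (2 * n) M 2) : ℝ := volumeIntegral Ω (fun _ => 1)

/-- `X` is superheavy for the functional `ζ` on `C^∞(M)`:
`min_X H ≤ ζ(H) ≤ max_X H` for all smooth `H`. -/
def IsSuperheavy (ζ : C^∞⟮𝓡 (2 * n), M; ℝ⟯ → ℝ) (X : Set M) : Prop :=
  IsClosed X ∧ X.Nonempty ∧
    ∀ H : C^∞⟮𝓡 (2 * n), M; ℝ⟯, sInf (H '' X) ≤ ζ H ∧ ζ H ≤ sSup (H '' X)

/-- The functional `ζ` on `C^∞(M)` associated with a function `ν` on the universal cover of the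
Hamiltonian group: `ζ(H) = (∫_M H Ωⁿ - ν(φ_H)) / Vol(M)`. -/
def quasiState (Ω : Form (2 * n) M 2) (ν : HamTilde Ω → ℝ)
    (H : C^∞⟮𝓡 (2 * n), M; ℝ⟯) : ℝ :=
  (volumeIntegral Ω H - ν (hamClass Ω (fun _ => H))) / totalVolume Ω

end Integration

/-! ### Prequantizations -/

section Prequantization

variable {n : ℕ}
  {V : Type*} [TopologicalSpace V] [ChartedSpace (Euc (2 * n + 1)) V]
  {M : Type*} [TopologicalSpace M] [ChartedSpace (Euc (2 * n)) M]

/-- `π : (V, α) → (M, Ω)` is a prequantization: the Reeb flow of the contact form `α` is a free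
action of `ℝ / ℏℤ` on `V`, for some `ℏ > 0`, which makes `π` a smooth principal circle bundle
(the fibres of `π` are the orbits and `π` has smooth local sections), and `π^* Ω = dα`. -/
structure IsPrequantization (α : Form (2 * n + 1) V 1) (Ω : Form (2 * n) M 2) (π : V → M) :
    Prop where
  contact : IsContactForm α
  symplectic : IsSymplecticForm Ω
  smooth : ContMDiff (𝓡 (2 * n + 1)) (𝓡 (2 * n)) ∞ π
  pullback_form : ∀ x (u v : TangentSpace (𝓡 (2 * n + 1)) x),
    Ω (π x) ![mfderiv (𝓡 (2 * n + 1)) (𝓡 (2 * n)) π x u,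
      mfderiv (𝓡 (2 * n + 1)) (𝓡 (2 * n)) π x v] = α.d x ![u, v]
  principal : ∃ (ℏ : ℝ) (ρ : DiffeoFamily (2 * n + 1) ℝ V), 0 < ℏ ∧
    (∀ x, ρ.toFun 0 x = x) ∧
    (∀ s t x, ρ.toFun (s + t) x = ρ.toFun s (ρ.toFun t x)) ∧
    (∀ t x, α (ρ.toFun t x) ![ρ.velocity t x] = 1) ∧
    (∀ t x v, α.d (ρ.toFun t x) ![ρ.velocity t x, v] = 0) ∧
    (∀ t x, ρ.toFun t x = x ↔ ∃ k : ℤ, t = k * ℏ) ∧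
    (∀ x y, π x = π y ↔ ∃ t, ρ.toFun t x = y)
  local_section : ∀ p : M, ∃ (U : Set M) (σ : M → V), IsOpen U ∧ p ∈ U ∧
    ContMDiffOn (𝓡 (2 * n)) (𝓡 (2 * n + 1)) ∞ σ U ∧ ∀ q ∈ U, π (σ q) = q

variable [IsManifold (𝓡 (2 * n)) ∞ M] [T2Space M] [CompactSpace M]

/-- The splitting `σ(F) = π^* F - (∫_M F Ωⁿ) / Vol(M)`. -/
def sigma (Ω : Form (2 * n) M 2) (π : V → M) (F : ℝ → M → ℝ) : ℝ → V → ℝ := fun t x =>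
  F t (π x) - volumeIntegral Ω (F t) / totalVolume Ω

/-- The homomorphism `π^*` from the universal cover of the Hamiltonian group to the universal cover
of the identity component of the contactomorphism group, `φ_F ↦ φ_{σ(F)}`. (The value does not
depend on the chosen Hamiltonian isotopy in the class.) -/
def pullback (α : Form (2 * n + 1) V 1) (Ω : Form (2 * n) M 2) (π : V → M) (a : HamTilde Ω) :
    ContTilde α :=
  contactClass α (sigma Ω π (Quot.out a).ham)

/-- The quasi-morphism `μ_M = -(Vol(M) / μ(φ_1)) (μ ∘ π^*)` induced by `μ`. -/
def inducedQuasimorphism (α : Form (2 * n + 1) V 1) (Ω : Form (2 * n) M 2) (π : V → M)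
    (μ : ContTilde α → ℝ) : HamTilde Ω → ℝ := fun a =>
  -(totalVolume Ω / μ (contactClass α (fun _ _ => 1))) * μ (pullback α Ω π a)

end Prequantization

end Prequant

end

section

open Set Metric Filter Topology

/-! ### Smooth dependence of solutions of ordinary differential equations on initial values -/

section Flow

universe u

variable {E : Type u} [NormedAddCommGroup E] [NormedSpace ℝ E]

/-! Everything rests on the identity `quasiState_eq`: ζ(H) = μ(φ_{H∘π}) / μ(φ_1). Given it, both
claims are monotonicity arguments. If Y is subheavy and H ≤ a on π(Y), then H ≤ χ(H - a) + a + ε,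
where χ is a smooth approximation of the positive part. The function χ(H∘π - a) vanishes on Y, so
its class has μ = 0. Monotonicity and the rule μ(φ_{H∘π + c}) = μ(φ_{H∘π}) + c μ(φ_1) then give ζ(H)
≤ a + ε; the lower bound is symmetric. If X is superheavy and h > 0 on the preimage of X, there is a
smooth H on M with H∘π ≤ h everywhere and H a positive constant on X, so μ(φ_h) ≥ μ(φ_{H∘π}) = ζ(H)
μ(φ_1) > 0.

The rule for constants (`contactClass_basic_add`) holds because isotopies generated by basic
functions preserve α and commute with the Reeb flow, and a homogeneous quasi-morphism is additive on
commuting elements. Moreover μ(φ_1) > 0 (`map_path_one_pos`): every contact Hamiltonian on [0,1] × V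
lies between two constants, so μ(φ_1) = 0 would force μ = 0.

The delicate point is that `pullback` evaluates σ on an arbitrary representative of a class in the
universal cover of the Hamiltonian group. That μ does not depend on it is `contactClass_sigma_eq`.
Let Φ(s,t) be a homotopy with fixed end points, K its normalized Hamiltonians, Ψ the flow of K∘π on
V, and w = α(∂_s Ψ). Cartan's formula gives ∂_t w = (∂_s K)∘Φ∘π. At t = 1 the vector ∂_s Ψ is
vertical, hence equals w R; as Ψ preserves α, w is constant on V. This constant is the time integral
of (∂_s K)∘Φ, which has mean zero because Φ preserves volume and K is normalized. Thus w = 0, the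
end points of the lifts do not move, and Ψ is a homotopy in the contactomorphism group.

The classes of isotopies are chosen by existence, with a default value otherwise, so isotopies must
be constructed for all smooth Hamiltonians, smoothly in parameters. This is why the file develops
smooth dependence for ordinary differential equations, flows on manifolds, naturality of the
exterior derivative and the symplectic volume integral. Uniqueness of the contact isotopy with a
given Hamiltonian is never needed: two such isotopies have equal μ by monotonicity in both
directions (`eq_of_hamiltonian_eq`). -/

theorem Convex.norm_sub_sub_fderiv_le {f : E → E} {f' : E → E →L[ℝ] E} {s : Set E} {K : ℝ}
    (hs : Convex ℝ s) (hf : ∀ x ∈ s, HasFDerivAt f (f' x) x)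
    (hf' : ∀ x ∈ s, ∀ y ∈ s, ‖f' x - f' y‖ ≤ K * ‖x - y‖) (hK : 0 ≤ K)
    {a b : E} (ha : a ∈ s) (hb : b ∈ s) :
    ‖f b - f a - f' a (b - a)‖ ≤ K * ‖b - a‖ ^ 2 := by
  have hsub : segment ℝ a b ⊆ s := hs.segment_subset ha hb
  have := Convex.norm_image_sub_le_of_norm_hasFDerivWithin_le' (f := f) (f' := f') (φ := f' a)
    (C := K * ‖b - a‖) (s := segment ℝ a b)
    (fun x hx => (hf x (hsub hx)).hasFDerivWithinAt)
    (fun x hx => (hf' x (hsub hx) a ha).trans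
      (mul_le_mul_of_nonneg_left (norm_sub_le_of_mem_segment hx) hK))
    (convex_segment a b) (left_mem_segment ℝ a b) (right_mem_segment ℝ a b)
  calc _ ≤ K * ‖b - a‖ * ‖b - a‖ := this
    _ = _ := by ring

/-- The solution of the linearized equation approximates the difference of two solutions to second
order. -/
theorem norm_sub_sub_linearized_le_forward {f : E → E} {f' : E → E →L[ℝ] E} {s : Set E} {K T : ℝ}
    (hs : Convex ℝ s) (hf : ∀ x ∈ s, HasFDerivAt f (f' x) x) (hK : 0 < K)
    (hf' : ∀ x ∈ s, ∀ y ∈ s, ‖f' x - f' y‖ ≤ K * ‖x - y‖) (hb : ∀ x ∈ s, ‖f' x‖ ≤ K)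
    {x y : ℝ → E} {χ : ℝ → E →L[ℝ] E}
    (hx : ∀ t ∈ Icc 0 T, HasDerivAt x (f (x t)) t) (hxs : ∀ t ∈ Icc 0 T, x t ∈ s)
    (hy : ∀ t ∈ Icc 0 T, HasDerivAt y (f (y t)) t) (hys : ∀ t ∈ Icc 0 T, y t ∈ s)
    (hχ : ∀ t ∈ Icc 0 T, HasDerivAt χ ((f' (x t)).comp (χ t)) t)
    (hχ0 : χ 0 = ContinuousLinearMap.id ℝ E) {t : ℝ} (ht : t ∈ Icc 0 T) :
    ‖y t - x t - χ t (y 0 - x 0)‖ ≤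
      K * (Real.exp (K * T)) ^ 2 / K * Real.exp (K * T) * ‖y 0 - x 0‖ ^ 2 := by
  have hlip : LipschitzOnWith K.toNNReal f s := by
    refine hs.lipschitzOnWith_of_nnnorm_hasFDerivWithin_le
      (fun z hz => (hf z hz).hasFDerivWithinAt) fun z hz => ?_
    rw [← NNReal.coe_le_coe, Real.coe_toNNReal _ hK.le]
    exact hb z hz
  have hT : ∀ {τ}, τ ∈ Ico 0 T → τ ∈ Icc 0 T := fun h => Ico_subset_Icc_self h
  have hdist : ∀ τ ∈ Icc 0 T, ‖y τ - x τ‖ ≤ ‖y 0 - x 0‖ * Real.exp (K * T) := by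
    intro τ hτ
    have := dist_le_of_trajectories_ODE_of_mem (v := fun _ => f) (s := fun _ => s)
      (fun _ _ => hlip) (fun τ hτ => (hy τ hτ).continuousAt.continuousWithinAt)
      (fun τ hτ => (hy τ (hT hτ)).hasDerivWithinAt) (fun τ hτ => hys τ (hT hτ))
      (fun τ hτ => (hx τ hτ).continuousAt.continuousWithinAt)
      (fun τ hτ => (hx τ (hT hτ)).hasDerivWithinAt) (fun τ hτ => hxs τ (hT hτ)) le_rfl τ hτ
    rw [dist_eq_norm, dist_eq_norm, Real.coe_toNNReal _ hK.le, sub_zero] at this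
    refine this.trans (mul_le_mul_of_nonneg_left ?_ (norm_nonneg _))
    exact Real.exp_le_exp.2 (mul_le_mul_of_nonneg_left hτ.2 hK.le)
  have hder : ∀ τ ∈ Icc 0 T, HasDerivAt (fun t => y t - x t - χ t (y 0 - x 0))
      (f (y τ) - f (x τ) - (f' (x τ)) (χ τ (y 0 - x 0))) τ := fun τ hτ => by
    have h1 : HasDerivAt (fun t => χ t (y 0 - x 0)) (((f' (x τ)).comp (χ τ)) (y 0 - x 0)) τ := by
      have := (hχ τ hτ).clm_apply (hasDerivAt_const τ (y 0 - x 0))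
      simpa using this
    exact ((hy τ hτ).sub (hx τ hτ)).sub h1
  -- The error y - x - χ(y₀ - x₀) solves the linearized equation up to the Taylor remainder of f,
  -- which is quadratic in y - x and hence, by `hdist`, in y₀ - x₀. Grönwall with initial value 0
  -- gives the bound.
  have key := norm_le_gronwallBound_of_norm_deriv_right_le
    (f := fun t => y t - x t - χ t (y 0 - x 0)) (δ := 0) (K := K)
    (ε := K * (‖y 0 - x 0‖ * Real.exp (K * T)) ^ 2) (a := 0) (b := T)
    (fun τ hτ => (hder τ hτ).continuousAt.continuousWithinAt)
    (fun τ hτ => (hder τ (hT hτ)).hasDerivWithinAt) (by simp [hχ0])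
    (fun τ hτ => by
      have h1 := hs.norm_sub_sub_fderiv_le hf hf' hK.le (hxs τ (hT hτ)) (hys τ (hT hτ))
      have e : f (y τ) - f (x τ) - (f' (x τ)) (χ τ (y 0 - x 0)) =
          f' (x τ) (y τ - x τ - χ τ (y 0 - x 0)) + (f (y τ) - f (x τ) - f' (x τ) (y τ - x τ)) := by
        simp only [map_sub]; abel
      rw [e]
      refine (norm_add_le _ _).trans (add_le_add ?_ (h1.trans ?_))
      · exact ((f' (x τ)).le_opNorm _).trans
          (mul_le_mul_of_nonneg_right (hb _ (hxs τ (hT hτ))) (norm_nonneg _))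
      · refine mul_le_mul_of_nonneg_left ?_ hK.le
        exact pow_le_pow_left₀ (norm_nonneg _) (hdist τ (hT hτ)) 2) t ht
  refine key.trans ?_
  rw [gronwallBound_of_K_ne_0 hK.ne', sub_zero]
  simp only [zero_mul, zero_add]
  have h1 : Real.exp (K * t) - 1 ≤ Real.exp (K * T) := by
    have := Real.exp_le_exp.2 (mul_le_mul_of_nonneg_left ht.2 hK.le)
    linarith
  calc K * (‖y 0 - x 0‖ * Real.exp (K * T)) ^ 2 / K * (Real.exp (K * t) - 1)
      ≤ K * (‖y 0 - x 0‖ * Real.exp (K * T)) ^ 2 / K * Real.exp (K * T) :=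
        mul_le_mul_of_nonneg_left h1 (by positivity)
    _ = _ := by ring

/-- Negative times reduce to positive ones by reversing time and replacing f by -f. -/
theorem norm_sub_sub_linearized_le {f : E → E} {f' : E → E →L[ℝ] E} {s : Set E} {K T : ℝ}
    (hs : Convex ℝ s) (hf : ∀ x ∈ s, HasFDerivAt f (f' x) x) (hK : 0 < K)
    (hf' : ∀ x ∈ s, ∀ y ∈ s, ‖f' x - f' y‖ ≤ K * ‖x - y‖) (hb : ∀ x ∈ s, ‖f' x‖ ≤ K)
    {x y : ℝ → E} {χ : ℝ → E →L[ℝ] E}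
    (hx : ∀ t ∈ Icc (-T) T, HasDerivAt x (f (x t)) t) (hxs : ∀ t ∈ Icc (-T) T, x t ∈ s)
    (hy : ∀ t ∈ Icc (-T) T, HasDerivAt y (f (y t)) t) (hys : ∀ t ∈ Icc (-T) T, y t ∈ s)
    (hχ : ∀ t ∈ Icc (-T) T, HasDerivAt χ ((f' (x t)).comp (χ t)) t)
    (hχ0 : χ 0 = ContinuousLinearMap.id ℝ E) {t : ℝ} (ht : t ∈ Icc (-T) T) :
    ‖y t - x t - χ t (y 0 - x 0)‖ ≤
      K * (Real.exp (K * T)) ^ 2 / K * Real.exp (K * T) * ‖y 0 - x 0‖ ^ 2 := by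
  rcases le_total 0 t with h0 | h0
  · have hT : ∀ {τ}, τ ∈ Icc 0 T → τ ∈ Icc (-T) T := fun {τ} h =>
      ⟨by linarith [h.1, h.2, ht.2], h.2⟩
    exact norm_sub_sub_linearized_le_forward hs hf hK hf' hb (fun τ h => hx τ (hT h))
      (fun τ h => hxs τ (hT h)) (fun τ h => hy τ (hT h)) (fun τ h => hys τ (hT h))
      (fun τ h => hχ τ (hT h)) hχ0 ⟨h0, ht.2⟩
  · have hT : ∀ {τ}, τ ∈ Icc 0 T → -τ ∈ Icc (-T) T := fun {τ} h =>
      ⟨by linarith [h.1, h.2], by linarith [h.1, h.2]⟩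
    have := norm_sub_sub_linearized_le_forward (f := fun z => -f z) (f' := fun z => -f' z)
      (x := fun τ => x (-τ)) (y := fun τ => y (-τ)) (χ := fun τ => χ (-τ)) (T := T) (t := -t) hs
      (fun z hz => (hf z hz).neg) hK
      (fun z hz w hw => by
        rw [neg_sub_neg, ← norm_neg, neg_sub]; exact hf' z hz w hw)
      (fun z hz => by rw [norm_neg]; exact hb z hz)
      (fun τ h => by simpa [Function.comp_def] using (hx _ (hT h)).scomp τ (hasDerivAt_neg τ))
      (fun τ h => hxs _ (hT h))
      (fun τ h => by simpa [Function.comp_def] using (hy _ (hT h)).scomp τ (hasDerivAt_neg τ))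
      (fun τ h => hys _ (hT h))
      (fun τ h => by simpa [Function.comp_def, ContinuousLinearMap.neg_comp] using (hχ _ (hT h)).scomp τ (hasDerivAt_neg τ))
      (by simpa using hχ0) ⟨by linarith, by linarith [ht.1]⟩
    simpa using this

/-- `ψ` is a `C^n` local flow of the vector field `f` on the ball of radius `r` around `x₀`, for
times in `(-ε, ε)`, staying in the set `W`. -/
structure IsLocalFlow (n : ℕ) (f : E → E) (W : Set E) (x₀ : E) (ε r : ℝ) (ψ : ℝ × E → E) :
    Prop where
  time_pos : 0 < ε
  radius_pos : 0 < r
  init : ∀ x ∈ ball x₀ r, ψ (0, x) = x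
  deriv : ∀ t ∈ Ioo (-ε) ε, ∀ x ∈ ball x₀ r, HasDerivAt (fun τ => ψ (τ, x)) (f (ψ (t, x))) t
  smooth : ContDiffOn ℝ n ψ (Ioo (-ε) ε ×ˢ ball x₀ r)
  mapsTo : ∀ t ∈ Ioo (-ε) ε, ∀ x ∈ ball x₀ r, ψ (t, x) ∈ W

theorem IsLocalFlow.mono {n : ℕ} {f : E → E} {W : Set E} {x₀ : E} {ε r ε' r' : ℝ} {ψ : ℝ × E → E}
    (h : IsLocalFlow n f W x₀ ε r ψ) (hε' : 0 < ε') (hε : ε' ≤ ε) (hr' : 0 < r') (hr : r' ≤ r) :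
    IsLocalFlow n f W x₀ ε' r' ψ := by
  have h1 : Ioo (-ε') ε' ⊆ Ioo (-ε) ε := Ioo_subset_Ioo (by linarith) hε
  have h2 : ball x₀ r' ⊆ ball x₀ r := ball_subset_ball hr
  exact ⟨hε', hr', fun x hx => h.init x (h2 hx), fun t ht x hx => h.deriv t (h1 ht) x (h2 hx),
    h.smooth.mono (prod_mono h1 h2), fun t ht x hx => h.mapsTo t (h1 ht) x (h2 hx)⟩

theorem IsLocalFlow.confine {n : ℕ} {f : E → E} {W W' : Set E} {x₀ : E} {ε r : ℝ} {ψ : ℝ × E → E}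
    (h : IsLocalFlow n f W x₀ ε r ψ) (hW : W' ∈ 𝓝 x₀) :
    ∃ ε' > 0, ∃ r' > 0, ε' ≤ ε ∧ r' ≤ r ∧ IsLocalFlow n f W' x₀ ε' r' ψ := by
  have hmem : Ioo (-ε) ε ×ˢ ball x₀ r ∈ 𝓝 ((0 : ℝ), x₀) :=
    prod_mem_nhds (Ioo_mem_nhds (by linarith [h.time_pos]) h.time_pos) (ball_mem_nhds _ h.radius_pos)
  have hc : ContinuousAt ψ (0, x₀) := h.smooth.continuousOn.continuousAt hmem
  have hp : ψ ⁻¹' W' ∈ 𝓝 ((0 : ℝ), x₀) := hc (by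
    rwa [h.init x₀ (mem_ball_self h.radius_pos)])
  obtain ⟨δ, hδ, hsub⟩ := Metric.mem_nhds_iff.1 hp
  refine ⟨min ε δ, lt_min h.time_pos hδ, min r δ, lt_min h.radius_pos hδ, min_le_left _ _,
    min_le_left _ _, ?_⟩
  have hm := h.mono (lt_min h.time_pos hδ) (min_le_left _ _) (lt_min h.radius_pos hδ)
    (min_le_left _ _)
  refine ⟨hm.time_pos, hm.radius_pos, hm.init, hm.deriv, hm.smooth, fun t ht x hx => hsub ?_⟩
  rw [← ball_prod_same]
  refine ⟨?_, ball_subset_ball (min_le_right _ _) hx⟩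
  rw [Real.ball_eq_Ioo, zero_sub, zero_add]
  exact ⟨by linarith [ht.1, min_le_right ε δ], ht.2.trans_le (min_le_right _ _)⟩

theorem exists_isLocalFlow_zero [CompleteSpace E] {f : E → E} {W : Set E} (hW : IsOpen W)
    (hf : ContDiffOn ℝ ∞ f W) {x₀ : E} (hx₀ : x₀ ∈ W) :
    ∃ ε r ψ, IsLocalFlow 0 f W x₀ ε r ψ := by
  have hf1 : ContDiffAt ℝ 1 f x₀ := (hf.contDiffAt (hW.mem_nhds hx₀)).of_le (by
    exact_mod_cast le_top)
  obtain ⟨ε, hε, a, r, L, K, hr, hpl⟩ := IsPicardLindelof.of_contDiffAt_one hf1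
  obtain ⟨φ, h1, h2⟩ := (hpl 0).exists_forall_mem_closedBall_eq_hasDerivWithinAt_continuousOn
  have hflow : IsLocalFlow 0 f univ x₀ ε r (fun p => φ (p.2, p.1)) := by
    refine ⟨hε, hr, fun x hx => (h1 x (ball_subset_closedBall hx)).1, fun t ht x hx => ?_, ?_,
      fun _ _ _ _ => mem_univ _⟩
    · have := (h1 x (ball_subset_closedBall hx)).2 t (by
        rw [zero_sub, zero_add]; exact Ioo_subset_Icc_self ht)
      rw [zero_sub, zero_add] at this
      exact this.hasDerivAt (Icc_mem_nhds ht.1 ht.2)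
    · rw [Nat.cast_zero, contDiffOn_zero]
      refine h2.comp (continuous_swap.continuousOn) fun p hp => ⟨ball_subset_closedBall hp.2, ?_⟩
      rw [zero_sub, zero_add]
      exact Ioo_subset_Icc_self hp.1
  obtain ⟨ε', _, r', _, _, _, h⟩ := hflow.confine (hW.mem_nhds hx₀)
  exact ⟨ε', r', _, h⟩

theorem exists_ball_fderiv_bounds {f : E → E} {W : Set E} (hW : IsOpen W)
    (hf : ContDiffOn ℝ ∞ f W) {x₀ : E} (hx₀ : x₀ ∈ W) :
    ∃ δ > 0, ball x₀ δ ⊆ W ∧ ∃ K > 0, (∀ x ∈ ball x₀ δ, ‖fderiv ℝ f x‖ ≤ K) ∧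
      ∀ x ∈ ball x₀ δ, ∀ y ∈ ball x₀ δ, ‖fderiv ℝ f x - fderiv ℝ f y‖ ≤ K * ‖x - y‖ := by
  have hf' : ContDiffOn ℝ ∞ (fderiv ℝ f) W := hf.fderiv_of_isOpen hW (by simp)
  have h1 : ContDiffAt ℝ 1 (fderiv ℝ f) x₀ := (hf'.contDiffAt (hW.mem_nhds hx₀)).of_le (by
    exact_mod_cast le_top)
  obtain ⟨K, s, hs, hK⟩ := h1.exists_lipschitzOnWith
  have hbd : {x | ‖fderiv ℝ f x‖ < ‖fderiv ℝ f x₀‖ + 1} ∈ 𝓝 x₀ :=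
    h1.continuousAt.norm.eventually_lt continuousAt_const (lt_add_one _)
  obtain ⟨δ, hδ, hsub⟩ := Metric.mem_nhds_iff.1 (inter_mem (inter_mem hs hbd) (hW.mem_nhds hx₀))
  have hKn : (0 : ℝ) ≤ K := K.2
  refine ⟨δ, hδ, fun x hx => (hsub hx).2, K + ‖fderiv ℝ f x₀‖ + 1, by positivity,
    fun x hx => ?_, fun x hx y hy => ?_⟩
  · have := (hsub hx).1.2
    rw [mem_ofPred_eq] at this
    linarith
  · have := hK.dist_le_mul x (hsub hx).1.1 y (hsub hy).1.1
    rw [dist_eq_norm, dist_eq_norm] at this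
    refine this.trans (mul_le_mul_of_nonneg_right ?_ (norm_nonneg _))
    linarith [norm_nonneg (fderiv ℝ f x₀)]

/-- The spatial derivative of a flow solves the variational equation. If the coupled system for the
point and the derivative has a C^n flow, both partial derivatives of the first component, f∘ψ in
time and χ in space, are C^n, so the first component is C^(n+1). -/
theorem IsLocalFlow.succ_of_variational {n : ℕ} {f : E → E} {x₀ : E} {δ K ε r : ℝ}
    {Ψ : ℝ × (E × (E →L[ℝ] E)) → E × (E →L[ℝ] E)} (hf : ContDiffOn ℝ ∞ f (ball x₀ δ)) (hK : 0 < K)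
    (hb : ∀ x ∈ ball x₀ δ, ‖fderiv ℝ f x‖ ≤ K)
    (hf' : ∀ x ∈ ball x₀ δ, ∀ y ∈ ball x₀ δ, ‖fderiv ℝ f x - fderiv ℝ f y‖ ≤ K * ‖x - y‖)
    (h : IsLocalFlow n (fun z : E × (E →L[ℝ] E) => (f z.1, (fderiv ℝ f z.1).comp z.2))
      (ball x₀ δ ×ˢ univ) (x₀, ContinuousLinearMap.id ℝ E) ε r Ψ) :
    IsLocalFlow (n + 1) f (ball x₀ δ) x₀ (ε / 2) r
      (fun p => (Ψ (p.1, (p.2, ContinuousLinearMap.id ℝ E))).1) := by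
  set ψ : ℝ × E → E := fun p => (Ψ (p.1, (p.2, ContinuousLinearMap.id ℝ E))).1 with hψ
  set χ : ℝ × E → E →L[ℝ] E := fun p => (Ψ (p.1, (p.2, ContinuousLinearMap.id ℝ E))).2 with hχ
  have hε := h.time_pos
  have hball : ∀ {x}, x ∈ ball x₀ r →
      (x, ContinuousLinearMap.id ℝ E) ∈ ball (x₀, ContinuousLinearMap.id ℝ E) r := by
    intro x hx
    rw [← ball_prod_same]
    exact ⟨hx, mem_ball_self h.radius_pos⟩
  have hψd : ∀ t ∈ Ioo (-ε) ε, ∀ x ∈ ball x₀ r,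
      HasDerivAt (fun τ => ψ (τ, x)) (f (ψ (t, x))) t := fun t ht x hx =>
    (h.deriv t ht _ (hball hx)).fst
  have hχd : ∀ t ∈ Ioo (-ε) ε, ∀ x ∈ ball x₀ r,
      HasDerivAt (fun τ => χ (τ, x)) ((fderiv ℝ f (ψ (t, x))).comp (χ (t, x))) t :=
    fun t ht x hx => (h.deriv t ht _ (hball hx)).snd
  have hmaps : ∀ t ∈ Ioo (-ε) ε, ∀ x ∈ ball x₀ r, ψ (t, x) ∈ ball x₀ δ := fun t ht x hx =>
    (h.mapsTo t ht _ (hball hx)).1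
  -- The estimate for the linearized equation needs a closed time interval, hence the halved time.
  have hsub : Icc (-(ε / 2)) (ε / 2) ⊆ Ioo (-ε) ε := fun t ht =>
    ⟨by linarith [ht.1], by linarith [ht.2]⟩
  have hsub' : Ioo (-(ε / 2)) (ε / 2) ⊆ Ioo (-ε) ε := Ioo_subset_Icc_self.trans hsub
  have hΨ : ContDiffOn ℝ n (fun p : ℝ × E => Ψ (p.1, (p.2, ContinuousLinearMap.id ℝ E)))
      (Ioo (-ε) ε ×ˢ ball x₀ r) :=
    h.smooth.comp (contDiff_fst.prodMk (contDiff_snd.prodMk contDiff_const)).contDiffOn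
      fun p hp => ⟨hp.1, hball hp.2⟩
  have hψn : ContDiffOn ℝ n ψ (Ioo (-ε) ε ×ˢ ball x₀ r) := hΨ.fst
  have hχn : ContDiffOn ℝ n χ (Ioo (-ε) ε ×ˢ ball x₀ r) := hΨ.snd
  -- The error of the linear approximation by χ is O(‖y - x‖²), so χ is the spatial derivative.
  have hψx : ∀ t ∈ Ioo (-(ε / 2)) (ε / 2), ∀ x ∈ ball x₀ r,
      HasFDerivAt (fun y => ψ (t, y)) (χ (t, x)) x := by
    intro t ht x hx
    have hO : (fun y => ψ (t, y) - ψ (t, x) - χ (t, x) (y - x)) =O[𝓝 x]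
        fun y => ‖y - x‖ ^ 2 := by
      refine Asymptotics.IsBigO.of_bound
        (K * (Real.exp (K * (ε / 2))) ^ 2 / K * Real.exp (K * (ε / 2))) ?_
      filter_upwards [isOpen_ball.mem_nhds hx] with y hy
      have := norm_sub_sub_linearized_le (f := f) (f' := fderiv ℝ f) (T := ε / 2)
        (x := fun τ => ψ (τ, x)) (y := fun τ => ψ (τ, y)) (χ := fun τ => χ (τ, x))
        (convex_ball x₀ δ)
        (fun z hz => ((hf.contDiffAt (isOpen_ball.mem_nhds hz)).differentiableAt
          (by simp)).hasFDerivAt)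
        hK hf' hb
        (fun τ hτ => hψd τ (hsub hτ) x hx) (fun τ hτ => hmaps τ (hsub hτ) x hx)
        (fun τ hτ => hψd τ (hsub hτ) y hy) (fun τ hτ => hmaps τ (hsub hτ) y hy)
        (fun τ hτ => hχd τ (hsub hτ) x hx)
        (by simp only [hχ]; rw [h.init _ (hball hx)]) (Ioo_subset_Icc_self ht)
      have e : ∀ {z}, z ∈ ball x₀ r → ψ (0, z) = z := fun hz => by
        simp only [hψ]; rw [h.init _ (hball hz)]
      simp only [e hx, e hy] at this
      rwa [norm_pow, norm_norm]
    have h1 := hO.hasFDerivAt (𝕜 := ℝ) one_lt_two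
    have h2 : HasFDerivAt (fun y => ψ (t, x) + χ (t, x) (y - x)) (χ (t, x)) x :=
      (((χ (t, x)).hasFDerivAt).comp x ((hasFDerivAt_id x).sub_const x)).const_add _
    have h3 := h1.add h2
    rw [zero_add] at h3
    refine h3.congr_of_eventuallyEq (Eventually.of_forall fun y => ?_)
    simp
  have hopen : IsOpen (Ioo (-(ε / 2)) (ε / 2) ×ˢ ball x₀ r) := isOpen_Ioo.prod isOpen_ball
  have hfull : ∀ p ∈ Ioo (-(ε / 2)) (ε / 2) ×ˢ ball x₀ r,
      HasFDerivAt ψ (((1 : ℝ →L[ℝ] ℝ).smulRight (f (ψ p))).coprod (χ p)) p := by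
    intro p hp
    have hsmall : Ioo (-ε) ε ×ˢ ball x₀ r ∈ 𝓝 p :=
      mem_of_superset (hopen.mem_nhds hp) (prod_mono hsub' Subset.rfl)
    have hψc : ContinuousAt ψ p := hψn.continuousOn.continuousAt hsmall
    have hχc : ContinuousAt χ p := hχn.continuousOn.continuousAt hsmall
    have hfc : ContinuousAt (fun q => f (ψ q)) p :=
      ContinuousAt.comp (g := f) ((hf.continuousOn).continuousAt
        (isOpen_ball.mem_nhds (hmaps _ (hsub' hp.1) _ hp.2))) hψc
    exact (hasStrictFDerivAt_uncurry_coprod (u := p) (f := fun t x => ψ (t, x))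
      (f₁ := fun t x => (1 : ℝ →L[ℝ] ℝ).smulRight (f (ψ (t, x)))) (f₂ := fun t x => χ (t, x))
      (by
        filter_upwards [hopen.mem_nhds hp] with q hq
        exact (hψd q.1 (hsub' hq.1) q.2 hq.2).hasFDerivAt)
      (by
        filter_upwards [hopen.mem_nhds hp] with q hq
        exact hψx q.1 hq.1 q.2 hq.2)
      (ContinuousAt.comp (g := fun v => ContinuousLinearMap.smulRightL ℝ ℝ E (1 : ℝ →L[ℝ] ℝ) v)
        (ContinuousLinearMap.continuous _).continuousAt hfc)
      hχc).hasFDerivAt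
  refine ⟨by positivity, h.radius_pos, fun x hx => by simp only [hψ]; rw [h.init _ (hball hx)],
    fun t ht x hx => hψd t (hsub' ht) x hx, ?_, fun t ht x hx => hmaps t (hsub' ht) x hx⟩
  have hmono : Ioo (-(ε / 2)) (ε / 2) ×ˢ ball x₀ r ⊆ Ioo (-ε) ε ×ˢ ball x₀ r :=
    prod_mono hsub' Subset.rfl
  rw [Nat.cast_add, Nat.cast_one, contDiffOn_succ_iff_fderiv_of_isOpen hopen]
  refine ⟨fun p hp => (hfull p hp).differentiableAt.differentiableWithinAt, by simp, ?_⟩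
  have hfψ : ContDiffOn ℝ n (fun p => f (ψ p)) (Ioo (-(ε / 2)) (ε / 2) ×ˢ ball x₀ r) :=
    (hf.of_le (by exact_mod_cast le_top)).comp (hψn.mono hmono)
      fun p hp => hmaps _ (hsub' hp.1) _ hp.2
  have : ContDiffOn ℝ n (fun p => ((1 : ℝ →L[ℝ] ℝ).smulRight (f (ψ p))).coprod (χ p))
      (Ioo (-(ε / 2)) (ε / 2) ×ˢ ball x₀ r) := by
    have e : (fun p => ((1 : ℝ →L[ℝ] ℝ).smulRight (f (ψ p))).coprod (χ p)) = fun p =>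
        (ContinuousLinearMap.smulRightL ℝ ℝ E (1 : ℝ →L[ℝ] ℝ) (f (ψ p))).comp
          (ContinuousLinearMap.fst ℝ ℝ E) + (χ p).comp (ContinuousLinearMap.snd ℝ ℝ E) := by
      ext <;> simp
    rw [e]
    exact (((ContinuousLinearMap.contDiff _).comp_contDiffOn hfψ).clm_comp contDiffOn_const).add
      ((hχn.mono hmono).clm_comp contDiffOn_const)
  exact this.congr fun p hp => (hfull p hp).fderiv

/-- A smooth vector field on an open subset of a Banach space has local flows of every finite
differentiability class. -/
theorem exists_isLocalFlow (n : ℕ) : ∀ {E : Type u} [NormedAddCommGroup E] [NormedSpace ℝ E]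
    [CompleteSpace E] {f : E → E} {W : Set E}, IsOpen W → ContDiffOn ℝ ∞ f W →
    ∀ {x₀ : E}, x₀ ∈ W → ∃ ε r ψ, IsLocalFlow n f W x₀ ε r ψ := by
  induction n with
  | zero => exact fun hW hf _ hx₀ => exists_isLocalFlow_zero hW hf hx₀
  | succ n ih =>
    intro E _ _ _ f W hW hf x₀ hx₀
    obtain ⟨δ, hδ, hsub, K, hK, hb, hf'⟩ := exists_ball_fderiv_bounds hW hf hx₀
    have hfδ := hf.mono hsub
    have hfd : ContDiffOn ℝ ∞ (fderiv ℝ f) (ball x₀ δ) := hfδ.fderiv_of_isOpen isOpen_ball (by simp)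
    -- The induction quantifies over all Banach spaces in the universe, so it applies to the
    -- variational system on E × (E →L[ℝ] E), which is again smooth.
    obtain ⟨ε, r, Ψ, h⟩ := ih (E := E × (E →L[ℝ] E))
      (f := fun z : E × (E →L[ℝ] E) => (f z.1, (fderiv ℝ f z.1).comp z.2))
      (W := ball x₀ δ ×ˢ univ) (isOpen_ball.prod isOpen_univ)
      ((hfδ.comp contDiffOn_fst fun z hz => hz.1).prodMk
        ((hfd.comp contDiffOn_fst fun z hz => hz.1).clm_comp contDiffOn_snd))
      (x₀ := (x₀, ContinuousLinearMap.id ℝ E)) ⟨mem_ball_self hδ, mem_univ _⟩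
    have := h.succ_of_variational hfδ hK hb hf'
    exact ⟨_, _, _, this.time_pos, this.radius_pos, this.init, this.deriv, this.smooth,
      fun t ht x hx => hsub (this.mapsTo t ht x hx)⟩

end Flow

end

section

open Set Metric Filter Topology Bundle

set_option linter.unusedSectionVars false

/-! ### Smoothness of global flows on manifolds -/

section ManifoldFlow

variable {E : Type*} [NormedAddCommGroup E] [NormedSpace ℝ E]
  {H : Type*} [TopologicalSpace H] {I : ModelWithCorners ℝ E H} [I.Boundaryless]
  {N : Type*} [TopologicalSpace N] [ChartedSpace H N] [IsManifold I ∞ N]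

theorem contDiffOn_mfderiv_extChartAt_vectorField {v : (x : N) → TangentSpace I x}
    (hv : ContMDiff I I.tangent ∞ (fun x => (⟨x, v x⟩ : TangentBundle I N))) (z : N) :
    ContDiffOn ℝ ∞ (fun y => (mfderiv I 𝓘(ℝ, E) (extChartAt I z) ((extChartAt I z).symm y)
      (v ((extChartAt I z).symm y)) : E)) (extChartAt I z).target := by
  have hsrc : IsOpen (extChartAt I z).source := isOpen_extChartAt_source z
  have h1 : ContMDiffOn I.tangent 𝓘(ℝ, E).tangent ∞
      (tangentMapWithin I 𝓘(ℝ, E) (extChartAt I z) (extChartAt I z).source)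
      (TotalSpace.proj ⁻¹' (extChartAt I z).source) := by
    have : ContMDiffOn I 𝓘(ℝ, E) ∞ (extChartAt I z) (extChartAt I z).source := by
      rw [extChartAt_source]; exact contMDiffOn_extChartAt
    exact this.contMDiffOn_tangentMapWithin (m := ∞) le_rfl hsrc.uniqueMDiffOn
  have h2 : ContMDiffOn 𝓘(ℝ, E) I.tangent ∞
      (fun y => (⟨(extChartAt I z).symm y, v ((extChartAt I z).symm y)⟩ : TangentBundle I N))
      (extChartAt I z).target := hv.comp_contMDiffOn (contMDiffOn_extChartAt_symm z)
  have h3 := h1.comp h2 fun y hy => (extChartAt I z).map_target hy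
  have h4 := (contMDiff_snd_tangentBundle_modelSpace E 𝓘(ℝ, E) (n := ∞)).comp_contMDiffOn h3
  rw [contMDiffOn_iff_contDiffOn] at h4
  refine h4.congr fun y hy => ?_
  change _ = (mfderivWithin I 𝓘(ℝ, E) (extChartAt I z) (extChartAt I z).source
    ((extChartAt I z).symm y) (v ((extChartAt I z).symm y)) : E)
  rw [mfderivWithin_of_isOpen hsrc ((extChartAt I z).map_target hy)]

theorem mfderiv_extChartAt_symm_apply_mfderiv_extChartAt (z : N) {y : E}
    (hy : y ∈ (extChartAt I z).target) (w : TangentSpace I ((extChartAt I z).symm y)) :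
    mfderiv 𝓘(ℝ, E) I (extChartAt I z).symm y
      (mfderiv I 𝓘(ℝ, E) (extChartAt I z) ((extChartAt I z).symm y) w) = w := by
  have := mfderivWithin_extChartAt_symm_comp_mfderiv_extChartAt (I := I) hy
  rw [I.range_eq_univ, mfderivWithin_univ] at this
  exact DFunLike.congr_fun this w

theorem mfderiv_extChartAt_apply_mfderiv_extChartAt_symm (z : N) {y : E}
    (hy : y ∈ (extChartAt I z).target) (w : E) :
    mfderiv I 𝓘(ℝ, E) (extChartAt I z) ((extChartAt I z).symm y)
      (mfderiv 𝓘(ℝ, E) I (extChartAt I z).symm y w) = w := by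
  have := mfderiv_extChartAt_comp_mfderivWithin_extChartAt_symm (I := I) hy
  rw [I.range_eq_univ, mfderivWithin_univ] at this
  exact DFunLike.congr_fun this w

theorem mdifferentiableAt_extChartAt_symm_of_boundaryless (z : N) {y : E}
    (hy : y ∈ (extChartAt I z).target) : MDifferentiableAt 𝓘(ℝ, E) I (extChartAt I z).symm y :=
  ((contMDiffOn_extChartAt_symm (n := ∞) z).contMDiffAt
    ((isOpen_extChartAt_target z).mem_nhds hy)).mdifferentiableAt (by simp)

variable [CompleteSpace E]

theorem exists_local_contMDiff_flow {v : (x : N) → TangentSpace I x}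
    (hv : ContMDiff I I.tangent ∞ (fun x => (⟨x, v x⟩ : TangentBundle I N))) (n : ℕ) (z : N) :
    ∃ ε > 0, ∃ U ∈ 𝓝 z, ∃ Γ : ℝ × N → N,
      ContMDiffOn (𝓘(ℝ, ℝ).prod I) I n Γ (Ioo (-ε) ε ×ˢ U) ∧ ∀ x ∈ U, Γ (0, x) = x ∧
        ∀ t ∈ Ioo (-ε) ε, HasMFDerivAt 𝓘(ℝ, ℝ) I (fun τ => Γ (τ, x)) t
          ((1 : ℝ →L[ℝ] ℝ).smulRight (v (Γ (t, x)))) := by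
  obtain ⟨ε, r, ψ, h⟩ := exists_isLocalFlow n (isOpen_extChartAt_target z)
    (contDiffOn_mfderiv_extChartAt_vectorField hv z) (mem_extChartAt_target z)
  have hUz : (extChartAt I z).source ∩ extChartAt I z ⁻¹' ball (extChartAt I z z) r ∈ 𝓝 z :=
    inter_mem (extChartAt_source_mem_nhds z)
      ((continuousAt_extChartAt z).preimage_mem_nhds (ball_mem_nhds _ h.radius_pos))
  refine ⟨ε, h.time_pos, _, hUz, fun p => (extChartAt I z).symm (ψ (p.1, extChartAt I z p.2)),
    ?_, fun x hx => ⟨?_, fun t ht => ?_⟩⟩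
  · have h1 : ContMDiffOn (𝓘(ℝ, ℝ).prod I) 𝓘(ℝ, ℝ × E) n
        (fun p : ℝ × N => (p.1, extChartAt I z p.2))
        (Ioo (-ε) ε ×ˢ ((extChartAt I z).source ∩ extChartAt I z ⁻¹' ball (extChartAt I z z) r)) := by
      refine contMDiffOn_fst.prodMk_space (ContMDiffOn.comp (t := (extChartAt I z).source) ?_
        contMDiffOn_snd fun p hp => hp.2.1)
      rw [extChartAt_source]
      exact contMDiffOn_extChartAt
    have h2 : ContMDiffOn 𝓘(ℝ, ℝ × E) 𝓘(ℝ, E) n ψ (Ioo (-ε) ε ×ˢ ball (extChartAt I z z) r) :=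
      h.smooth.contMDiffOn
    have h3 := h2.comp h1 fun p hp => ⟨hp.1, hp.2.2⟩
    exact ((contMDiffOn_extChartAt_symm (n := ∞) z).of_le (by exact_mod_cast le_top)).comp h3
      fun p hp => h.mapsTo _ hp.1 _ hp.2.2
  · simp only
    rw [h.init _ hx.2, (extChartAt I z).left_inv hx.1]
  · have h1 : HasMFDerivAt 𝓘(ℝ, ℝ) 𝓘(ℝ, E) (fun τ => ψ (τ, extChartAt I z x)) t
        ((1 : ℝ →L[ℝ] ℝ).smulRight _) := (h.deriv t ht _ hx.2).hasFDerivAt.hasMFDerivAt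
    have hm := h.mapsTo t ht _ hx.2
    have h2 := (mdifferentiableAt_extChartAt_symm_of_boundaryless z hm).hasMFDerivAt
    refine (HasMFDerivAt.comp t h2 h1).congr_mfderiv ?_
    refine ContinuousLinearMap.ext_ring ?_
    exact (congrArg (mfderiv 𝓘(ℝ, E) I (extChartAt I z).symm (ψ (t, extChartAt I z x)))
      (one_smul ℝ _)).trans ((mfderiv_extChartAt_symm_apply_mfderiv_extChartAt z hm _).trans
        (one_smul ℝ _).symm)

variable [T2Space N]

theorem flow_add {v : (x : N) → TangentSpace I x}
    (hv : ContMDiff I I.tangent ∞ (fun x => (⟨x, v x⟩ : TangentBundle I N))) {F : ℝ → N → N}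
    (h0 : ∀ x, F 0 x = x) (hF : ∀ x, IsMIntegralCurve (fun t => F t x) v) (s t : ℝ) (x : N) :
    F (s + t) x = F s (F t x) := by
  have h1 : IsMIntegralCurve ((fun τ => F τ x) ∘ (· + t)) v := (hF x).comp_add t
  have := isMIntegralCurve_Ioo_eq_of_contMDiff_boundaryless (t₀ := 0)
    (hv.of_le (by exact_mod_cast le_top)) h1 (hF (F t x)) (by simp [h0])
  exact congrFun this s

theorem exists_contMDiffOn_flow_near_zero {v : (x : N) → TangentSpace I x}
    (hv : ContMDiff I I.tangent ∞ (fun x => (⟨x, v x⟩ : TangentBundle I N))) {F : ℝ → N → N}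
    (h0 : ∀ x, F 0 x = x) (hF : ∀ x, IsMIntegralCurve (fun t => F t x) v) (n : ℕ) (z : N) :
    ∃ ε > 0, ∃ U ∈ 𝓝 z, ContMDiffOn (𝓘(ℝ, ℝ).prod I) I n (fun p : ℝ × N => F p.1 p.2)
      (Ioo (-ε) ε ×ˢ U) := by
  obtain ⟨ε, hε, U, hU, Γ, hΓ, hx⟩ := exists_local_contMDiff_flow hv n z
  refine ⟨ε, hε, U, hU, hΓ.congr fun p hp => ?_⟩
  have := isMIntegralCurveOn_Ioo_eqOn_of_contMDiff_boundaryless (t₀ := 0) (a := -ε) (b := ε)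
    ⟨by linarith, hε⟩ (hv.of_le (by exact_mod_cast le_top)) ((hF p.2).isMIntegralCurveOn _)
    (fun t ht => ((hx p.2 hp.2).2 t ht).hasMFDerivWithinAt) (by
      simp only [h0]; exact (hx p.2 hp.2).1.symm)
  exact this hp.1

/-- The global flow of a smooth vector field is smooth. -/
theorem contMDiff_flow {v : (x : N) → TangentSpace I x}
    (hv : ContMDiff I I.tangent ∞ (fun x => (⟨x, v x⟩ : TangentBundle I N))) {F : ℝ → N → N}
    (h0 : ∀ x, F 0 x = x) (hF : ∀ x, IsMIntegralCurve (fun t => F t x) v) :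
    ContMDiff (𝓘(ℝ, ℝ).prod I) I ∞ (fun p : ℝ × N => F p.1 p.2) := by
  rw [contMDiff_infty]
  intro n
  suffices h : ∀ x t, ContMDiffAt (𝓘(ℝ, ℝ).prod I) I n (fun p : ℝ × N => F p.1 p.2) (t, x) from
    fun p => h p.2 p.1
  intro x
  have hcurve : Continuous fun t => F t x := by
    rw [continuous_iff_continuousAt]; exact fun t => (hF x t).continuousAt
  -- smoothness at time `s` propagates to nearby times, uniformly near a given time
  have step : ∀ t₀, ∃ δ > 0, ∀ s, |s - t₀| < δ →
      ContMDiffAt (𝓘(ℝ, ℝ).prod I) I n (fun p : ℝ × N => F p.1 p.2) (s, x) →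
      ∀ t, |t - t₀| < δ →
        ContMDiffAt (𝓘(ℝ, ℝ).prod I) I n (fun p : ℝ × N => F p.1 p.2) (t, x) := by
    intro t₀
    obtain ⟨ε, hε, U, hU, hs⟩ := exists_contMDiffOn_flow_near_zero hv h0 hF n (F t₀ x)
    have hpre : (fun t => F t x) ⁻¹' interior U ∈ 𝓝 t₀ :=
      hcurve.continuousAt.preimage_mem_nhds (interior_mem_nhds.2 hU)
    obtain ⟨δ, hδ, hsub⟩ := Metric.mem_nhds_iff.1 hpre
    refine ⟨min δ (ε / 2), by positivity, fun s hs' hsm t ht => ?_⟩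
    have hsU : F s x ∈ interior U := hsub (by
      rw [mem_ball, Real.dist_eq]; exact hs'.trans_le (min_le_left _ _))
    have hts : t - s ∈ Ioo (-ε) ε := by
      have h1 := abs_lt.1 (hs'.trans_le (min_le_right _ _))
      have h2 := abs_lt.1 (ht.trans_le (min_le_right _ _))
      constructor <;> linarith [h1.1, h1.2, h2.1, h2.2]
    -- By the group law F_t = F_{t-s} ∘ F_s. The second factor is smooth at x by hypothesis, the
    -- first near F_s(x) because t - s is within the local existence time.
    have e : (fun p : ℝ × N => F p.1 p.2) =
        fun p : ℝ × N => F (p.1 - s) (F s p.2) := by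
      funext p
      rw [← flow_add hv h0 hF, sub_add_cancel]
    rw [e]
    have h1 : ContMDiffAt (𝓘(ℝ, ℝ).prod I) I n (fun p : ℝ × N => F p.1 p.2) (t - s, F s x) :=
      hs.contMDiffAt (prod_mem_nhds (isOpen_Ioo.mem_nhds hts) (mem_interior_iff_mem_nhds.1 hsU))
    have h2 : ContMDiffAt (𝓘(ℝ, ℝ).prod I) I n (fun p : ℝ × N => F s p.2) (t, x) :=
      hsm.comp (t, x) (f := fun p : ℝ × N => ((s : ℝ), p.2))
        (contMDiffAt_const.prodMk contMDiffAt_snd)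
    have h3 : ContMDiffAt (𝓘(ℝ, ℝ).prod I) 𝓘(ℝ, ℝ) n (fun p : ℝ × N => p.1 - s) (t, x) :=
      contMDiffAt_fst.sub contMDiffAt_const
    exact ContMDiffAt.comp (t, x) (f := fun p : ℝ × N => (p.1 - s, F s p.2)) h1 (h3.prodMk h2)
  set S : Set ℝ := {t | ContMDiffAt (𝓘(ℝ, ℝ).prod I) I n (fun p : ℝ × N => F p.1 p.2) (t, x)}
  have hclopen : IsClopen S := by
    constructor
    · refine isClosed_of_closure_subset fun t₀ ht₀ => ?_
      obtain ⟨δ, hδ, hst⟩ := step t₀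
      obtain ⟨s, hsS, hs⟩ := Metric.mem_closure_iff.1 ht₀ δ hδ
      exact hst s (by rwa [dist_comm, Real.dist_eq] at hs) hsS t₀ (by simpa using hδ)
    · rw [Metric.isOpen_iff]
      intro t₀ ht₀
      obtain ⟨δ, hδ, hst⟩ := step t₀
      exact ⟨δ, hδ, fun t ht => hst t₀ (by simpa using hδ) ht₀ t (by
        rwa [mem_ball, Real.dist_eq] at ht)⟩
  have h0S : (0 : ℝ) ∈ S := by
    obtain ⟨ε, hε, U, hU, hs⟩ := exists_contMDiffOn_flow_near_zero hv h0 hF n x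
    exact hs.contMDiffAt (prod_mem_nhds (Ioo_mem_nhds (by linarith) hε) hU)
  intro t
  have ht : t ∈ S := hclopen.eq_univ ⟨0, h0S⟩ ▸ mem_univ t
  exact ht

end ManifoldFlow

/-! ### Flows of vector fields depending on parameters -/

section ParamFlow

open Prequant

variable {m : ℕ} {P : Type} [NormedAddCommGroup P] [NormedSpace ℝ P]
  {X : Type*} [TopologicalSpace X] [ChartedSpace (Euc m) X] [IsManifold (𝓡 m) ∞ X]

/-- Joint smoothness of a family of vector fields. -/
def IsSmoothFamily (Z : P → (x : X) → TangentSpace (𝓡 m) x) : Prop :=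
  ContMDiff (𝓘(ℝ, P).prod (𝓡 m)) (𝓡 m).tangent ∞
    (fun q : P × X => (⟨q.2, Z q.1 q.2⟩ : TangentBundle (𝓡 m) X))

/-- The vector field on `P × X` which moves the parameter in the direction `e`. -/
def suspension (e : P) (Z : P → (x : X) → TangentSpace (𝓡 m) x) (q : P × X) :
    TangentSpace (𝓘(ℝ, P).prod (𝓡 m)) q := ((e, Z q.1 q.2) : P × Euc m)

theorem contMDiff_suspension {Z : P → (x : X) → TangentSpace (𝓡 m) x} (hZ : IsSmoothFamily Z)
    (e : P) : ContMDiff (𝓘(ℝ, P).prod (𝓡 m)) (𝓘(ℝ, P).prod (𝓡 m)).tangent ∞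
      (fun q => (⟨q, suspension e Z q⟩ : TangentBundle (𝓘(ℝ, P).prod (𝓡 m)) (P × X))) := by
  have h1 : ContMDiff 𝓘(ℝ, P) 𝓘(ℝ, P).tangent ∞
      (fun p : P => (⟨p, e⟩ : TangentBundle 𝓘(ℝ, P) P)) :=
    contMDiff_vectorSpace_iff_contDiff.2 (contDiff_const (c := e))
  exact (contMDiff_equivTangentBundleProd_symm (I := 𝓘(ℝ, P)) (I' := 𝓡 m) (M := P) (M' := X)
    (n := ∞)).comp ((h1.comp contMDiff_fst).prodMk hZ)

theorem isSmoothFamily_zero : IsSmoothFamily (fun (_ : P) (x : X) => (0 : TangentSpace (𝓡 m) x)) :=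
  (Bundle.contMDiff_zeroSection ℝ (TangentSpace (𝓡 m) : X → Type _)).comp contMDiff_snd

theorem hasMFDerivAt_suspension {Z : P → (x : X) → TangentSpace (𝓡 m) x} {e p : P} {γ : ℝ → X}
    {t : ℝ} (h : HasMFDerivAt 𝓘(ℝ, ℝ) (𝓡 m) γ t
      ((1 : ℝ →L[ℝ] ℝ).smulRight (Z (p + t • e) (γ t)))) :
    HasMFDerivAt 𝓘(ℝ, ℝ) (𝓘(ℝ, P).prod (𝓡 m)) (fun τ => (p + τ • e, γ τ)) t
      ((1 : ℝ →L[ℝ] ℝ).smulRight (suspension e Z (p + t • e, γ t))) := by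
  have h1 : HasDerivAt (fun τ : ℝ => p + τ • e) ((1 : ℝ) • e) t :=
    ((hasDerivAt_id t).smul_const e).const_add p
  rw [one_smul] at h1
  exact h1.hasFDerivAt.hasMFDerivAt.prodMk h

theorem eq_of_hasMFDerivAt_param [T2Space X] {Z : P → (x : X) → TangentSpace (𝓡 m) x}
    (hZ : IsSmoothFamily Z) {e p : P} {γ γ' : ℝ → X}
    (h : ∀ t, HasMFDerivAt 𝓘(ℝ, ℝ) (𝓡 m) γ t
      ((1 : ℝ →L[ℝ] ℝ).smulRight (Z (p + t • e) (γ t))))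
    (h' : ∀ t, HasMFDerivAt 𝓘(ℝ, ℝ) (𝓡 m) γ' t
      ((1 : ℝ →L[ℝ] ℝ).smulRight (Z (p + t • e) (γ' t)))) (h0 : γ 0 = γ' 0) : γ = γ' := by
  have h1 := isMIntegralCurve_Ioo_eq_of_contMDiff_boundaryless (t₀ := 0)
    (γ := fun τ : ℝ => (p + τ • e, γ τ)) (γ' := fun τ : ℝ => (p + τ • e, γ' τ))
    ((contMDiff_suspension hZ e).of_le (by exact_mod_cast le_top))
    (fun t => hasMFDerivAt_suspension (h t)) (fun t => hasMFDerivAt_suspension (h' t))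
    (by rw [h0])
  funext t
  exact congrArg Prod.snd (congrFun h1 t)

theorem IsMIntegralCurve.fst_eq_of_fst_eq {e : P} {v : (q : P × X) →
    TangentSpace (𝓘(ℝ, P).prod (𝓡 m)) q} (hv : ∀ q, (v q : P × Euc m).1 = e) {γ : ℝ → P × X}
    (hγ : IsMIntegralCurve γ v) (t : ℝ) : (γ t).1 = (γ 0).1 + t • e := by
  have h1 : ∀ t, HasDerivAt (fun τ => (γ τ).1) e t := fun t => by
    have h2 : HasFDerivAt (fun τ => (γ τ).1) _ t :=
      (HasMFDerivAt.comp t (hasMFDerivAt_fst (I := 𝓘(ℝ, P)) (I' := 𝓡 m) (γ t)) (hγ t)).hasFDerivAt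
    refine h2.congr_fderiv (ContinuousLinearMap.ext_ring ?_)
    change ((1 : ℝ) • (v (γ t) : P × Euc m)).1 = (1 : ℝ) • e
    rw [one_smul, one_smul, hv]
  have h2 : ∀ t, HasDerivAt (fun τ => (γ τ).1 - τ • e) (0 : P) t := fun t => by
    have h3 := (h1 t).fun_sub ((hasDerivAt_id' t).smul_const e)
    rwa [one_smul, sub_self] at h3
  have h3 := is_const_of_deriv_eq_zero (fun t => (h2 t).differentiableAt) (fun t => (h2 t).deriv) t 0
  simp only [zero_smul, sub_zero] at h3
  rw [← h3]; abel

variable [T2Space X] [CompactSpace X] [FiniteDimensional ℝ P]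

/-- A closed ball in the finite-dimensional space P times the compact X is compact, so the local
existence times have a common positive lower bound there. -/
theorem exists_uniform_time {v : (q : P × X) → TangentSpace (𝓘(ℝ, P).prod (𝓡 m)) q}
    (hv : ContMDiff (𝓘(ℝ, P).prod (𝓡 m)) (𝓘(ℝ, P).prod (𝓡 m)).tangent ∞
      (fun q => (⟨q, v q⟩ : TangentBundle (𝓘(ℝ, P).prod (𝓡 m)) (P × X)))) (R : ℝ) :
    ∃ ε > 0, ∀ q : P × X, ‖q.1‖ ≤ R → ∃ γ : ℝ → P × X, γ 0 = q ∧
      IsMIntegralCurveOn γ v (Ioo (-ε) ε) := by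
  have hK : IsCompact (closedBall (0 : P) R ×ˢ (univ : Set X)) :=
    (isCompact_closedBall 0 R).prod isCompact_univ
  have key : ∃ ε > 0, ∀ q ∈ closedBall (0 : P) R ×ˢ (univ : Set X), ∃ γ : ℝ → P × X, γ 0 = q ∧
      IsMIntegralCurveOn γ v (Ioo (-ε) ε) := by
    refine hK.induction_on (p := fun S => ∃ ε > 0, ∀ q ∈ S, ∃ γ : ℝ → P × X, γ 0 = q ∧
      IsMIntegralCurveOn γ v (Ioo (-ε) ε)) ⟨1, one_pos, fun _ h => h.elim⟩ ?_ ?_ ?_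
    · rintro S T hST ⟨ε, hε, h⟩
      exact ⟨ε, hε, fun q hq => h q (hST hq)⟩
    · rintro S T ⟨ε, hε, h⟩ ⟨ε', hε', h'⟩
      refine ⟨min ε ε', lt_min hε hε', ?_⟩
      rintro q (hq | hq)
      · obtain ⟨γ, h0, hγ⟩ := h q hq
        exact ⟨γ, h0, hγ.mono (Ioo_subset_Ioo (neg_le_neg (min_le_left _ _)) (min_le_left _ _))⟩
      · obtain ⟨γ, h0, hγ⟩ := h' q hq
        exact ⟨γ, h0, hγ.mono (Ioo_subset_Ioo (neg_le_neg (min_le_right _ _)) (min_le_right _ _))⟩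
    · intro q _
      obtain ⟨ε, hε, U, hU, Γ, -, hΓ⟩ := exists_local_contMDiff_flow hv 0 q
      exact ⟨U, mem_nhdsWithin_of_mem_nhds hU, ε, hε, fun q' hq' => ⟨fun t => Γ (t, q'),
        (hΓ q' hq').1, fun t ht => ((hΓ q' hq').2 t ht).hasMFDerivWithinAt⟩⟩
  obtain ⟨ε, hε, h⟩ := key
  exact ⟨ε, hε, fun q hq => h q ⟨by simpa using hq, mem_univ _⟩⟩

/-- Completeness is not immediate since P is not compact. On a given time interval the parameter
stays in a ball, so Z may be cut off outside a larger ball. The cut-off field has a uniform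
existence time, by compactness near the ball and because its integral curves are straight lines far
away. -/
theorem exists_isMIntegralCurve_suspension {Z : P → (x : X) → TangentSpace (𝓡 m) x}
    (hZ : IsSmoothFamily Z) (e : P) (q : P × X) :
    ∃ γ : ℝ → P × X, γ 0 = q ∧ IsMIntegralCurve γ (suspension e Z) := by
  rw [exists_isMIntegralCurve_iff_exists_isMIntegralCurveOn_Ioo
    ((contMDiff_suspension hZ e).of_le (by exact_mod_cast le_top))]
  intro a
  -- The parameter p + t e has norm at most R for |t| < |a|, so the cut-off equals 1 along the
  -- relevant part of the curve.
  set R : ℝ := ‖q.1‖ + |a| * ‖e‖ + 1 with hR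
  have hR0 : 0 < R := by positivity
  let χ : ContDiffBump (0 : P) := ⟨R, R + 1, hR0, by linarith⟩
  have hχs : ContMDiff (𝓘(ℝ, P).prod (𝓡 m)) 𝓘(ℝ, ℝ) ∞ (fun q : P × X => χ q.1) :=
    (χ.contDiff (n := ⊤)).contMDiff.comp contMDiff_fst
  have hv : ContMDiff (𝓘(ℝ, P).prod (𝓡 m)) (𝓘(ℝ, P).prod (𝓡 m)).tangent ∞
      (fun q => (⟨q, suspension e (fun (p : P) (x : X) => χ p • Z p x) q⟩ :
        TangentBundle (𝓘(ℝ, P).prod (𝓡 m)) (P × X))) := by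
    -- The cut-off field is (e, χ Z) = χ (e, Z) + (1 - χ) (e, 0): only the component along X is
    -- damped.
    have h1 := (hχs.smul_section (contMDiff_suspension hZ e)).add_section
      ((contMDiff_const.sub hχs).smul_section
        (contMDiff_suspension (isSmoothFamily_zero (P := P) (X := X)) e) (f := fun q => 1 - χ q.1))
    convert h1 using 3 with q
    have hz : ∀ (a : ℝ) (w : Euc m), a • w = a • w + (1 - a) • (0 : Euc m) := fun a w => by simp
    have he : ∀ a : ℝ, e = a • e + (1 - a) • e := fun a => by
      rw [← add_smul, add_sub_cancel, one_smul]
    exact Prod.ext (he _) (hz _ _)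
  obtain ⟨ε, hε, h⟩ := exists_uniform_time hv (R + 2)
  have hfar : ∀ q : P × X, R + 1 < ‖q.1‖ → suspension e (fun (p : P) (x : X) => χ p • Z p x) q =
      suspension e (fun (_ : P) (x : X) => (0 : TangentSpace (𝓡 m) x)) q := fun q hq => by
    have : χ q.1 = 0 := χ.zero_of_le_dist (by rw [dist_zero_right]; exact hq.le)
    simp only [suspension, this, zero_smul]; rfl
  obtain ⟨γ, h0, hγ⟩ := exists_isMIntegralCurve_of_isMIntegralCurveOn
    (hv.of_le (by exact_mod_cast le_top)) (ε := min ε (1 / (‖e‖ + 1)))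
    (lt_min hε (by positivity)) (fun q' => by
      by_cases hq' : ‖q'.1‖ ≤ R + 2
      · obtain ⟨γ, h0, hγ⟩ := h q' hq'
        exact ⟨γ, h0, hγ.mono (Ioo_subset_Ioo (neg_le_neg (min_le_left _ _)) (min_le_left _ _))⟩
      -- For ‖p‖ > R + 2 and |t| ‖e‖ ≤ 1 the parameter stays outside the ball of radius R + 1, where
      -- χ = 0 and the straight line is an integral curve.
      · refine ⟨fun τ => (q'.1 + τ • e, q'.2), by simp, fun t ht => ?_⟩
        have ht' : |t| < 1 / (‖e‖ + 1) := abs_lt.2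
          ⟨by linarith [ht.1, min_le_right ε (1 / (‖e‖ + 1))], ht.2.trans_le (min_le_right _ _)⟩
        have hte : ‖t • e‖ ≤ 1 := by
          rw [norm_smul, Real.norm_eq_abs]
          calc |t| * ‖e‖ ≤ 1 / (‖e‖ + 1) * (‖e‖ + 1) :=
                mul_le_mul ht'.le (by linarith) (norm_nonneg _) (by positivity)
            _ = 1 := by field_simp
        have hlt : R + 1 < ‖q'.1 + t • e‖ := by
          have := norm_sub_norm_le q'.1 (-(t • e))
          rw [norm_neg, sub_neg_eq_add] at this
          push Not at hq'
          linarith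
        rw [hfar _ hlt]
        refine (hasMFDerivAt_suspension (γ := fun _ => q'.2)
          (Z := fun (_ : P) (x : X) => (0 : TangentSpace (𝓡 m) x)) ?_).hasMFDerivWithinAt
        refine (hasMFDerivAt_const q'.2 t).congr_mfderiv ?_
        exact (ContinuousLinearMap.smulRight_zero _).symm) q
  refine ⟨γ, h0, fun t ht => ?_⟩
  have h1 : (γ t).1 = q.1 + t • e := by
    rw [hγ.fst_eq_of_fst_eq (e := e) (fun _ => rfl), h0]
  have h2 : χ (γ t).1 = 1 := by
    refine χ.one_of_mem_closedBall ?_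
    rw [mem_closedBall, dist_zero_right, h1]
    have h3 : |t| ≤ |a| := by
      rw [abs_le]
      constructor <;> linarith [ht.1, ht.2, le_abs_self a]
    calc ‖q.1 + t • e‖ ≤ ‖q.1‖ + |t| * ‖e‖ := by
          refine (norm_add_le _ _).trans ?_
          rw [norm_smul, Real.norm_eq_abs]
      _ ≤ ‖q.1‖ + |a| * ‖e‖ := by gcongr
      _ ≤ R := by linarith
  have h4 : suspension e (fun (p : P) (x : X) => χ p • Z p x) (γ t) = suspension e Z (γ t) := by
    simp only [suspension, h2, one_smul]; rfl
  exact h4 ▸ (hγ t).hasMFDerivWithinAt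

/-- Smooth global flows of time dependent vector fields with parameters on a closed manifold. -/
theorem exists_param_flow {Z : P → (x : X) → TangentSpace (𝓡 m) x} (hZ : IsSmoothFamily Z)
    (e : P) : ∃ Ψ : ℝ → P → X → X,
      ContMDiff (𝓘(ℝ, ℝ).prod (𝓘(ℝ, P).prod (𝓡 m))) (𝓡 m) ∞
        (fun q : ℝ × (P × X) => Ψ q.1 q.2.1 q.2.2) ∧
      (∀ p x, Ψ 0 p x = x) ∧
      (∀ s t p x, Ψ (s + t) p x = Ψ s (p + t • e) (Ψ t p x)) ∧
      ∀ t p x, HasMFDerivAt 𝓘(ℝ, ℝ) (𝓡 m) (fun τ => Ψ τ p x) t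
        ((1 : ℝ →L[ℝ] ℝ).smulRight (Z (p + t • e) (Ψ t p x))) := by
  choose γ h0 hγ using exists_isMIntegralCurve_suspension hZ e
  have hv := contMDiff_suspension hZ e
  have hs := contMDiff_flow hv (F := fun t q => γ q t) h0 hγ
  have hadd := flow_add hv (F := fun t q => γ q t) h0 hγ
  have hfst : ∀ q t, (γ q t).1 = q.1 + t • e := fun q t => by
    rw [(hγ q).fst_eq_of_fst_eq (e := e) (fun _ => rfl), h0]
  refine ⟨fun t p x => (γ (p, x) t).2, contMDiff_snd.comp hs, fun p x => congrArg Prod.snd (h0 (p, x)),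
    fun s t p x => ?_, fun t p x => ?_⟩
  · simp only at hadd ⊢
    rw [hadd]
    congr 3
    exact Prod.ext (hfst _ _) rfl
  · have := HasMFDerivAt.comp t (hasMFDerivAt_snd (I := 𝓘(ℝ, P)) (I' := 𝓡 m) (γ (p, x) t))
      (hγ (p, x) t)
    refine this.congr_mfderiv (ContinuousLinearMap.ext_ring ?_)
    have h2 := hfst (p, x) t
    change (1 : ℝ) • (Z (γ (p, x) t).1 (γ (p, x) t).2 : Euc m) = (1 : ℝ) • (Z _ _ : Euc m)
    rw [h2]

/-- Smooth two-parameter families of diffeomorphisms obtained by integrating a family of time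
dependent vector fields, the second parameter being the time. -/
theorem exists_diffeoFamily {Z : ℝ × ℝ → (x : X) → TangentSpace (𝓡 m) x}
    (hZ : IsSmoothFamily Z) : ∃ Φ : DiffeoFamily m (ℝ × ℝ) X,
      (∀ s x, Φ.toFun (s, 0) x = x) ∧
      ∀ s t x, HasMFDerivAt 𝓘(ℝ, ℝ) (𝓡 m) (fun τ => Φ.toFun (s, τ) x) t
        ((1 : ℝ →L[ℝ] ℝ).smulRight (Z (s, t) (Φ.toFun (s, t) x))) := by
  obtain ⟨Ψ, hΨ, h0, hadd, hd⟩ := exists_param_flow hZ ((0, 1) : ℝ × ℝ)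
  have e1 : ∀ s t : ℝ, ((s, 0) : ℝ × ℝ) + t • ((0, 1) : ℝ × ℝ) = (s, t) := fun s t => by simp
  have hc : ∀ {f : ℝ × ℝ → ℝ} {g : ℝ × ℝ → ℝ × ℝ}, ContDiff ℝ ∞ f → ContDiff ℝ ∞ g →
      ContMDiff (𝓘(ℝ, ℝ × ℝ).prod (𝓡 m)) (𝓡 m) ∞
        (fun q : (ℝ × ℝ) × X => Ψ (f q.1) (g q.1) q.2) := fun {f g} hf hg =>
    hΨ.comp ((hf.contMDiff.comp contMDiff_fst).prodMk
      ((hg.contMDiff.comp contMDiff_fst).prodMk contMDiff_snd))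
  -- The diffeomorphism at (s, t) flows for time t from the parameter (s, 0); its inverse flows for
  -- time -t from the parameter (s, t).
  refine ⟨⟨fun p x => Ψ p.2 (p.1, 0) x, fun p x => Ψ (-p.2) p x, fun p x => ?_, fun p x => ?_,
    hc contDiff_snd (contDiff_fst.prodMk contDiff_const), hc contDiff_snd.neg contDiff_id⟩,
    fun s x => h0 _ _, fun s t x => ?_⟩
  · have := hadd (-p.2) p.2 (p.1, 0) x
    rw [e1] at this
    rw [← this, neg_add_cancel, h0]
  · have := hadd p.2 (-p.2) p x
    have e2 : p + (-p.2) • ((0, 1) : ℝ × ℝ) = (p.1, 0) := by ext <;> simp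
    rw [e2, add_neg_cancel, h0] at this
    exact this.symm
  · have := hd t (s, 0) x
    rw [e1] at this
    exact this

end ParamFlow

/-! ### Pullback of differential forms to normed spaces -/

theorem two_le_contDiff_infty : (2 : ℕ∞ω) ≤ ∞ := by
  have : ((2 : ℕ∞) : ℕ∞ω) ≤ ∞ := by exact_mod_cast le_top
  exact this

/-- Induction on the degree: currying off the first argument is a bounded linear operation, which
reduces the claim to applying a smooth family of linear maps. -/
theorem ContDiffOn.continuousAlternatingMap_apply {G E : Type*} [NormedAddCommGroup G]
    [NormedSpace ℝ G] [NormedAddCommGroup E] [NormedSpace ℝ E] {n : ℕ∞ω} {s : Set G} {k : ℕ}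
    {f : G → E [⋀^Fin k]→L[ℝ] ℝ} {g : Fin k → G → E} (hf : ContDiffOn ℝ n f s)
    (hg : ∀ i, ContDiffOn ℝ n (g i) s) : ContDiffOn ℝ n (fun x => f x (fun i => g i x)) s := by
  induction k with
  | zero =>
    have : ContDiffOn ℝ n (fun x => ContinuousAlternatingMap.apply ℝ E ℝ (0 : Fin 0 → E) (f x)) s :=
      (ContinuousLinearMap.contDiff _).comp_contDiffOn hf
    refine this.congr fun x _ => ?_
    change f x _ = f x _
    congr 1
    exact Subsingleton.elim _ _
  | succ k ih =>
    have hL : ContDiff ℝ n (fun f : E [⋀^Fin (k + 1)]→L[ℝ] ℝ => f.curryLeft) :=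
      IsBoundedLinearMap.contDiff (IsLinearMap.with_bound ⟨fun _ _ => rfl, fun _ _ => rfl⟩ 1
        fun f => by rw [one_mul, ContinuousAlternatingMap.norm_curryLeft])
    have h1 : ContDiffOn ℝ n (fun x => (f x).curryLeft (g 0 x)) s :=
      ContDiffOn.clm_apply (hL.comp_contDiffOn hf) (hg 0)
    refine (ih h1 (fun i => hg i.succ)).congr fun x _ => ?_
    rw [ContinuousAlternatingMap.curryLeft_apply_apply]
    congr 1
    funext i
    refine Fin.cases ?_ (fun j => ?_) i <;> simp

namespace Prequant

section FormPullback

variable {m k : ℕ} {Q : Type*} [NormedAddCommGroup Q] [NormedSpace ℝ Q]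
  {X : Type*} [TopologicalSpace X] [ChartedSpace (Euc m) X] [IsManifold (𝓡 m) ∞ X]

/-- The pullback of a form on a manifold by a map defined on a normed space. -/
noncomputable def Form.pullbackTo (θ : Form m X k) (u : Q → X) (q : Q) : Q [⋀^Fin k]→L[ℝ] ℝ :=
  (θ (u q)).compContinuousLinearMap (mfderiv 𝓘(ℝ, Q) (𝓡 m) u q)

theorem Form.apply_congr (θ : Form m X k) {x y : X} (h : x = y) {v w : Fin k → Euc m}
    (hvw : v = w) : θ x v = θ y w := by
  subst h; subst hvw; rfl

/-- The chart c may be any chart around u q. Differentiating the pullback needs one chart that stays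
fixed while the point moves. -/
theorem Form.pullbackTo_eq_inChart (θ : Form m X k) {u : Q → X} {q : Q} (c : X)
    (hu : MDifferentiableAt 𝓘(ℝ, Q) (𝓡 m) u q) (hc : u q ∈ (extChartAt (𝓡 m) c).source) :
    θ.pullbackTo u q = (θ.inChart c (extChartAt (𝓡 m) c (u q))).compContinuousLinearMap
      (fderiv ℝ (fun q => extChartAt (𝓡 m) c (u q)) q) := by
  ext v
  have hleft : (fun q => (extChartAt (𝓡 m) c).symm (extChartAt (𝓡 m) c (u q))) =ᶠ[𝓝 q] u := by
    filter_upwards [hu.continuousAt.preimage_mem_nhds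
      ((isOpen_extChartAt_source (I := 𝓡 m) c).mem_nhds hc)] with q' hq'
    exact (extChartAt (𝓡 m) c).left_inv hq'
  have hφ : MDifferentiableAt 𝓘(ℝ, Q) 𝓘(ℝ, Euc m) (fun q => extChartAt (𝓡 m) c (u q)) q :=
    MDifferentiableAt.comp q (mdifferentiableAt_extChartAt
      (by rwa [extChartAt_source] at hc)) hu
  have hs := mdifferentiableAt_extChartAt_symm_of_boundaryless (I := 𝓡 m) c
    ((extChartAt (𝓡 m) c).map_source hc)
  refine Form.apply_congr θ ((extChartAt (𝓡 m) c).left_inv hc).symm ?_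
  funext i
  have h1 := mfderiv_comp_apply (I := 𝓘(ℝ, Q)) (I' := 𝓘(ℝ, Euc m)) (I'' := 𝓡 m) q hs hφ (v i)
  have h2 := hleft.mfderiv_eq (I := 𝓘(ℝ, Q)) (I' := 𝓡 m)
  have h3 : mfderiv 𝓘(ℝ, Q) (𝓡 m) u q (v i) = (mfderiv 𝓘(ℝ, Q) (𝓡 m)
      (fun q => (extChartAt (𝓡 m) c).symm (extChartAt (𝓡 m) c (u q))) q (v i) : Euc m) :=
    (DFunLike.congr_fun h2 (v i)).symm
  refine h3.trans (h1.trans ?_)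
  rw [mfderiv_eq_fderiv]
  rfl

theorem contDiffAt_extChartAt_comp {u : Q → X} {q : Q} (c : X)
    (hu : ContMDiffAt 𝓘(ℝ, Q) (𝓡 m) ∞ u q) (hc : u q ∈ (extChartAt (𝓡 m) c).source) :
    ContDiffAt ℝ ∞ (fun q => extChartAt (𝓡 m) c (u q)) q := by
  rw [← contMDiffAt_iff_contDiffAt]
  exact ContMDiffAt.comp q (contMDiffAt_extChartAt' (by rwa [extChartAt_source] at hc)) hu

variable {s : Set Q} {u : Q → X} {q : Q}

theorem Form.pullbackTo_eventuallyEq (θ : Form m X k) (hs : IsOpen s)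
    (hu : ContMDiffOn 𝓘(ℝ, Q) (𝓡 m) ∞ u s) (hq : q ∈ s) (c : X)
    (hc : u q ∈ (extChartAt (𝓡 m) c).source) :
    θ.pullbackTo u =ᶠ[𝓝 q] fun q => (θ.inChart c (extChartAt (𝓡 m) c (u q))).compContinuousLinearMap
      (fderiv ℝ (fun q => extChartAt (𝓡 m) c (u q)) q) := by
  filter_upwards [hs.mem_nhds hq, (hu.contMDiffAt (hs.mem_nhds hq)).continuousAt.preimage_mem_nhds
      ((isOpen_extChartAt_source (I := 𝓡 m) c).mem_nhds hc)] with q' h1 h2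
  exact θ.pullbackTo_eq_inChart c ((hu.contMDiffAt (hs.mem_nhds h1)).mdifferentiableAt (by simp)) h2

theorem Form.IsSmooth.differentiableAt_inChart {θ : Form m X k} (hθ : θ.IsSmooth) {c : X}
    {y : Euc m} (hy : y ∈ (extChartAt (𝓡 m) c).target) : DifferentiableAt ℝ (θ.inChart c) y :=
  ((hθ c).contDiffAt ((isOpen_extChartAt_target _).mem_nhds hy)).differentiableAt (by simp)

theorem Form.IsSmooth.differentiableAt_pullbackTo {θ : Form m X k} (hθ : θ.IsSmooth)
    (hs : IsOpen s) (hu : ContMDiffOn 𝓘(ℝ, Q) (𝓡 m) ∞ u s) (hq : q ∈ s) :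
    DifferentiableAt ℝ (θ.pullbackTo u) q := by
  have hc := mem_extChartAt_source (I := 𝓡 m) (u q)
  refine DifferentiableAt.congr_of_eventuallyEq ?_ (θ.pullbackTo_eventuallyEq hs hu hq (u q) hc)
  have hφ := contDiffAt_extChartAt_comp (u q) (hu.contMDiffAt (hs.mem_nhds hq)) hc
  exact (DifferentiableAt.comp q (hθ.differentiableAt_inChart (mem_extChartAt_target _))
    (hφ.differentiableAt (by simp))).continuousAlternatingMapCompContinuousLinearMap
    ((hφ.fderiv_right (m := 1) (by
      rw [one_add_one_eq_two]; exact two_le_contDiff_infty)).differentiableAt (by simp))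

/-- In a fixed chart this is naturality of the exterior derivative on normed spaces. Since `Form.d`
is computed at each point in that point's own preferred chart, applying this to inverse charts also
shows that `Form.d` is independent of the chart. -/
theorem Form.IsSmooth.extDeriv_pullbackTo {θ : Form m X k} (hθ : θ.IsSmooth)
    (hs : IsOpen s) (hu : ContMDiffOn 𝓘(ℝ, Q) (𝓡 m) ∞ u s) (hq : q ∈ s) :
    extDeriv (θ.pullbackTo u) q = θ.d.pullbackTo u q := by
  have huq := hu.contMDiffAt (hs.mem_nhds hq)
  obtain ⟨c, hcu⟩ : ∃ c, c = u q := ⟨_, rfl⟩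
  have hc : u q ∈ (extChartAt (𝓡 m) c).source := hcu ▸ mem_extChartAt_source (I := 𝓡 m) (u q)
  rw [(θ.pullbackTo_eventuallyEq hs hu hq c hc).extDeriv_eq]
  have hφ := contDiffAt_extChartAt_comp c huq hc
  rw [extDeriv_pullback (f := fun q => extChartAt (𝓡 m) c (u q))
    (hθ.differentiableAt_inChart ((extChartAt (𝓡 m) c).map_source hc)) hφ (by
      rw [minSmoothness_of_isRCLikeNormedField]; exact two_le_contDiff_infty)]
  ext v
  subst hcu
  change extDeriv (θ.inChart (u q)) (extChartAt (𝓡 m) (u q) (u q)) _ =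
    extDeriv (θ.inChart (u q)) (extChartAt (𝓡 m) (u q) (u q)) _
  congr 1
  funext i
  have h1 := mfderiv_comp_apply (I := 𝓘(ℝ, Q)) (I' := 𝓡 m) (I'' := 𝓘(ℝ, Euc m)) q
    (mdifferentiableAt_extChartAt (by rwa [extChartAt_source] at hc))
    (huq.mdifferentiableAt (by simp)) (v i) (g := extChartAt (𝓡 m) (u q))
  refine Eq.trans ?_ h1
  rw [mfderiv_eq_fderiv]
  rfl

/-- Evaluation of the pullback of a smooth form on smooth vector fields is smooth. -/
theorem Form.IsSmooth.contDiffOn_pullbackTo_apply {θ : Form m X k} (hθ : θ.IsSmooth)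
    (hs : IsOpen s) (hu : ContMDiffOn 𝓘(ℝ, Q) (𝓡 m) ∞ u s) {w : Fin k → Q → Q}
    (hw : ∀ i, ContDiffOn ℝ ∞ (w i) s) :
    ContDiffOn ℝ ∞ (fun q => θ.pullbackTo u q (fun i => w i q)) s := by
  intro q hq
  have hc := mem_extChartAt_source (I := 𝓡 m) (u q)
  set c := u q with hcdef
  set s' := s ∩ u ⁻¹' (extChartAt (𝓡 m) c).source with hs'def
  have hs' : IsOpen s' := hu.continuousOn.isOpen_inter_preimage hs (isOpen_extChartAt_source c)
  have hφ : ContDiffOn ℝ ∞ (fun q => extChartAt (𝓡 m) c (u q)) s' := fun q' hq' =>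
    (contDiffAt_extChartAt_comp c (hu.contMDiffAt (hs.mem_nhds hq'.1)) hq'.2).contDiffWithinAt
  have h1 : ContDiffOn ℝ ∞ (fun q => θ.inChart c (extChartAt (𝓡 m) c (u q))
      (fun i => fderiv ℝ (fun q => extChartAt (𝓡 m) c (u q)) q (w i q))) s' := by
    refine ContDiffOn.continuousAlternatingMap_apply
      ((hθ c).comp hφ fun q' hq' => (extChartAt (𝓡 m) c).map_source hq'.2) fun i => ?_
    exact (hφ.fderiv_of_isOpen hs' (by simp)).clm_apply ((hw i).mono inter_subset_left)
  have h2 : ContDiffAt ℝ ∞ (fun q => θ.inChart c (extChartAt (𝓡 m) c (u q))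
      (fun i => fderiv ℝ (fun q => extChartAt (𝓡 m) c (u q)) q (w i q))) q :=
    h1.contDiffAt (hs'.mem_nhds ⟨hq, hc⟩)
  refine (h2.congr_of_eventuallyEq ?_).contDiffWithinAt
  filter_upwards [θ.pullbackTo_eventuallyEq hs hu hq c hc] with q' hq'
  rw [hq']
  rfl

theorem Form.IsSmooth.extDeriv_inChart {θ : Form m X k} (hθ : θ.IsSmooth) (c : X) {y : Euc m}
    (hy : y ∈ (extChartAt (𝓡 m) c).target) : extDeriv (θ.inChart c) y = θ.d.inChart c y :=
  hθ.extDeriv_pullbackTo (isOpen_extChartAt_target c) (contMDiffOn_extChartAt_symm c) hy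

theorem Form.IsSmooth.d {θ : Form m X k} (hθ : θ.IsSmooth) : θ.d.IsSmooth := fun c => by
  have h1 : ContDiffOn ℝ ∞ (fderiv ℝ (θ.inChart c)) (extChartAt (𝓡 m) c).target :=
    (hθ c).fderiv_of_isOpen (isOpen_extChartAt_target c) (by simp)
  have h2 := (ContinuousAlternatingMap.alternatizeUncurryFinCLM ℝ (Euc m) ℝ
    (n := k)).contDiff.comp_contDiffOn h1
  exact h2.congr fun y hy => (hθ.extDeriv_inChart c hy).symm

/-- Cartan's formula for the derivative of a 1-form along a map from a normed space, for constant
vector fields. -/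
theorem Form.IsSmooth.fderiv_pullbackTo_sub {α : Form m X 1} (hα : α.IsSmooth)
    (hs : IsOpen s) (hu : ContMDiffOn 𝓘(ℝ, Q) (𝓡 m) ∞ u s) (hq : q ∈ s) (v w : Q) :
    fderiv ℝ (fun q => α.pullbackTo u q ![w]) q v - fderiv ℝ (fun q => α.pullbackTo u q ![v]) q w =
      α.d.pullbackTo u q ![v, w] := by
  rw [← hα.extDeriv_pullbackTo hs hu hq, extDeriv_apply (hα.differentiableAt_pullbackTo hs hu hq)]
  have e0 : Fin.removeNth 0 ![v, w] = ![w] := by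
    ext i; fin_cases i; rfl
  have e1 : Fin.removeNth 1 ![v, w] = ![v] := by
    ext i; fin_cases i; rfl
  rw [Fin.sum_univ_two, e0, e1]
  simp [sub_eq_add_neg]

end FormPullback


/-! ### Vector fields dual to 1-forms -/

section DualVectorField

variable {m : ℕ} {P : Type} [NormedAddCommGroup P] [NormedSpace ℝ P]
  {X : Type*} [TopologicalSpace X] [ChartedSpace (Euc m) X] [IsManifold (𝓡 m) ∞ X]

/-- The derivative of the inverse of the preferred chart around `c`. -/
noncomputable def chartFrame (c : X) (y : Euc m) : Euc m →L[ℝ] Euc m :=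
  mfderiv 𝓘(ℝ, Euc m) (𝓡 m) (extChartAt (𝓡 m) c).symm y

theorem chartFrame_surjective (c : X) {y : Euc m} (hy : y ∈ (extChartAt (𝓡 m) c).target)
    (w : Euc m) : ∃ v, chartFrame c y v = w :=
  ⟨_, mfderiv_extChartAt_symm_apply_mfderiv_extChartAt (I := 𝓡 m) c hy w⟩

theorem chartFrame_injective (c : X) {y : Euc m} (hy : y ∈ (extChartAt (𝓡 m) c).target) :
    Function.Injective (chartFrame c y) :=
  Function.LeftInverse.injective
    (mfderiv_extChartAt_apply_mfderiv_extChartAt_symm (I := 𝓡 m) c hy)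

theorem isSmoothFamily_of_inChart {Z : P → (x : X) → TangentSpace (𝓡 m) x}
    {Zc : X → P → Euc m → Euc m}
    (hZc : ∀ c, ContDiffOn ℝ ∞ (fun q : P × Euc m => Zc c q.1 q.2)
      (univ ×ˢ (extChartAt (𝓡 m) c).target))
    (hZ : ∀ c p, ∀ y ∈ (extChartAt (𝓡 m) c).target,
      Z p ((extChartAt (𝓡 m) c).symm y) = chartFrame c y (Zc c p y)) : IsSmoothFamily Z := by
  intro q₀
  set c := q₀.2 with hc
  have ht : IsOpen (extChartAt (𝓡 m) c).target := isOpen_extChartAt_target c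
  have hs : IsOpen ((univ : Set P) ×ˢ (extChartAt (𝓡 m) c).source) :=
    isOpen_univ.prod (isOpen_extChartAt_source c)
  have h1 : ContMDiffOn 𝓘(ℝ, Euc m).tangent (𝓡 m).tangent ∞
      (tangentMapWithin 𝓘(ℝ, Euc m) (𝓡 m) (extChartAt (𝓡 m) c).symm (extChartAt (𝓡 m) c).target)
      (TotalSpace.proj ⁻¹' (extChartAt (𝓡 m) c).target) :=
    ContMDiffOn.contMDiffOn_tangentMapWithin (n := ∞) (m := ∞) (contMDiffOn_extChartAt_symm c) le_rfl
      ht.uniqueMDiffOn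
  have hφ : ContMDiffOn (𝓘(ℝ, P).prod (𝓡 m)) 𝓘(ℝ, Euc m) ∞
      (fun q : P × X => extChartAt (𝓡 m) c q.2) (univ ×ˢ (extChartAt (𝓡 m) c).source) := by
    refine ContMDiffOn.comp (t := (extChartAt (𝓡 m) c).source) ?_ contMDiffOn_snd fun q hq => hq.2
    rw [extChartAt_source]
    exact contMDiffOn_extChartAt
  have hpair : ContMDiffOn (𝓘(ℝ, P).prod (𝓡 m)) 𝓘(ℝ, P × Euc m) ∞
      (fun q : P × X => (q.1, extChartAt (𝓡 m) c q.2)) (univ ×ˢ (extChartAt (𝓡 m) c).source) :=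
    contMDiffOn_fst.prodMk_space hφ
  have h2 : ContMDiffOn (𝓘(ℝ, P).prod (𝓡 m)) 𝓘(ℝ, Euc m) ∞
      (fun q : P × X => Zc c q.1 (extChartAt (𝓡 m) c q.2))
      (univ ×ˢ (extChartAt (𝓡 m) c).source) :=
    (hZc c).contMDiffOn.comp hpair fun q hq => ⟨mem_univ _, (extChartAt (𝓡 m) c).map_source hq.2⟩
  have h3 : ContMDiffOn (𝓘(ℝ, P).prod (𝓡 m)) 𝓘(ℝ, Euc m).tangent ∞
      (fun q : P × X => (⟨extChartAt (𝓡 m) c q.2, Zc c q.1 (extChartAt (𝓡 m) c q.2)⟩ :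
        TangentBundle 𝓘(ℝ, Euc m) (Euc m))) (univ ×ˢ (extChartAt (𝓡 m) c).source) := by
    intro q hq
    rw [Bundle.contMDiffWithinAt_totalSpace]
    refine ⟨hφ q hq, (h2 q hq).congr (fun q' _ => ?_) ?_⟩ <;>
    simp
  have h4 := h1.comp h3 fun q hq => (extChartAt (𝓡 m) c).map_source hq.2
  have hmem : ((univ : Set P) ×ˢ (extChartAt (𝓡 m) c).source) ∈ 𝓝 q₀ :=
    hs.mem_nhds ⟨mem_univ _, mem_extChartAt_source c⟩
  refine (h4.contMDiffAt hmem).congr_of_eventuallyEq ?_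
  filter_upwards [hmem] with q hq
  have hy := (extChartAt (𝓡 m) c).map_source hq.2
  have e1 := hZ c q.1 _ hy
  have e2 : (extChartAt (𝓡 m) c).symm (extChartAt (𝓡 m) c q.2) = q.2 :=
    (extChartAt (𝓡 m) c).left_inv hq.2
  have e3 : tangentMapWithin 𝓘(ℝ, Euc m) (𝓡 m) (extChartAt (𝓡 m) c).symm
      (extChartAt (𝓡 m) c).target (⟨extChartAt (𝓡 m) c q.2, Zc c q.1 (extChartAt (𝓡 m) c q.2)⟩ :
        TangentBundle 𝓘(ℝ, Euc m) (Euc m)) =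
      (⟨(extChartAt (𝓡 m) c).symm (extChartAt (𝓡 m) c q.2),
        Z q.1 ((extChartAt (𝓡 m) c).symm (extChartAt (𝓡 m) c q.2))⟩ : TangentBundle (𝓡 m) X) := by
    rw [e1]
    simp only [tangentMapWithin, chartFrame]
    rw [mfderivWithin_of_isOpen ht hy]
    rfl
  refine Eq.trans ?_ e3.symm
  rw [e2]

theorem isInvertible_of_injective_dual {E : Type*} [NormedAddCommGroup E] [NormedSpace ℝ E]
    [FiniteDimensional ℝ E] (L : E →L[ℝ] E →L[ℝ] ℝ) (hL : Function.Injective L) :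
    ∃ e : E ≃L[ℝ] (E →L[ℝ] ℝ), (e : E →L[ℝ] (E →L[ℝ] ℝ)) = L := by
  have hdim : Module.finrank ℝ E = Module.finrank ℝ (E →L[ℝ] ℝ) := by
    rw [← LinearEquiv.finrank_eq (LinearMap.toContinuousLinearMap (𝕜 := ℝ) (E := E) (F' := ℝ))]
    exact (Subspace.dual_finrank_eq (K := ℝ) (V := E)).symm
  refine ⟨(LinearEquiv.ofInjectiveOfFinrankEq L.toLinearMap hL hdim).toContinuousLinearEquiv, ?_⟩
  ext
  rfl

/-- In a chart, T is a smooth family of injective maps from a finite-dimensional space to its dual,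
hence invertible, and inversion of operators is smooth. This one construction yields Hamiltonian,
Reeb and contact vector fields. -/
theorem exists_smooth_dual_vectorField (T : (x : X) → Euc m →ₗ[ℝ] Euc m →ₗ[ℝ] ℝ)
    (β : P → X → Euc m →ₗ[ℝ] ℝ)
    (hT : ∀ c u v, ContDiffOn ℝ ∞ (fun y => T ((extChartAt (𝓡 m) c).symm y)
      (chartFrame c y u) (chartFrame c y v)) (extChartAt (𝓡 m) c).target)
    (hβ : ∀ c v, ContDiffOn ℝ ∞ (fun q : P × Euc m => β q.1 ((extChartAt (𝓡 m) c).symm q.2)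
      (chartFrame c q.2 v)) (univ ×ˢ (extChartAt (𝓡 m) c).target))
    (hnd : ∀ x u, (∀ v, T x u v = 0) → u = 0) :
    ∃ Z : P → X → Euc m, IsSmoothFamily Z ∧
      ∀ p x v, T x (Z p x) v = β p x v := by
  have hex : ∀ p x, ∃ z : Euc m, ∀ v, T x z v = β p x v := fun p x => by
    obtain ⟨e, he⟩ := isInvertible_of_injective_dual
      (LinearMap.toContinuousLinearMap (LinearMap.toContinuousLinearMap.toLinearMap ∘ₗ T x))
      ((injective_iff_map_eq_zero _).2 fun u hu => hnd x u fun v => DFunLike.congr_fun hu v)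
    refine ⟨e.symm (LinearMap.toContinuousLinearMap (β p x)), fun v => ?_⟩
    have := congrArg (fun L : Euc m →L[ℝ] Euc m →L[ℝ] ℝ =>
      L (e.symm (LinearMap.toContinuousLinearMap (β p x))) v) he
    refine this.symm.trans ?_
    simp
  choose Z hZ using hex
  refine ⟨Z, ?_, hZ⟩
  set Tc : X → Euc m → (Euc m →L[ℝ] Euc m →L[ℝ] ℝ) := fun c y =>
    LinearMap.toContinuousLinearMap (LinearMap.toContinuousLinearMap.toLinearMap ∘ₗ
      (T ((extChartAt (𝓡 m) c).symm y)).compl₁₂ (chartFrame c y).toLinearMap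
        (chartFrame c y).toLinearMap) with hTc
  set βc : X → P → Euc m → (Euc m →L[ℝ] ℝ) := fun c p y =>
    LinearMap.toContinuousLinearMap (β p ((extChartAt (𝓡 m) c).symm y) ∘ₗ
      (chartFrame c y).toLinearMap) with hβc
  have hTcs : ∀ c, ContDiffOn ℝ ∞ (Tc c) (extChartAt (𝓡 m) c).target := fun c => by
    rw [contDiffOn_clm_apply]; intro u
    rw [contDiffOn_clm_apply]; intro v
    exact hT c u v
  have hβcs : ∀ c, ContDiffOn ℝ ∞ (fun q : P × Euc m => βc c q.1 q.2)
      (univ ×ˢ (extChartAt (𝓡 m) c).target) := fun c => by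
    rw [contDiffOn_clm_apply]; intro v
    exact hβ c v
  have hinv : ∀ c, ∀ y ∈ (extChartAt (𝓡 m) c).target,
      ∃ e : Euc m ≃L[ℝ] (Euc m →L[ℝ] ℝ), (e : Euc m →L[ℝ] (Euc m →L[ℝ] ℝ)) = Tc c y :=
    fun c y hy => isInvertible_of_injective_dual _ ((injective_iff_map_eq_zero _).2 fun u hu => by
      refine (injective_iff_map_eq_zero _).1 (chartFrame_injective c hy) u (hnd ((extChartAt (𝓡 m) c).symm y) _ fun w => ?_)
      obtain ⟨v, rfl⟩ := chartFrame_surjective c hy w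
      exact DFunLike.congr_fun hu v)
  refine isSmoothFamily_of_inChart (Zc := fun c p y => (Tc c y).inverse (βc c p y))
    (fun c => ?_) fun c p y hy => ?_
  · have h1 : ContDiffOn ℝ ∞ (fun y => (Tc c y).inverse) (extChartAt (𝓡 m) c).target := by
      intro y hy
      obtain ⟨e, he⟩ := hinv c y hy
      have := contDiffAt_map_inverse (n := ∞) e
      rw [he] at this
      exact this.comp_contDiffWithinAt y (hTcs c y hy)
    exact (h1.comp contDiffOn_snd fun q hq => hq.2).clm_apply (hβcs c)
  · obtain ⟨e, he⟩ := hinv c y hy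
    have h1 : Tc c y ((Tc c y).inverse (βc c p y)) = βc c p y := by
      rw [← he, ContinuousLinearMap.inverse_equiv]; simp
    have h2 : Z p ((extChartAt (𝓡 m) c).symm y) -
        chartFrame c y ((Tc c y).inverse (βc c p y)) = 0 := by
      refine hnd ((extChartAt (𝓡 m) c).symm y) _ fun w => ?_
      obtain ⟨v, rfl⟩ := chartFrame_surjective c hy w
      rw [map_sub, LinearMap.sub_apply, hZ, sub_eq_zero]
      exact (DFunLike.congr_fun h1 v).symm
    exact sub_eq_zero.1 h2

end DualVectorField


/-! ### Hamiltonian and contact vector fields -/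

section Fields

variable {m : ℕ} {P : Type} [NormedAddCommGroup P] [NormedSpace ℝ P]
  {X : Type*} [TopologicalSpace X] [ChartedSpace (Euc m) X]

/-- A 1-form as a field of linear functionals. -/
noncomputable def Form.linear (θ : Form m X 1) (x : X) : Euc m →ₗ[ℝ] ℝ where
  toFun v := θ x ![v]
  map_add' v w := (θ x).map_vecCons_add (m := ![]) v w
  map_smul' c v := (θ x).map_vecCons_smul (m := ![]) c v

theorem Form.apply_swap (θ : Form m X 2) (x : X) (u v : Euc m) : θ x ![u, v] = -θ x ![v, u] := by
  refine Eq.trans ?_ ((θ x).map_swap ![v, u] (i := 0) (j := 1) (by decide))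
  refine congrArg (θ x) ?_
  funext i
  fin_cases i <;> rfl

/-- A 2-form as a field of bilinear forms. -/
noncomputable def Form.bilinear (θ : Form m X 2) (x : X) : Euc m →ₗ[ℝ] Euc m →ₗ[ℝ] ℝ :=
  LinearMap.mk₂ ℝ (fun u v => θ x ![u, v])
    (fun u v w => (θ x).map_vecCons_add (m := ![w]) u v)
    (fun c u w => (θ x).map_vecCons_smul (m := ![w]) c u)
    (fun u v w => by
      refine (θ.apply_swap x _ _).trans ?_
      refine (congrArg Neg.neg ((θ x).map_vecCons_add (m := ![u]) v w)).trans ?_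
      rw [neg_add]
      exact congrArg₂ (· + ·) (θ.apply_swap x _ _).symm (θ.apply_swap x _ _).symm)
    (fun c u w => by
      refine (θ.apply_swap x _ _).trans ?_
      refine (congrArg Neg.neg ((θ x).map_vecCons_smul (m := ![u]) c w)).trans ?_
      rw [← smul_neg]
      exact congrArg (c • ·) (θ.apply_swap x _ _).symm)

theorem Form.bilinear_swap (θ : Form m X 2) (x : X) (u v : Euc m) :
    θ.bilinear x u v = -θ.bilinear x v u := θ.apply_swap x u v

/-- The differential of a function. -/
noncomputable def diff (F : X → ℝ) (x : X) : Euc m →L[ℝ] ℝ := mfderiv (𝓡 m) 𝓘(ℝ, ℝ) F x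

variable [IsManifold (𝓡 m) ∞ X]

theorem Form.IsSmooth.contDiffOn_linear {θ : Form m X 1} (hθ : θ.IsSmooth) (c : X) (v : Euc m) :
    ContDiffOn ℝ ∞ (fun y => θ.linear ((extChartAt (𝓡 m) c).symm y) (chartFrame c y v))
      (extChartAt (𝓡 m) c).target := by
  refine ((hθ c).continuousAlternatingMap_apply (g := fun _ _ => v)
    fun _ => contDiffOn_const).congr fun y _ => ?_
  refine Form.apply_congr θ rfl ?_
  ext i; fin_cases i; rfl

theorem Form.IsSmooth.contDiffOn_bilinear {θ : Form m X 2} (hθ : θ.IsSmooth) (c : X)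
    (u v : Euc m) :
    ContDiffOn ℝ ∞ (fun y => θ.bilinear ((extChartAt (𝓡 m) c).symm y) (chartFrame c y u)
      (chartFrame c y v)) (extChartAt (𝓡 m) c).target := by
  refine ((hθ c).continuousAlternatingMap_apply (g := fun i _ => ![u, v] i)
    fun _ => contDiffOn_const).congr fun y _ => ?_
  refine Form.apply_congr θ rfl ?_
  funext i; fin_cases i <;> rfl

theorem contDiffOn_inChart {F : P → X → ℝ}
    (hF : ContMDiff (𝓘(ℝ, P).prod (𝓡 m)) 𝓘(ℝ, ℝ) ∞ (fun q : P × X => F q.1 q.2)) (c : X) :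
    ContDiffOn ℝ ∞ (fun q : P × Euc m => F q.1 ((extChartAt (𝓡 m) c).symm q.2))
      (univ ×ˢ (extChartAt (𝓡 m) c).target) := by
  rw [← contMDiffOn_iff_contDiffOn]
  have h1 : ContMDiffOn 𝓘(ℝ, P × Euc m) (𝓡 m) ∞
      (fun q : P × Euc m => (extChartAt (𝓡 m) c).symm q.2)
      (univ ×ˢ (extChartAt (𝓡 m) c).target) :=
    (contMDiffOn_extChartAt_symm c).comp contDiff_snd.contMDiff.contMDiffOn fun q hq => hq.2
  exact hF.comp_contMDiffOn (contDiff_fst.contMDiff.contMDiffOn.prodMk h1)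

theorem fderiv_inChart {F : P → X → ℝ}
    (hF : ContMDiff (𝓘(ℝ, P).prod (𝓡 m)) 𝓘(ℝ, ℝ) ∞ (fun q : P × X => F q.1 q.2)) (c : X) (p : P)
    {y : Euc m} (hy : y ∈ (extChartAt (𝓡 m) c).target) (v : Euc m) :
    diff (F p) ((extChartAt (𝓡 m) c).symm y) (chartFrame c y v) =
      fderiv ℝ (fun q : P × Euc m => F q.1 ((extChartAt (𝓡 m) c).symm q.2)) (p, y) (0, v) := by
  have hFp : ContMDiff (𝓡 m) 𝓘(ℝ, ℝ) ∞ (F p) := hF.comp (contMDiff_const.prodMk contMDiff_id)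
  have hs := mdifferentiableAt_extChartAt_symm_of_boundaryless (I := 𝓡 m) c hy
  have h1 := mfderiv_comp_apply (I := 𝓘(ℝ, Euc m)) (I' := 𝓡 m) (I'' := 𝓘(ℝ, ℝ)) y
    ((hFp ((extChartAt (𝓡 m) c).symm y)).mdifferentiableAt (by simp)) hs v
  refine h1.symm.trans ?_
  rw [mfderiv_eq_fderiv]
  have h2 : DifferentiableAt ℝ (fun q : P × Euc m => F q.1 ((extChartAt (𝓡 m) c).symm q.2))
      (p, y) := ((contDiffOn_inChart hF c).contDiffAt
    ((isOpen_univ.prod (isOpen_extChartAt_target c)).mem_nhds ⟨mem_univ _, hy⟩)).differentiableAt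
      (by simp)
  have h3 := h2.hasFDerivAt.comp y ((hasFDerivAt_const p y).prodMk (hasFDerivAt_id y))
  exact DFunLike.congr_fun h3.fderiv v

theorem contDiffOn_diff_chartFrame {F : P → X → ℝ}
    (hF : ContMDiff (𝓘(ℝ, P).prod (𝓡 m)) 𝓘(ℝ, ℝ) ∞ (fun q : P × X => F q.1 q.2)) (c : X)
    {w : P × Euc m → Euc m} (hw : ContDiffOn ℝ ∞ w (univ ×ˢ (extChartAt (𝓡 m) c).target)) :
    ContDiffOn ℝ ∞ (fun q : P × Euc m =>
      diff (F q.1) ((extChartAt (𝓡 m) c).symm q.2) (chartFrame c q.2 (w q)))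
      (univ ×ˢ (extChartAt (𝓡 m) c).target) := by
  have h1 := ((contDiffOn_inChart hF c).fderiv_of_isOpen
    (isOpen_univ.prod (isOpen_extChartAt_target c)) (m := ∞) (by simp)).clm_apply
    (contDiffOn_const (c := (0 : P)).prodMk hw)
  exact h1.congr fun q hq => fderiv_inChart hF c q.1 hq.2 _

theorem contMDiff_of_inChart {F : P → X → ℝ}
    (hF : ∀ c, ContDiffOn ℝ ∞ (fun q : P × Euc m => F q.1 ((extChartAt (𝓡 m) c).symm q.2))
      (univ ×ˢ (extChartAt (𝓡 m) c).target)) :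
    ContMDiff (𝓘(ℝ, P).prod (𝓡 m)) 𝓘(ℝ, ℝ) ∞ (fun q : P × X => F q.1 q.2) := by
  intro q₀
  set c := q₀.2 with hc
  have hs : IsOpen ((univ : Set P) ×ˢ (extChartAt (𝓡 m) c).source) :=
    isOpen_univ.prod (isOpen_extChartAt_source c)
  have hφ : ContMDiffOn (𝓘(ℝ, P).prod (𝓡 m)) 𝓘(ℝ, Euc m) ∞
      (fun q : P × X => extChartAt (𝓡 m) c q.2) (univ ×ˢ (extChartAt (𝓡 m) c).source) := by
    refine ContMDiffOn.comp (t := (extChartAt (𝓡 m) c).source) ?_ contMDiffOn_snd fun q hq => hq.2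
    rw [extChartAt_source]
    exact contMDiffOn_extChartAt
  have hpair : ContMDiffOn (𝓘(ℝ, P).prod (𝓡 m)) 𝓘(ℝ, P × Euc m) ∞
      (fun q : P × X => (q.1, extChartAt (𝓡 m) c q.2)) (univ ×ˢ (extChartAt (𝓡 m) c).source) :=
    contMDiffOn_fst.prodMk_space hφ
  have h2 := (hF c).contMDiffOn.comp hpair
    fun q hq => ⟨mem_univ _, (extChartAt (𝓡 m) c).map_source hq.2⟩
  have hmem : ((univ : Set P) ×ˢ (extChartAt (𝓡 m) c).source) ∈ 𝓝 q₀ :=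
    hs.mem_nhds ⟨mem_univ _, mem_extChartAt_source c⟩
  refine (h2.contMDiffAt hmem).congr_of_eventuallyEq ?_
  filter_upwards [hmem] with q hq
  simp only [Function.comp_apply]
  rw [(extChartAt (𝓡 m) c).left_inv hq.2]

/-- Smooth functions have smooth Hamiltonian vector fields. -/
theorem IsSymplecticForm.exists_vectorField {Ω : Form m X 2} (hΩ : IsSymplecticForm Ω)
    {F : P → X → ℝ}
    (hF : ContMDiff (𝓘(ℝ, P).prod (𝓡 m)) 𝓘(ℝ, ℝ) ∞ (fun q : P × X => F q.1 q.2)) :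
    ∃ Z : P → X → Euc m, IsSmoothFamily Z ∧
      ∀ p x v, Ω.bilinear x (Z p x) v = -diff (F p) x v :=
  exists_smooth_dual_vectorField Ω.bilinear (fun p x => -(diff (F p) x).toLinearMap)
    (fun c u v => hΩ.smooth.contDiffOn_bilinear c u v)
    (fun c v => (contDiffOn_diff_chartFrame hF c (contDiffOn_const (c := v))).neg)
    fun x u hu => hΩ.nondegenerate x u hu

theorem IsSymplecticForm.eq_of_forall {Ω : Form m X 2} (hΩ : IsSymplecticForm Ω) {x : X}
    {u w : Euc m} (h : ∀ v, Ω.bilinear x u v = Ω.bilinear x w v) : u = w := by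
  have h1 : ∀ v, Ω.bilinear x (u - w) v = 0 := fun v => by
    rw [LinearMap.map_sub₂, h, sub_self]
  exact sub_eq_zero.1 (hΩ.nondegenerate x _ h1)

/-- `R` is the Reeb vector field of the 1-form `α`. -/
structure IsReebField (α : Form m X 1) (R : X → Euc m) : Prop where
  apply_eq_one : ∀ x, α.linear x (R x) = 1
  d_eq_zero : ∀ x v, α.d.bilinear x (R x) v = 0

/-- The bilinear form `dα + α ⊗ α`. -/
noncomputable def Form.contactBilinear (α : Form m X 1) (x : X) : Euc m →ₗ[ℝ] Euc m →ₗ[ℝ] ℝ :=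
  α.d.bilinear x + (α.linear x).smulRight (α.linear x)

theorem Form.contactBilinear_apply (α : Form m X 1) (x : X) (u v : Euc m) :
    α.contactBilinear x u v = α.d.bilinear x u v + α.linear x u * α.linear x v := rfl

section Contact

variable {α : Form m X 1} {R : X → Euc m}

theorem IsReebField.contactBilinear_reeb (hR : IsReebField α R) (x : X) (u : Euc m) :
    α.contactBilinear x u (R x) = α.linear x u := by
  rw [Form.contactBilinear_apply, Form.bilinear_swap, hR.d_eq_zero, hR.apply_eq_one]
  ring

/-- Pairing u with the Reeb vector reads off α(u). If all pairings vanish, then α(u) = 0, so dα(u,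
·) = 0, and the contact condition applies. -/
theorem IsReebField.contactBilinear_nondegenerate (hR : IsReebField α R) (hα : IsContactForm α)
    (x : X) (u : Euc m) (h : ∀ v, α.contactBilinear x u v = 0) : u = 0 := by
  have h0 : α.linear x u = 0 := by rw [← hR.contactBilinear_reeb, h]
  have h1 : ∀ v, α.d.bilinear x u v = 0 := fun v => by
    have := h v
    rwa [Form.contactBilinear_apply, h0, zero_mul, add_zero] at this
  exact hα.nondegenerate x u h0 fun v _ => h1 v

theorem IsContactForm.contDiffOn_contactBilinear (hα : IsContactForm α) (c : X) (u v : Euc m) :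
    ContDiffOn ℝ ∞ (fun y => α.contactBilinear ((extChartAt (𝓡 m) c).symm y) (chartFrame c y u)
      (chartFrame c y v)) (extChartAt (𝓡 m) c).target :=
  (hα.smooth.d.contDiffOn_bilinear c u v).add
    ((hα.smooth.contDiffOn_linear c u).mul (hα.smooth.contDiffOn_linear c v))

theorem IsReebField.eq_of_forall (hR : IsReebField α R) (hα : IsContactForm α) {x : X}
    {u w : Euc m} (h0 : α.linear x u = α.linear x w)
    (h : ∀ v, α.d.bilinear x u v = α.d.bilinear x w v) : u = w := by
  refine sub_eq_zero.1 (hR.contactBilinear_nondegenerate hα x _ fun v => ?_)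
  rw [LinearMap.map_sub₂, Form.contactBilinear_apply, Form.contactBilinear_apply, h0, h, sub_self]

/-- The Reeb field is the dual of α under dα + α ⊗ α, so its smoothness, which is not assumed,
follows. -/
theorem IsReebField.contMDiff (hR : IsReebField α R) (hα : IsContactForm α) :
    ContMDiff (𝓡 m) (𝓡 m).tangent ∞ (fun x => (⟨x, R x⟩ : TangentBundle (𝓡 m) X)) := by
  obtain ⟨Z, hZ, h⟩ := exists_smooth_dual_vectorField (P := ℝ) α.contactBilinear
    (fun _ x => α.linear x) hα.contDiffOn_contactBilinear
    (fun c v => (hα.smooth.contDiffOn_linear c v).comp contDiffOn_snd fun q hq => hq.2)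
    (hR.contactBilinear_nondegenerate hα)
  have h' : ∀ x v, α.contactBilinear x (Z 0 x) v = α.linear x v := h 0
  have e : ∀ x, R x = Z 0 x := fun x => by
    refine sub_eq_zero.1 (hR.contactBilinear_nondegenerate hα x _ fun v => ?_)
    rw [LinearMap.map_sub₂, h', Form.contactBilinear_apply, hR.d_eq_zero, hR.apply_eq_one,
      zero_add, one_mul, sub_self]
  have := hZ.comp ((contMDiff_const (c := (0 : ℝ))).prodMk (contMDiff_id (M := X) (I := 𝓡 m)))
  refine this.congr fun x => ?_
  rw [e]
  rfl

theorem IsReebField.contMDiff_diff (hR : IsReebField α R) (hα : IsContactForm α) {h : P → X → ℝ}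
    (hh : ContMDiff (𝓘(ℝ, P).prod (𝓡 m)) 𝓘(ℝ, ℝ) ∞ (fun q : P × X => h q.1 q.2)) :
    ContMDiff (𝓘(ℝ, P).prod (𝓡 m)) 𝓘(ℝ, ℝ) ∞ (fun q : P × X => diff (h q.1) q.2 (R q.2)) := by
  refine contMDiff_of_inChart (F := fun p x => diff (h p) x (R x)) fun c => ?_
  have h1 := contDiffOn_mfderiv_extChartAt_vectorField (hR.contMDiff hα) c
  refine (contDiffOn_diff_chartFrame hh c (h1.comp contDiffOn_snd fun q hq => hq.2)).congr
    fun q hq => ?_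
  exact congrArg (diff (h q.1) _)
    (mfderiv_extChartAt_symm_apply_mfderiv_extChartAt (I := 𝓡 m) c hq.2 _).symm

/-- Smooth functions have smooth contact vector fields. -/
theorem IsReebField.exists_vectorField (hR : IsReebField α R) (hα : IsContactForm α)
    {h : P → X → ℝ}
    (hh : ContMDiff (𝓘(ℝ, P).prod (𝓡 m)) 𝓘(ℝ, ℝ) ∞ (fun q : P × X => h q.1 q.2)) :
    ∃ Z : P → X → Euc m, IsSmoothFamily Z ∧
      (∀ p x, α.linear x (Z p x) = h p x) ∧ ∀ p x v,
        α.d.bilinear x (Z p x) v = -diff (h p) x v + diff (h p) x (R x) * α.linear x v := by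
  -- The field is dual to -dh + dh(R) α + h α. Evaluation on R gives α(Z) = h; the terms coming from
  -- α ⊗ α then cancel and leave the condition on dα.
  obtain ⟨Z, hZ, hT⟩ := exists_smooth_dual_vectorField (P := P) α.contactBilinear
    (fun p x => -(diff (h p) x).toLinearMap + diff (h p) x (R x) • α.linear x +
      h p x • α.linear x) hα.contDiffOn_contactBilinear
    (fun c v => (((contDiffOn_diff_chartFrame hh c (contDiffOn_const (c := v))).neg.add
      ((contDiffOn_inChart (F := fun p x => diff (h p) x (R x)) (hR.contMDiff_diff hα hh) c).mul
        ((hα.smooth.contDiffOn_linear c v).comp contDiffOn_snd fun q hq => hq.2)))).add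
      ((contDiffOn_inChart hh c).mul
        ((hα.smooth.contDiffOn_linear c v).comp contDiffOn_snd fun q hq => hq.2)))
    (hR.contactBilinear_nondegenerate hα)
  have h1 : ∀ p x (v : Euc m), α.d.bilinear x (Z p x) v + α.linear x (Z p x) * α.linear x v =
      -diff (h p) x v + diff (h p) x (R x) * α.linear x v + h p x * α.linear x v := hT
  have h2 : ∀ p x, α.linear x (Z p x) = h p x := fun p x => by
    have := h1 p x (R x)
    rw [Form.bilinear_swap, hR.d_eq_zero, hR.apply_eq_one] at this
    linarith
  refine ⟨Z, hZ, h2, fun p x v => ?_⟩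
  have := h1 p x v
  rw [h2] at this
  linarith

end Contact

end Fields


/-! ### Derivatives of families of diffeomorphisms -/

section FamilyCalculus

variable {m k : ℕ} {X : Type*} [TopologicalSpace X] [ChartedSpace (Euc m) X]
  {Y : Type*} [TopologicalSpace Y] [ChartedSpace (Euc k) Y]

/-- The derivative of a map between manifolds. -/
noncomputable def tmap (f : X → Y) (x : X) : Euc m →L[ℝ] Euc k := mfderiv (𝓡 m) (𝓡 k) f x

/-- The velocity of a curve. -/
noncomputable def curveVel (γ : ℝ → X) (t : ℝ) : Euc m := mfderiv 𝓘(ℝ, ℝ) (𝓡 m) γ t (1 : ℝ)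

/-- The velocity of a path of diffeomorphisms. -/
noncomputable def DiffeoFamily.vel (φ : DiffeoFamily m ℝ X) (t : ℝ) (x : X) : Euc m :=
  curveVel (fun τ => φ.toFun τ x) t

theorem hasMFDerivAt_curveVel {γ : ℝ → X} {t : ℝ} (h : MDifferentiableAt 𝓘(ℝ, ℝ) (𝓡 m) γ t) :
    HasMFDerivAt 𝓘(ℝ, ℝ) (𝓡 m) γ t ((1 : ℝ →L[ℝ] ℝ).smulRight (curveVel γ t)) := by
  refine h.hasMFDerivAt.congr_mfderiv (ContinuousLinearMap.ext_ring ?_)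
  change _ = (1 : ℝ) • curveVel γ t
  rw [one_smul]
  rfl

theorem curveVel_eq {γ : ℝ → X} {t : ℝ} {w : Euc m}
    (h : HasMFDerivAt 𝓘(ℝ, ℝ) (𝓡 m) γ t ((1 : ℝ →L[ℝ] ℝ).smulRight w)) : curveVel γ t = w := by
  have h1 := DFunLike.congr_fun h.mfderiv (1 : ℝ)
  refine h1.trans ?_
  change (1 : ℝ) • w = w
  exact one_smul ℝ w

theorem curveVel_comp {γ : ℝ → X} {t : ℝ} {f : X → Y}
    (hf : MDifferentiableAt (𝓡 m) (𝓡 k) f (γ t)) (h : MDifferentiableAt 𝓘(ℝ, ℝ) (𝓡 m) γ t) :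
    curveVel (m := k) (fun τ => f (γ τ)) t = tmap f (γ t) (curveVel (m := m) γ t) :=
  mfderiv_comp_apply (I := 𝓘(ℝ, ℝ)) (I' := 𝓡 m) (I'' := 𝓡 k) t hf h (1 : ℝ)

theorem diff_comp {f : X → Y} {g : Y → ℝ} {x : X} (hg : MDifferentiableAt (𝓡 k) 𝓘(ℝ, ℝ) g (f x))
    (hf : MDifferentiableAt (𝓡 m) (𝓡 k) f x) (v : Euc m) :
    diff (m := m) (fun x => g (f x)) x v = diff (m := k) g (f x) (tmap f x v) :=
  mfderiv_comp_apply (I := 𝓡 m) (I' := 𝓡 k) (I'' := 𝓘(ℝ, ℝ)) x hg hf v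

theorem tmap_comp {l : ℕ} {Z : Type*} [TopologicalSpace Z] [ChartedSpace (Euc l) Z] {f : X → Y}
    {g : Y → Z} {x : X} (hg : MDifferentiableAt (𝓡 k) (𝓡 l) g (f x))
    (hf : MDifferentiableAt (𝓡 m) (𝓡 k) f x) (v : Euc m) :
    tmap (m := m) (k := l) (fun x => g (f x)) x v = tmap (m := k) g (f x) (tmap f x v) :=
  mfderiv_comp_apply (I := 𝓡 m) (I' := 𝓡 k) (I'' := 𝓡 l) x hg hf v

theorem tmap_id (x : X) (v : Euc m) : tmap (fun x : X => x) x v = v := by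
  have : mfderiv (𝓡 m) (𝓡 m) (fun x : X => x) x = ContinuousLinearMap.id ℝ _ := mfderiv_id
  exact DFunLike.congr_fun this v

theorem tmap_congr {f g : X → Y} (h : ∀ x, f x = g x) (x : X) (v : Euc m) :
    tmap (m := m) (k := k) f x v = tmap g x v := by
  rw [funext h]

theorem DiffeoFamily.contMDiff_curve (φ : DiffeoFamily m ℝ X) (x : X) :
    ContMDiff 𝓘(ℝ, ℝ) (𝓡 m) ∞ (fun τ => φ.toFun τ x) :=
  φ.smooth_toFun.comp (contMDiff_id.prodMk contMDiff_const)

theorem DiffeoFamily.hasMFDerivAt_vel (φ : DiffeoFamily m ℝ X) (t : ℝ) (x : X) :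
    HasMFDerivAt 𝓘(ℝ, ℝ) (𝓡 m) (fun τ => φ.toFun τ x) t
      ((1 : ℝ →L[ℝ] ℝ).smulRight (φ.vel t x)) :=
  hasMFDerivAt_curveVel ((φ.contMDiff_curve x).mdifferentiable (by simp) t)

theorem DiffeoFamily.mdifferentiable (φ : DiffeoFamily m ℝ X) (t : ℝ) :
    MDifferentiable (𝓡 m) (𝓡 m) (φ.toFun t) := (φ.smooth_apply t).mdifferentiable (by simp)

theorem curveVel_line {Q : Type*} [NormedAddCommGroup Q] [NormedSpace ℝ Q] {u : Q → X}
    {q : Q} (hu : MDifferentiableAt 𝓘(ℝ, Q) (𝓡 m) u q) {g : ℝ → Q} {t : ℝ} {e : Q}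
    (hg : HasDerivAt g e t) (hq : g t = q) :
    curveVel (fun τ => u (g τ)) t = (mfderiv 𝓘(ℝ, Q) (𝓡 m) u q e : Euc m) := by
  subst hq
  have h1 := mfderiv_comp_apply (I := 𝓘(ℝ, ℝ)) (I' := 𝓘(ℝ, Q)) (I'' := 𝓡 m) t hu
    hg.differentiableAt.mdifferentiableAt (1 : ℝ)
  refine h1.trans ?_
  rw [mfderiv_eq_fderiv, hg.hasFDerivAt.fderiv]
  change (mfderiv 𝓘(ℝ, Q) (𝓡 m) u (g t) ((1 : ℝ) • e) : Euc m) = _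
  rw [one_smul]

variable [IsManifold (𝓡 m) ∞ X]

theorem Form.pullbackTo_one_apply (α : Form m X 1) {Q : Type*} [NormedAddCommGroup Q]
    [NormedSpace ℝ Q] (u : Q → X) (q e : Q) :
    α.pullbackTo u q ![e] = α.linear (u q) (mfderiv 𝓘(ℝ, Q) (𝓡 m) u q e) := by
  refine Form.apply_congr α rfl ?_
  funext i; fin_cases i; rfl

theorem Form.pullbackTo_two_apply (θ : Form m X 2) {Q : Type*} [NormedAddCommGroup Q]
    [NormedSpace ℝ Q] (u : Q → X) (q e e' : Q) :
    θ.pullbackTo u q ![e, e'] = θ.bilinear (u q) (mfderiv 𝓘(ℝ, Q) (𝓡 m) u q e)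
      (mfderiv 𝓘(ℝ, Q) (𝓡 m) u q e') := by
  refine Form.apply_congr θ rfl ?_
  funext i; fin_cases i <;> rfl

/-- The pairing of a 1-form with the velocity of a path of diffeomorphisms. -/
noncomputable def DiffeoFamily.pairing (φ : DiffeoFamily m ℝ X) (α : Form m X 1) (t : ℝ) (x : X) :
    ℝ := α.linear (φ.toFun t x) (φ.vel t x)

namespace DiffeoFamily

variable (φ : DiffeoFamily m ℝ X)

theorem contMDiffOn_inChart (c : X) : ContMDiffOn 𝓘(ℝ, ℝ × Euc m) (𝓡 m) ∞
    (fun q : ℝ × Euc m => φ.toFun q.1 ((extChartAt (𝓡 m) c).symm q.2))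
    (univ ×ˢ (extChartAt (𝓡 m) c).target) := by
  have h1 : ContMDiffOn 𝓘(ℝ, ℝ × Euc m) (𝓡 m) ∞
      (fun q : ℝ × Euc m => (extChartAt (𝓡 m) c).symm q.2)
      (univ ×ˢ (extChartAt (𝓡 m) c).target) :=
    (contMDiffOn_extChartAt_symm c).comp contDiff_snd.contMDiff.contMDiffOn fun q hq => hq.2
  exact φ.smooth_toFun.comp_contMDiffOn (contDiff_fst.contMDiff.contMDiffOn.prodMk h1)

variable {c : X} {y : Euc m}

theorem mdifferentiableAt_inChart (hy : y ∈ (extChartAt (𝓡 m) c).target) (t : ℝ) :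
    MDifferentiableAt 𝓘(ℝ, ℝ × Euc m) (𝓡 m)
    (fun q : ℝ × Euc m => φ.toFun q.1 ((extChartAt (𝓡 m) c).symm q.2)) (t, y) :=
  ((φ.contMDiffOn_inChart c).contMDiffAt ((isOpen_univ.prod
    (isOpen_extChartAt_target c)).mem_nhds ⟨mem_univ _, hy⟩)).mdifferentiableAt (by simp)

theorem mfderiv_inChart_time (hy : y ∈ (extChartAt (𝓡 m) c).target) (t : ℝ) :
    (mfderiv 𝓘(ℝ, ℝ × Euc m) (𝓡 m) (fun q : ℝ × Euc m => φ.toFun q.1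
      ((extChartAt (𝓡 m) c).symm q.2)) (t, y) ((1, 0) : ℝ × Euc m) : Euc m) =
      φ.vel t ((extChartAt (𝓡 m) c).symm y) :=
  (curveVel_line (φ.mdifferentiableAt_inChart hy t)
    ((hasDerivAt_id t).prodMk (hasDerivAt_const t y)) rfl).symm

theorem mfderiv_inChart_space (hy : y ∈ (extChartAt (𝓡 m) c).target) (t : ℝ) (w : Euc m) :
    (mfderiv 𝓘(ℝ, ℝ × Euc m) (𝓡 m) (fun q : ℝ × Euc m => φ.toFun q.1
      ((extChartAt (𝓡 m) c).symm q.2)) (t, y) ((0, w) : ℝ × Euc m) : Euc m) =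
      tmap (φ.toFun t) ((extChartAt (𝓡 m) c).symm y) (chartFrame c y w) := by
  have hg : HasFDerivAt (fun y : Euc m => (t, y)) (ContinuousLinearMap.inr ℝ ℝ (Euc m)) y :=
    (hasFDerivAt_const t y).prodMk (hasFDerivAt_id y)
  have h1 := mfderiv_comp_apply (I := 𝓘(ℝ, Euc m)) (I' := 𝓘(ℝ, ℝ × Euc m)) (I'' := 𝓡 m) y
    (φ.mdifferentiableAt_inChart hy t) hg.differentiableAt.mdifferentiableAt w
  have h2 := mfderiv_comp_apply (I := 𝓘(ℝ, Euc m)) (I' := 𝓡 m) (I'' := 𝓡 m) y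
    (φ.mdifferentiable t _) (mdifferentiableAt_extChartAt_symm_of_boundaryless c hy) w
  rw [mfderiv_eq_fderiv, hg.fderiv] at h1
  exact h1.symm.trans h2

theorem contMDiff_pairing {α : Form m X 1} (hα : α.IsSmooth) :
    ContMDiff (𝓘(ℝ, ℝ).prod (𝓡 m)) 𝓘(ℝ, ℝ) ∞ (fun q : ℝ × X => φ.pairing α q.1 q.2) := by
  refine contMDiff_of_inChart fun c => ?_
  have h1 := hα.contDiffOn_pullbackTo_apply
    (isOpen_univ.prod (isOpen_extChartAt_target c)) (φ.contMDiffOn_inChart c)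
    (w := fun _ _ => ((1, 0) : ℝ × Euc m)) fun _ => contDiffOn_const
  refine h1.congr fun q hq => ?_
  have e : (fun _ => ((1, 0) : ℝ × Euc m) : Fin 1 → ℝ × Euc m) = ![((1, 0) : ℝ × Euc m)] := by
    ext i <;> fin_cases i <;> rfl
  rw [e, Form.pullbackTo_one_apply]
  exact congrArg _ (φ.mfderiv_inChart_time hq.2 q.1).symm

theorem contMDiff_pairing_apply {α : Form m X 1} (hα : α.IsSmooth) (t : ℝ) :
    ContMDiff (𝓡 m) 𝓘(ℝ, ℝ) ∞ (φ.pairing α t) :=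
  (φ.contMDiff_pairing hα).comp (contMDiff_const.prodMk contMDiff_id)

/-- Cartan's formula along a path of diffeomorphisms. -/
theorem hasDerivAt_linear_tmap {α : Form m X 1} (hα : α.IsSmooth) (t : ℝ) (x : X) (v : Euc m) :
    HasDerivAt (fun τ => α.linear (φ.toFun τ x) (tmap (φ.toFun τ) x v))
      (diff (φ.pairing α t) x v +
        α.d.bilinear (φ.toFun t x) (φ.vel t x) (tmap (φ.toFun t) x v)) t := by
  obtain ⟨c, y, hy, rfl⟩ : ∃ c, ∃ y ∈ (extChartAt (𝓡 m) c).target,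
      (extChartAt (𝓡 m) c).symm y = x := ⟨x, _, mem_extChartAt_target x, extChartAt_to_inv x⟩
  obtain ⟨w, rfl⟩ := chartFrame_surjective c hy v
  set u := fun q : ℝ × Euc m => φ.toFun q.1 ((extChartAt (𝓡 m) c).symm q.2) with hu
  have hs : IsOpen ((univ : Set ℝ) ×ˢ (extChartAt (𝓡 m) c).target) :=
    isOpen_univ.prod (isOpen_extChartAt_target c)
  have hmem : ((t, y) : ℝ × Euc m) ∈ (univ : Set ℝ) ×ˢ (extChartAt (𝓡 m) c).target :=
    ⟨mem_univ _, hy⟩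
  have hus := φ.contMDiffOn_inChart c
  -- The coordinate fields ∂_t and w are constant in (t, y), so Cartan's formula has no bracket
  -- term.
  have hcartan := hα.fderiv_pullbackTo_sub hs hus hmem (1, 0) (0, w)
  rw [Form.pullbackTo_two_apply, φ.mfderiv_inChart_time hy, φ.mfderiv_inChart_space hy] at hcartan
  have hA : HasFDerivAt (fun q => α.pullbackTo u q ![((0, w) : ℝ × Euc m)])
      (fderiv ℝ (fun q => α.pullbackTo u q ![((0, w) : ℝ × Euc m)]) (t, y)) (t, y) := by
    refine DifferentiableAt.hasFDerivAt ?_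
    have h1 := hα.contDiffOn_pullbackTo_apply hs hus
      (w := fun _ _ => ((0, w) : ℝ × Euc m)) fun _ => contDiffOn_const
    have e : (fun _ => ((0, w) : ℝ × Euc m) : Fin 1 → ℝ × Euc m) = ![((0, w) : ℝ × Euc m)] := by
      ext i <;> fin_cases i <;> rfl
    rw [e] at h1
    exact (h1.contDiffAt (hs.mem_nhds hmem)).differentiableAt (by simp)
  have hA' := hA.comp_hasDerivAt t ((hasDerivAt_id t).prodMk (hasDerivAt_const t y))
  have hB : fderiv ℝ (fun q => α.pullbackTo u q ![((1, 0) : ℝ × Euc m)]) (t, y) (0, w) =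
      diff (φ.pairing α t) ((extChartAt (𝓡 m) c).symm y) (chartFrame c y w) := by
    rw [fderiv_inChart (φ.contMDiff_pairing hα) c t hy]
    refine congrArg (fun L : ℝ × Euc m →L[ℝ] ℝ => L (0, w)) (Filter.EventuallyEq.fderiv_eq ?_)
    filter_upwards [hs.mem_nhds hmem] with q hq
    rw [Form.pullbackTo_one_apply]
    exact congrArg _ (φ.mfderiv_inChart_time hq.2 q.1)
  rw [hB] at hcartan
  rw [add_comm, ← eq_add_of_sub_eq hcartan]
  refine hA'.congr_of_eventuallyEq (Eventually.of_forall fun τ => ?_)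
  rw [Function.comp_apply, Form.pullbackTo_one_apply]
  exact congrArg _ (φ.mfderiv_inChart_space hy τ w).symm

end DiffeoFamily

/-- Cartan's formula along a surface. -/
theorem hasDerivAt_linear_surface {α : Form m X 1} (hα : α.IsSmooth) {u : ℝ × ℝ → X}
    (hu : ContMDiff 𝓘(ℝ, ℝ × ℝ) (𝓡 m) ∞ u) (s t : ℝ) {f : ℝ × ℝ → ℝ}
    (hf : ∀ s t, α.linear (u (s, t)) (curveVel (fun τ => u (s, τ)) t) = f (s, t)) {f' : ℝ}
    (hf' : HasDerivAt (fun σ => f (σ, t)) f' s) :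
    HasDerivAt (fun τ => α.linear (u (s, τ)) (curveVel (fun σ => u (σ, τ)) s))
      (f' + α.d.bilinear (u (s, t)) (curveVel (fun τ => u (s, τ)) t)
        (curveVel (fun σ => u (σ, t)) s)) t := by
  have hd : ∀ q, MDifferentiableAt 𝓘(ℝ, ℝ × ℝ) (𝓡 m) u q := hu.mdifferentiable (by simp)
  have ht : ∀ s t, curveVel (fun τ => u (s, τ)) t =
      (mfderiv 𝓘(ℝ, ℝ × ℝ) (𝓡 m) u (s, t) ((0, 1) : ℝ × ℝ) : Euc m) := fun s t =>
    curveVel_line (hd (s, t)) ((hasDerivAt_const t s).prodMk (hasDerivAt_id t)) rfl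
  have hs : ∀ s t, curveVel (fun σ => u (σ, t)) s =
      (mfderiv 𝓘(ℝ, ℝ × ℝ) (𝓡 m) u (s, t) ((1, 0) : ℝ × ℝ) : Euc m) := fun s t =>
    curveVel_line (hd (s, t)) ((hasDerivAt_id s).prodMk (hasDerivAt_const s t)) rfl
  have hus := hu.contMDiffOn (s := univ)
  have hcartan := hα.fderiv_pullbackTo_sub isOpen_univ hus (mem_univ (s, t)) (0, 1) (1, 0)
  rw [Form.pullbackTo_two_apply, ← ht, ← hs] at hcartan
  have hdiff : ∀ e : ℝ × ℝ, DifferentiableAt ℝ (fun q => α.pullbackTo u q ![e]) (s, t) := by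
    intro e
    have h1 := hα.contDiffOn_pullbackTo_apply isOpen_univ hus
      (w := fun _ _ => e) fun _ => contDiffOn_const
    have e' : (fun _ => e : Fin 1 → ℝ × ℝ) = ![e] := by
      ext i <;> fin_cases i <;> rfl
    rw [e'] at h1
    exact (h1.contDiffAt univ_mem).differentiableAt (by simp)
  have hA := (hdiff (1, 0)).hasFDerivAt.comp_hasDerivAt t
    ((hasDerivAt_const t s).prodMk (hasDerivAt_id t))
  have hB := (hdiff (0, 1)).hasFDerivAt.comp_hasDerivAt s
    ((hasDerivAt_id s).prodMk (hasDerivAt_const s t))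
  have hBf : fderiv ℝ (fun q => α.pullbackTo u q ![((0, 1) : ℝ × ℝ)]) (s, t) (1, 0) = f' := by
    refine hB.unique (hf'.congr_of_eventuallyEq (Eventually.of_forall fun σ => ?_))
    rw [Function.comp_apply, Form.pullbackTo_one_apply, ← ht]
    exact hf _ _
  rw [hBf] at hcartan
  rw [add_comm, ← eq_add_of_sub_eq hcartan]
  refine hA.congr_of_eventuallyEq (Eventually.of_forall fun τ => ?_)
  rw [Function.comp_apply, Form.pullbackTo_one_apply, ← hs]

end FamilyCalculus

end Prequant

end

section

open Set Metric Filter Topology MeasureTheory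

set_option linter.unusedSectionVars false

namespace Prequant

/-! ### Contact and Hamiltonian flows -/

section Flows

variable {m : ℕ} {X : Type*} [TopologicalSpace X] [ChartedSpace (Euc m) X]
  [IsManifold (𝓡 m) ∞ X]

theorem contMDiff_apply_left {P : Type*} [NormedAddCommGroup P] [NormedSpace ℝ P] {F : P → X → ℝ}
    (hF : ContMDiff (𝓘(ℝ, P).prod (𝓡 m)) 𝓘(ℝ, ℝ) ∞ (fun q : P × X => F q.1 q.2)) (p : P) :
    ContMDiff (𝓡 m) 𝓘(ℝ, ℝ) ∞ (F p) := hF.comp (contMDiff_const.prodMk contMDiff_id)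

/-- The curve `γ` is an integral curve of the Hamiltonian vector fields of `F`. -/
structure IsHamCurve (Ω : Form m X 2) (F : ℝ → X → ℝ) (γ : ℝ → X) : Prop where
  mdifferentiable : MDifferentiable 𝓘(ℝ, ℝ) (𝓡 m) γ
  bilinear_curveVel : ∀ t v, Ω.bilinear (γ t) (curveVel γ t) v = -diff (F t) (γ t) v

theorem IsSymplecticForm.curve_unique [T2Space X] {Ω : Form m X 2} (hΩ : IsSymplecticForm Ω)
    {F : ℝ → X → ℝ}
    (hF : ContMDiff (𝓘(ℝ, ℝ).prod (𝓡 m)) 𝓘(ℝ, ℝ) ∞ (fun q : ℝ × X => F q.1 q.2)) {γ γ' : ℝ → X}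
    (h : IsHamCurve Ω F γ) (h' : IsHamCurve Ω F γ') (h0 : γ 0 = γ' 0) : γ = γ' := by
  obtain ⟨Z, hZ, hZΩ⟩ := hΩ.exists_vectorField hF
  have key : ∀ {γ : ℝ → X}, IsHamCurve Ω F γ → ∀ t, HasMFDerivAt 𝓘(ℝ, ℝ) (𝓡 m) γ t
      ((1 : ℝ →L[ℝ] ℝ).smulRight (Z (0 + t • 1) (γ t))) := fun {γ} hγ t => by
    have := hasMFDerivAt_curveVel (hγ.mdifferentiable t)
    have e : curveVel γ t = Z (0 + t • 1) (γ t) := hΩ.eq_of_forall fun v => by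
      rw [hγ.bilinear_curveVel, hZΩ, zero_add, smul_eq_mul, mul_one]
    rwa [e] at this
  exact eq_of_hasMFDerivAt_param hZ (key h) (key h') h0

theorem IsSymplecticForm.exists_family [T2Space X] [CompactSpace X] {Ω : Form m X 2}
    (hΩ : IsSymplecticForm Ω) {F : ℝ × ℝ → X → ℝ}
    (hF : ContMDiff (𝓘(ℝ, ℝ × ℝ).prod (𝓡 m)) 𝓘(ℝ, ℝ) ∞ (fun q : (ℝ × ℝ) × X => F q.1 q.2)) :
    ∃ Φ : DiffeoFamily m (ℝ × ℝ) X, (∀ s x, Φ.toFun (s, 0) x = x) ∧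
      ∀ s, IsGeneratedBy Ω (Φ.slice s) (fun t => F (s, t)) := by
  obtain ⟨Z, hZ, hZΩ⟩ := hΩ.exists_vectorField hF
  obtain ⟨Φ, h0, hΦ⟩ := exists_diffeoFamily hZ
  refine ⟨Φ, h0, fun s t x v => ?_⟩
  have e : (Φ.slice s).vel t x = Z (s, t) (Φ.toFun (s, t) x) := curveVel_eq (hΦ s t x)
  have := hZΩ (s, t) (Φ.toFun (s, t) x) v
  rw [← e] at this
  exact this

theorem IsGeneratedBy.isHamCurve {Ω : Form m X 2} {f : DiffeoFamily m ℝ X} {F : ℝ → X → ℝ}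
    (h : IsGeneratedBy Ω f F) (x : X) : IsHamCurve Ω F (fun t => f.toFun t x) :=
  ⟨(f.contMDiff_curve x).mdifferentiable (by simp), fun t v => h t x v⟩

theorem contMDiff_autonomous {H : X → ℝ} (hH : ContMDiff (𝓡 m) 𝓘(ℝ, ℝ) ∞ H) {P : Type*}
    [NormedAddCommGroup P] [NormedSpace ℝ P] :
    ContMDiff (𝓘(ℝ, P).prod (𝓡 m)) 𝓘(ℝ, ℝ) ∞ (fun q : P × X => H q.2) := hH.comp contMDiff_snd

theorem IsSymplecticForm.exists_hamIsotopy [T2Space X] [CompactSpace X] {Ω : Form m X 2}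
    (hΩ : IsSymplecticForm Ω) {H : X → ℝ} (hH : ContMDiff (𝓡 m) 𝓘(ℝ, ℝ) ∞ H) :
    ∃ f : HamIsotopy Ω, f.ham = fun _ => H := by
  obtain ⟨Φ, h0, hΦ⟩ := hΩ.exists_family (F := fun _ => H) (contMDiff_autonomous hH)
  exact ⟨⟨Φ.slice 0, fun _ => H, h0 0, contMDiff_autonomous hH, hΦ 0⟩, rfl⟩

/-- The curve `γ` is an integral curve of the contact vector fields of `h`. -/
structure IsContactCurve (α : Form m X 1) (R : X → Euc m) (h : ℝ → X → ℝ) (γ : ℝ → X) : Prop where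
  mdifferentiable : MDifferentiable 𝓘(ℝ, ℝ) (𝓡 m) γ
  linear_curveVel : ∀ t, α.linear (γ t) (curveVel γ t) = h t (γ t)
  bilinear_curveVel : ∀ t v, α.d.bilinear (γ t) (curveVel γ t) v =
    -diff (h t) (γ t) v + diff (h t) (γ t) (R (γ t)) * α.linear (γ t) v

variable {α : Form m X 1} {R : X → Euc m}

theorem IsReebField.curve_unique [T2Space X] (hR : IsReebField α R) (hα : IsContactForm α)
    {h : ℝ → X → ℝ}
    (hh : ContMDiff (𝓘(ℝ, ℝ).prod (𝓡 m)) 𝓘(ℝ, ℝ) ∞ (fun q : ℝ × X => h q.1 q.2)) {γ γ' : ℝ → X}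
    (hγ : IsContactCurve α R h γ) (hγ' : IsContactCurve α R h γ') (h0 : γ 0 = γ' 0) : γ = γ' := by
  obtain ⟨Z, hZ, hZ1, hZ2⟩ := hR.exists_vectorField hα hh
  have key : ∀ {γ : ℝ → X}, IsContactCurve α R h γ → ∀ t, HasMFDerivAt 𝓘(ℝ, ℝ) (𝓡 m) γ t
      ((1 : ℝ →L[ℝ] ℝ).smulRight (Z (0 + t • 1) (γ t))) := fun {γ} hγ t => by
    have := hasMFDerivAt_curveVel (hγ.mdifferentiable t)
    have e : curveVel γ t = Z (0 + t • 1) (γ t) := by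
      refine hR.eq_of_forall hα (x := γ t) ?_ fun v => ?_
      · rw [hγ.linear_curveVel, hZ1, zero_add, smul_eq_mul, mul_one]
      · rw [hγ.bilinear_curveVel, hZ2, zero_add, smul_eq_mul, mul_one]
    rwa [e] at this
  exact eq_of_hasMFDerivAt_param hZ (key hγ) (key hγ') h0

/-- The path `φ` of diffeomorphisms is the contact isotopy based at the identity which is generated
by `h`. -/
structure IsContactFlow (α : Form m X 1) (R : X → Euc m) (h : ℝ → X → ℝ)
    (φ : DiffeoFamily m ℝ X) : Prop where
  start : ∀ x, φ.toFun 0 x = x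
  curve : ∀ x, IsContactCurve α R h (fun t => φ.toFun t x)

theorem IsContactFlow.pairing_eq {h : ℝ → X → ℝ} {φ : DiffeoFamily m ℝ X}
    (hφ : IsContactFlow α R h φ) (t : ℝ) (x : X) : φ.pairing α t x = h t (φ.toFun t x) :=
  (hφ.curve x).linear_curveVel t

/-- The conformal factor of a contact isotopy. -/
theorem IsContactFlow.linear_tmap {h : ℝ → X → ℝ} {φ : DiffeoFamily m ℝ X}
    (hφ : IsContactFlow α R h φ) (hR : IsReebField α R) (hα : IsContactForm α)
    (hh : ContMDiff (𝓘(ℝ, ℝ).prod (𝓡 m)) 𝓘(ℝ, ℝ) ∞ (fun q : ℝ × X => h q.1 q.2)) (t : ℝ) (x : X)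
    (v : Euc m) : α.linear (φ.toFun t x) (tmap (φ.toFun t) x v) =
      Real.exp (∫ τ in (0 : ℝ)..t, diff (h τ) (φ.toFun τ x) (R (φ.toFun τ x))) * α.linear x v := by
  set k : ℝ → ℝ := fun τ => diff (h τ) (φ.toFun τ x) (R (φ.toFun τ x)) with hk
  have hkc : Continuous k := (hR.contMDiff_diff hα hh).continuous.comp
    (continuous_id.prodMk (φ.contMDiff_curve x).continuous)
  -- The differential of the pairing contributes dh on the transported vector, and ι dα contributes
  -- its negative plus dh(R) α. What remains is a scalar linear equation with coefficient dh(R),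
  -- solved below by an integrating factor.
  have hd : ∀ t, HasDerivAt (fun τ => α.linear (φ.toFun τ x) (tmap (φ.toFun τ) x v))
      (k t * α.linear (φ.toFun t x) (tmap (φ.toFun t) x v)) t := fun t => by
    have h1 := φ.hasDerivAt_linear_tmap hα.smooth t x v
    have h2 : diff (m := m) (φ.pairing α t) x v = diff (m := m) (h t) (φ.toFun t x) (tmap (φ.toFun t) x v) := by
      rw [← diff_comp ((contMDiff_apply_left hh t).mdifferentiable (by simp) _)
        (φ.mdifferentiable t x)]
      rw [funext (hφ.pairing_eq t)]
    have h3 := (hφ.curve x).bilinear_curveVel t (tmap (φ.toFun t) x v)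
    rw [h2] at h1
    convert h1 using 1
    rw [DiffeoFamily.vel, h3]
    ring
  have hE : ∀ t, HasDerivAt (fun t => Real.exp (-∫ τ in (0 : ℝ)..t, k τ))
      (Real.exp (-∫ τ in (0 : ℝ)..t, k τ) * -k t) t := fun t =>
    (intervalIntegral.integral_hasDerivAt_right (hkc.intervalIntegrable _ _)
      (hkc.stronglyMeasurableAtFilter _ _) hkc.continuousAt).fun_neg.exp
  have hconst := fun t => is_const_of_deriv_eq_zero (f := fun t =>
    Real.exp (-∫ τ in (0 : ℝ)..t, k τ) * α.linear (φ.toFun t x) (tmap (φ.toFun t) x v))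
    (fun t => ((hE t).mul (hd t)).differentiableAt)
    (fun t => ((hE t).fun_mul (hd t)).deriv.trans (by ring)) t 0
  have h0 : α.linear (φ.toFun 0 x) (tmap (φ.toFun 0) x v) = α.linear x v := by
    have e : φ.toFun 0 = fun x => x := funext hφ.start
    rw [e, tmap_id]
  have h1 := hconst t
  simp only [intervalIntegral.integral_same, neg_zero, Real.exp_zero, one_mul] at h1
  rw [h0] at h1
  rw [← h1, ← mul_assoc, ← Real.exp_add, add_neg_cancel, Real.exp_zero, one_mul]

theorem IsContactFlow.preservesContact {h : ℝ → X → ℝ} {φ : DiffeoFamily m ℝ X}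
    (hφ : IsContactFlow α R h φ) (hR : IsReebField α R) (hα : IsContactForm α)
    (hh : ContMDiff (𝓘(ℝ, ℝ).prod (𝓡 m)) 𝓘(ℝ, ℝ) ∞ (fun q : ℝ × X => h q.1 q.2)) (t : ℝ) :
    PreservesContact α (φ.toFun t) := fun x =>
  ⟨_, Real.exp_pos _, fun v => hφ.linear_tmap hR hα hh t x v⟩

/-- Contact isotopies of Hamiltonians which are invariant under the Reeb flow preserve the contact
form. -/
theorem IsContactFlow.linear_tmap_of_invariant {h : ℝ → X → ℝ} {φ : DiffeoFamily m ℝ X}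
    (hφ : IsContactFlow α R h φ) (hR : IsReebField α R) (hα : IsContactForm α)
    (hh : ContMDiff (𝓘(ℝ, ℝ).prod (𝓡 m)) 𝓘(ℝ, ℝ) ∞ (fun q : ℝ × X => h q.1 q.2))
    (hinv : ∀ t x, diff (h t) x (R x) = 0) (t : ℝ) (x : X) (v : Euc m) :
    α.linear (φ.toFun t x) (tmap (φ.toFun t) x v) = α.linear x v := by
  rw [hφ.linear_tmap hR hα hh]
  simp [hinv]

/-- The contact isotopy generated by `h`, as an element of the group of contact isotopies. -/
def IsContactFlow.toPath {h : ℝ → X → ℝ} {φ : DiffeoFamily m ℝ X}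
    (hφ : IsContactFlow α R h φ) (hR : IsReebField α R) (hα : IsContactForm α)
    (hh : ContMDiff (𝓘(ℝ, ℝ).prod (𝓡 m)) 𝓘(ℝ, ℝ) ∞ (fun q : ℝ × X => h q.1 q.2)) :
    contactPaths α := ⟨φ, hφ.start, hφ.preservesContact hR hα hh⟩

theorem IsContactFlow.hasContactHamiltonian {h : ℝ → X → ℝ} {φ : DiffeoFamily m ℝ X}
    (hφ : IsContactFlow α R h φ) (hR : IsReebField α R) (hα : IsContactForm α)
    (hh : ContMDiff (𝓘(ℝ, ℝ).prod (𝓡 m)) 𝓘(ℝ, ℝ) ∞ (fun q : ℝ × X => h q.1 q.2)) :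
    HasContactHamiltonian α (hφ.toPath hR hα hh) h := fun t x => hφ.pairing_eq t x

theorem IsReebField.exists_family [T2Space X] [CompactSpace X] (hR : IsReebField α R)
    (hα : IsContactForm α) {h : ℝ × ℝ → X → ℝ}
    (hh : ContMDiff (𝓘(ℝ, ℝ × ℝ).prod (𝓡 m)) 𝓘(ℝ, ℝ) ∞ (fun q : (ℝ × ℝ) × X => h q.1 q.2)) :
    ∃ Φ : DiffeoFamily m (ℝ × ℝ) X, ∀ s, IsContactFlow α R (fun t => h (s, t)) (Φ.slice s) := by
  obtain ⟨Z, hZ, hZ1, hZ2⟩ := hR.exists_vectorField hα hh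
  obtain ⟨Φ, h0, hΦ⟩ := exists_diffeoFamily hZ
  have e : ∀ s t x, curveVel (fun τ => (Φ.slice s).toFun τ x) t = Z (s, t) (Φ.toFun (s, t) x) :=
    fun s t x => curveVel_eq (hΦ s t x)
  refine ⟨Φ, fun s => ⟨h0 s, fun x => ⟨((Φ.slice s).contMDiff_curve x).mdifferentiable (by simp),
    fun t => ?_, fun t v => ?_⟩⟩⟩
  · rw [e]
    exact hZ1 (s, t) _
  · rw [e]
    exact hZ2 (s, t) _ v

theorem contMDiff_of_time {h : ℝ → X → ℝ}
    (hh : ContMDiff (𝓘(ℝ, ℝ).prod (𝓡 m)) 𝓘(ℝ, ℝ) ∞ (fun q : ℝ × X => h q.1 q.2)) :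
    ContMDiff (𝓘(ℝ, ℝ × ℝ).prod (𝓡 m)) 𝓘(ℝ, ℝ) ∞ (fun q : (ℝ × ℝ) × X => h q.1.2 q.2) :=
  hh.comp ((contDiff_snd.contMDiff.comp contMDiff_fst).prodMk contMDiff_snd)

theorem contMDiff_slice {h : ℝ × ℝ → X → ℝ}
    (hh : ContMDiff (𝓘(ℝ, ℝ × ℝ).prod (𝓡 m)) 𝓘(ℝ, ℝ) ∞ (fun q : (ℝ × ℝ) × X => h q.1 q.2))
    (s : ℝ) : ContMDiff (𝓘(ℝ, ℝ).prod (𝓡 m)) 𝓘(ℝ, ℝ) ∞ (fun q : ℝ × X => h (s, q.1) q.2) :=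
  hh.comp (((contDiff_const.prodMk contDiff_id).contMDiff.comp contMDiff_fst).prodMk contMDiff_snd)

theorem IsReebField.exists_flow [T2Space X] [CompactSpace X] (hR : IsReebField α R)
    (hα : IsContactForm α) {h : ℝ → X → ℝ}
    (hh : ContMDiff (𝓘(ℝ, ℝ).prod (𝓡 m)) 𝓘(ℝ, ℝ) ∞ (fun q : ℝ × X => h q.1 q.2)) :
    ∃ φ : DiffeoFamily m ℝ X, IsContactFlow α R h φ := by
  obtain ⟨Φ, hΦ⟩ := hR.exists_family hα (h := fun p => h p.2) (contMDiff_of_time hh)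
  exact ⟨_, hΦ 0⟩

end Flows

/-! ### Lifting Hamiltonian isotopies to a prequantization -/

section Lift

variable {n : ℕ}
  {V : Type*} [TopologicalSpace V] [ChartedSpace (Euc (2 * n + 1)) V]
  [IsManifold (𝓡 (2 * n + 1)) ∞ V]
  {M : Type*} [TopologicalSpace M] [ChartedSpace (Euc (2 * n)) M] [IsManifold (𝓡 (2 * n)) ∞ M]
  {α : Form (2 * n + 1) V 1} {Ω : Form (2 * n) M 2} {π : V → M}

/-- The Reeb flow of a prequantization, together with its vector field. -/
structure IsReebFlow (α : Form (2 * n + 1) V 1) (π : V → M) (R : V → Euc (2 * n + 1))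
    (ρ : DiffeoFamily (2 * n + 1) ℝ V) : Prop where
  reeb : IsReebField α R
  start : ∀ x, ρ.toFun 0 x = x
  add : ∀ s t x, ρ.toFun (s + t) x = ρ.toFun s (ρ.toFun t x)
  vel : ∀ t x, ρ.vel t x = R (ρ.toFun t x)
  proj : ∀ t x, π (ρ.toFun t x) = π x
  orbit : ∀ x y, π x = π y → ∃ t, ρ.toFun t x = y

namespace IsPrequantization

variable (hπ : IsPrequantization α Ω π)
include hπ

theorem exists_reebFlow : ∃ R ρ, IsReebFlow α π R ρ := by
  obtain ⟨ℏ, ρ, -, h0, hadd, h1, h2, -, h3⟩ := hπ.principal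
  have hR : IsReebField α (ρ.vel 0) := by
    refine ⟨fun x => ?_, fun x v => ?_⟩
    · have : α.linear (ρ.toFun 0 x) (ρ.vel 0 x) = 1 := h1 0 x
      rwa [h0] at this
    · have : α.d.bilinear (ρ.toFun 0 x) (ρ.vel 0 x) v = 0 := h2 0 x v
      rwa [h0] at this
  -- Reeb vectors at a point are unique, so the velocity at any time is the value of the field
  -- defined at time 0.
  refine ⟨ρ.vel 0, ρ, hR, h0, hadd, fun t x => hR.eq_of_forall hπ.contact (x := ρ.toFun t x) ?_ fun v => ?_,
    fun t x => ((h3 _ _).2 ⟨t, rfl⟩).symm, fun x y => (h3 x y).1⟩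
  · rw [hR.apply_eq_one]
    exact h1 t x
  · rw [hR.d_eq_zero]
    exact h2 t x v

theorem mdifferentiable : MDifferentiable (𝓡 (2 * n + 1)) (𝓡 (2 * n)) π :=
  hπ.smooth.mdifferentiable (by simp)

theorem surjective : Function.Surjective π := fun p => by
  obtain ⟨U, σ, -, hp, -, h⟩ := hπ.local_section p
  exact ⟨σ p, h p hp⟩

theorem bilinear_tmap (x : V) (u v : Euc (2 * n + 1)) :
    Ω.bilinear (π x) (tmap π x u) (tmap π x v) = α.d.bilinear x u v := hπ.pullback_form x u v

variable {R : V → Euc (2 * n + 1)} {ρ : DiffeoFamily (2 * n + 1) ℝ V} (hρ : IsReebFlow α π R ρ)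
include hρ

/-- A local section gives surjectivity at its own point of the fibre. The Reeb flow moves that point
to x and commutes with the projection. -/
theorem tmap_surjective (x : V) : Function.Surjective (tmap (m := 2 * n + 1) (k := 2 * n) π x) := by
  intro w
  obtain ⟨U, σ, hU, hp, hσ, h⟩ := hπ.local_section (π x)
  obtain ⟨t, ht⟩ := hρ.orbit (σ (π x)) x (h _ hp)
  have hσd : MDifferentiableAt (𝓡 (2 * n)) (𝓡 (2 * n + 1)) σ (π x) :=
    (hσ.contMDiffAt (hU.mem_nhds hp)).mdifferentiableAt (by simp)
  have h1 : tmap (m := 2 * n) (k := 2 * n) (fun q => π (σ q)) (π x) w = w := by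
    have e : (fun q => π (σ q)) =ᶠ[𝓝 (π x)] fun q => q := by
      filter_upwards [hU.mem_nhds hp] with q hq using h q hq
    have e1 := DFunLike.congr_fun (e.mfderiv_eq (I := 𝓡 (2 * n)) (I' := 𝓡 (2 * n))) w
    exact e1.trans (tmap_id (m := 2 * n) (π x) w)
  rw [tmap_comp (hπ.mdifferentiable _) hσd] at h1
  have h2 : ∀ v, tmap π (σ (π x)) v = tmap (k := 2 * n) π (ρ.toFun t (σ (π x)))
      (tmap (ρ.toFun t) (σ (π x)) v) := fun v => by
    rw [← tmap_comp (hπ.mdifferentiable _) (ρ.mdifferentiable t _), tmap_congr (hρ.proj t)]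
  rw [h2, ht] at h1
  exact ⟨_, h1⟩

/-- Ω pairs the image of R with the image of v as dα(R, v) = 0, and these images exhaust the tangent
space, so nondegeneracy of Ω applies. -/
theorem tmap_reeb (x : V) : tmap (k := 2 * n) π x (R x) = 0 := by
  refine hπ.symplectic.nondegenerate (π x) _ fun w => ?_
  obtain ⟨v, rfl⟩ := hπ.tmap_surjective hρ x w
  exact (hπ.bilinear_tmap x (R x) v).trans (hρ.reeb.d_eq_zero x v)

/-- Since dα is pulled back from M, it sees only the projection, and α together with dα separates
tangent vectors. This splits them into a vertical and a horizontal part. -/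
theorem eq_of_tmap_eq {x : V} {u w : Euc (2 * n + 1)} (h0 : α.linear x u = α.linear x w)
    (h : tmap (k := 2 * n) π x u = tmap π x w) : u = w :=
  hρ.reeb.eq_of_forall hπ.contact h0 fun v => by
    rw [← hπ.bilinear_tmap, ← hπ.bilinear_tmap, h]

theorem diff_basic {H : M → ℝ} (hH : MDifferentiable (𝓡 (2 * n)) 𝓘(ℝ, ℝ) H) (c : ℝ) (x : V)
    (v : Euc (2 * n + 1)) :
    diff (m := 2 * n + 1) (fun x => H (π x) + c) x v = diff (m := 2 * n) H (π x) (tmap π x v) := by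
  rw [← diff_comp (hH _) (hπ.mdifferentiable x)]
  have h1 := ((hH (π x)).comp x (hπ.mdifferentiable x)).hasMFDerivAt.add
    (hasMFDerivAt_const (I := 𝓡 (2 * n + 1)) (I' := 𝓘(ℝ, ℝ)) c x)
  refine (DFunLike.congr_fun h1.mfderiv v).trans ?_
  exact add_zero _

theorem diff_basic_reeb {H : M → ℝ} (hH : MDifferentiable (𝓡 (2 * n)) 𝓘(ℝ, ℝ) H) (c : ℝ) (x : V) :
    diff (fun x => H (π x) + c) x (R x) = 0 := by
  rw [hπ.diff_basic hρ hH, hπ.tmap_reeb hρ, map_zero]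

/-- A curve in `V` is an integral curve of the contact vector field of a basic function if and only
if it is a lift of an integral curve in `M` with the right vertical component. -/
theorem isContactCurve_iff {F : ℝ → M → ℝ} {c : ℝ → ℝ} {γ : ℝ → V}
    (hF : ∀ t, MDifferentiable (𝓡 (2 * n)) 𝓘(ℝ, ℝ) (F t))
    (hγ : MDifferentiable 𝓘(ℝ, ℝ) (𝓡 (2 * n + 1)) γ) :
    IsContactCurve α R (fun t x => F t (π x) + c t) γ ↔
      (∀ t, α.linear (γ t) (curveVel γ t) = F t (π (γ t)) + c t) ∧
        IsHamCurve Ω F (fun t => π (γ t)) := by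
  have key : ∀ t v, Ω.bilinear (π (γ t)) (curveVel (fun t => π (γ t)) t) (tmap π (γ t) v) =
      α.d.bilinear (γ t) (curveVel γ t) v := fun t v => by
    rw [curveVel_comp (hπ.mdifferentiable _) (hγ t), hπ.bilinear_tmap]
  refine ⟨fun h => ⟨h.linear_curveVel, fun t => (hπ.mdifferentiable _).comp t (hγ t),
    fun t w => ?_⟩, fun h => ⟨hγ, h.1, fun t v => ?_⟩⟩
  · obtain ⟨v, rfl⟩ := hπ.tmap_surjective hρ (γ t) w
    rw [key, h.bilinear_curveVel, hπ.diff_basic_reeb hρ (hF t), hπ.diff_basic hρ (hF t)]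
    ring
  · rw [← key, h.2.bilinear_curveVel, hπ.diff_basic_reeb hρ (hF t), hπ.diff_basic hρ (hF t)]
    ring

end IsPrequantization

end Lift


/-! ### Quasi-morphisms -/

/-- For commuting elements the defect on k-th powers is k times the defect of a and b, yet it is
bounded by D for every k. -/
theorem IsQuasimorphism.map_mul_of_commute {G : Type*} [Group G] {μ : G → ℝ}
    (hμ : IsQuasimorphism μ) {a b : G} (h : Commute a b) : μ (a * b) = μ a + μ b := by
  obtain ⟨D, -, hD⟩ := hμ.bounded
  by_contra hne
  have hpos : 0 < |μ (a * b) - μ a - μ b| :=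
    abs_pos.2 fun h0 => hne (by linarith)
  obtain ⟨k, hk⟩ := exists_nat_gt (D / |μ (a * b) - μ a - μ b|)
  rw [div_lt_iff₀ hpos] at hk
  have h1 := hD (a ^ (k : ℤ)) (b ^ (k : ℤ))
  rw [← h.mul_zpow, hμ.homogeneous, hμ.homogeneous, hμ.homogeneous, ← mul_sub, ← mul_sub,
    abs_mul] at h1
  simp only [Int.cast_natCast, Nat.abs_cast] at h1
  linarith

/-- Squeezing k c between consecutive integers gives |k (r c - c r 1)| ≤ r 1 for every natural
number k. -/
theorem eq_mul_of_additive_monotone {r : ℝ → ℝ} (hadd : ∀ c d, r (c + d) = r c + r d)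
    (hmono : Monotone r) (c : ℝ) : r c = c * r 1 := by
  let f : ℝ →+ ℝ := AddMonoidHom.mk' r hadd
  have h0 : r 0 = 0 := f.map_zero
  have hneg : ∀ c, r (-c) = -r c := f.map_neg
  have hnat : ∀ (k : ℕ) c, r (k * c) = k * r c := fun k c => by
    have := f.map_nsmul k c
    simpa [f, nsmul_eq_mul] using this
  have hint : ∀ (z : ℤ), r z = z * r 1 := fun z => by
    have := f.map_zsmul z (1 : ℝ)
    simpa [f, zsmul_eq_mul] using this
  have h1 : 0 ≤ r 1 := h0 ▸ hmono zero_le_one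
  by_contra hne
  have hpos : 0 < |r c - c * r 1| := abs_pos.2 (sub_ne_zero.2 hne)
  obtain ⟨k, hk⟩ := exists_nat_gt (r 1 / |r c - c * r 1|)
  rw [div_lt_iff₀ hpos] at hk
  have hl := hmono (Int.floor_le (k * c))
  have hu := hmono (Int.lt_floor_add_one ((k : ℝ) * c)).le
  rw [hadd, hint] at hu
  rw [hint] at hl
  rw [hnat] at hl hu
  have hf1 := mul_le_mul_of_nonneg_right (Int.floor_le ((k : ℝ) * c)) h1
  have hf2 := mul_le_mul_of_nonneg_right (Int.lt_floor_add_one ((k : ℝ) * c)).le h1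
  have : |(k : ℝ) * (r c - c * r 1)| ≤ r 1 := by
    rw [abs_le]
    constructor <;> nlinarith
  rw [abs_mul, Nat.abs_cast] at this
  linarith

/-! ### Contact Hamiltonians and monotonicity -/

section Monotone

variable {m : ℕ} {X : Type*} [TopologicalSpace X] [ChartedSpace (Euc m) X]
  [IsManifold (𝓡 m) ∞ X]

theorem DiffeoFamily.vel_mul (φ χ : DiffeoFamily m ℝ X) (t : ℝ) (x : X) :
    (φ * χ).vel t x = φ.vel t (χ.toFun t x) + tmap (φ.toFun t) (χ.toFun t x) (χ.vel t x) := by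
  have hφ : MDifferentiableAt (𝓘(ℝ, ℝ).prod (𝓡 m)) (𝓡 m)
      (fun q : ℝ × X => φ.toFun q.1 q.2) (t, χ.toFun t x) :=
    φ.smooth_toFun.mdifferentiable (by simp) _
  have h1 := hφ.hasMFDerivAt.comp t ((hasMFDerivAt_id (I := 𝓘(ℝ, ℝ)) t).prodMk
    (χ.hasMFDerivAt_vel t x))
  have h2 := DFunLike.congr_fun h1.mfderiv (1 : ℝ)
  refine h2.trans ?_
  refine (mfderiv_prod_eq_add_apply hφ).trans ?_
  have e : (((1 : ℝ →L[ℝ] ℝ).smulRight (χ.vel t x) : ℝ →L[ℝ] Euc m) 1) = χ.vel t x := by simp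
  exact congrArg (fun w : Euc m => φ.vel t (χ.toFun t x) + tmap (φ.toFun t) (χ.toFun t x) w) e

variable {α : Form m X 1}

theorem DiffeoFamily.pairing_mul (φ χ : DiffeoFamily m ℝ X) (t : ℝ) (x : X) :
    (φ * χ).pairing α t x = φ.pairing α t (χ.toFun t x) +
      α.linear (φ.toFun t (χ.toFun t x)) (tmap (φ.toFun t) (χ.toFun t x) (χ.vel t x)) := by
  rw [pairing, vel_mul, map_add]
  rfl

/-- The contact isotopy `φ` has the contact Hamiltonian `h` during the time interval `[0,1]`. -/
def HasHamiltonianOn (α : Form m X 1) (φ : contactPaths α) (h : ℝ → X → ℝ) : Prop :=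
  ∀ t ∈ Icc (0 : ℝ) 1, ∀ x, φ.1.pairing α t x = h t (φ.1.toFun t x)

theorem HasContactHamiltonian.hasHamiltonianOn {φ : contactPaths α} {h : ℝ → X → ℝ}
    (H : HasContactHamiltonian α φ h) : HasHamiltonianOn α φ h := fun t _ x => H t x

variable {μ : ContTilde α → ℝ} (hμ : IsMonotoneQuasimorphism α μ)
include hμ

/-- Writing ψ = φ χ with χ = φ⁻¹ψ, the Hamiltonian of ψ exceeds that of φ by a positive conformal
factor times α(∂ₜχ). So the pointwise inequality says precisely that χ is nonnegative. -/
theorem IsMonotoneQuasimorphism.le_of_hamiltonian_le {φ ψ : contactPaths α} {f g : ℝ → X → ℝ}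
    (hφ : HasHamiltonianOn α φ f) (hψ : HasHamiltonianOn α ψ g)
    (hle : ∀ t ∈ Icc (0 : ℝ) 1, ∀ x, f t x ≤ g t x) :
    μ (QuotientGroup.mk φ) ≤ μ (QuotientGroup.mk ψ) := by
  refine hμ.monotone _ _ ⟨φ⁻¹ * ψ, rfl, fun t ht x => ?_⟩
  change 0 ≤ (φ⁻¹ * ψ).1.pairing α t x
  have h1 := φ.1.pairing_mul (α := α) (φ⁻¹ * ψ).1 t x
  have e : φ.1 * (φ⁻¹ * ψ).1 = ψ.1 := congrArg Subtype.val (mul_inv_cancel_left φ ψ)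
  rw [e, hψ t ht, hφ t ht] at h1
  obtain ⟨c, hc, hcv⟩ := φ.2.2 t ((φ⁻¹ * ψ).1.toFun t x)
  have h2 : α.linear (φ.1.toFun t ((φ⁻¹ * ψ).1.toFun t x)) (tmap (φ.1.toFun t)
      ((φ⁻¹ * ψ).1.toFun t x) ((φ⁻¹ * ψ).1.vel t x)) = c * (φ⁻¹ * ψ).1.pairing α t x := hcv _
  have e2 : φ.1.toFun t ((φ⁻¹ * ψ).1.toFun t x) = ψ.1.toFun t x := by
    rw [← DiffeoFamily.mul_toFun, e]
  rw [h2, e2] at h1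
  have h3 := hle t ht (ψ.1.toFun t x)
  exact (mul_nonneg_iff_of_pos_left hc).1 (by linarith)

/-- Antisymmetry of ≤ on real values replaces uniqueness of the generated isotopy, and only times in
[0,1] enter. -/
theorem IsMonotoneQuasimorphism.eq_of_hamiltonian_eq {φ ψ : contactPaths α} {f g : ℝ → X → ℝ}
    (hφ : HasHamiltonianOn α φ f) (hψ : HasHamiltonianOn α ψ g)
    (heq : ∀ t ∈ Icc (0 : ℝ) 1, ∀ x, f t x = g t x) :
    μ (QuotientGroup.mk φ) = μ (QuotientGroup.mk ψ) :=
  le_antisymm (hμ.le_of_hamiltonian_le hφ hψ fun t ht x => (heq t ht x).le)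
    (hμ.le_of_hamiltonian_le hψ hφ fun t ht x => (heq t ht x).ge)

/-- Removes the choice in `contactClass`: for the purpose of μ, any isotopy with the given
Hamiltonian will do. -/
theorem IsMonotoneQuasimorphism.contactClass_eq {φ : contactPaths α} {h : ℝ → X → ℝ}
    (hφ : HasContactHamiltonian α φ h) : μ (contactClass α h) = μ (QuotientGroup.mk φ) := by
  have H : ∃ φ : contactPaths α, HasContactHamiltonian α φ h := ⟨φ, hφ⟩
  rw [contactClass, dif_pos H]
  exact hμ.eq_of_hamiltonian_eq H.choose_spec.hasHamiltonianOn hφ.hasHamiltonianOn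
    fun _ _ _ => rfl

end Monotone

section Generated

variable {m : ℕ} {X : Type*} [TopologicalSpace X] [ChartedSpace (Euc m) X]
  [IsManifold (𝓡 m) ∞ X] [T2Space X] [CompactSpace X] {α : Form m X 1} {R : X → Euc m}
  (hR : IsReebField α R) (hα : IsContactForm α)
  {μ : ContTilde α → ℝ} (hμ : IsMonotoneQuasimorphism α μ)
include hR hα

theorem IsReebField.exists_hasContactHamiltonian {h : ℝ → X → ℝ}
    (hh : ContMDiff (𝓘(ℝ, ℝ).prod (𝓡 m)) 𝓘(ℝ, ℝ) ∞ (fun q : ℝ × X => h q.1 q.2)) :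
    ∃ φ : contactPaths α, HasContactHamiltonian α φ h := by
  obtain ⟨φ, hφ⟩ := hR.exists_flow hα hh
  exact ⟨_, hφ.hasContactHamiltonian hR hα hh⟩

include hμ

theorem IsReebField.contactClass_le {h k : ℝ → X → ℝ}
    (hh : ContMDiff (𝓘(ℝ, ℝ).prod (𝓡 m)) 𝓘(ℝ, ℝ) ∞ (fun q : ℝ × X => h q.1 q.2))
    (hk : ContMDiff (𝓘(ℝ, ℝ).prod (𝓡 m)) 𝓘(ℝ, ℝ) ∞ (fun q : ℝ × X => k q.1 q.2))
    (hle : ∀ t ∈ Icc (0 : ℝ) 1, ∀ x, h t x ≤ k t x) :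
    μ (contactClass α h) ≤ μ (contactClass α k) := by
  obtain ⟨φ, hφ⟩ := hR.exists_hasContactHamiltonian hα hh
  obtain ⟨ψ, hψ⟩ := hR.exists_hasContactHamiltonian hα hk
  rw [hμ.contactClass_eq hφ, hμ.contactClass_eq hψ]
  exact hμ.le_of_hamiltonian_le hφ.hasHamiltonianOn hψ.hasHamiltonianOn hle

end Generated

/-! ### The Reeb flow and lifts of autonomous Hamiltonians -/

section Reeb

variable {n : ℕ}
  {V : Type*} [TopologicalSpace V] [ChartedSpace (Euc (2 * n + 1)) V]
  [IsManifold (𝓡 (2 * n + 1)) ∞ V] [T2Space V]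
  {M : Type*} [TopologicalSpace M] [ChartedSpace (Euc (2 * n)) M] [IsManifold (𝓡 (2 * n)) ∞ M]
  {α : Form (2 * n + 1) V 1} {Ω : Form (2 * n) M 2} {π : V → M}
  {R : V → Euc (2 * n + 1)} {ρ : DiffeoFamily (2 * n + 1) ℝ V}

theorem diff_const {m : ℕ} {X : Type*} [TopologicalSpace X] [ChartedSpace (Euc m) X] (c : ℝ)
    (x : X) (v : Euc m) : diff (fun _ => c) x v = 0 := by
  have : mfderiv (𝓡 m) 𝓘(ℝ, ℝ) (fun _ : X => c) x = 0 := mfderiv_const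
  exact DFunLike.congr_fun this v

/-- A one-parameter group, with the time rescaled by `c`. -/
def DiffeoFamily.rescale {m : ℕ} {X : Type*} [TopologicalSpace X] [ChartedSpace (Euc m) X]
    (ρ : DiffeoFamily m ℝ X) (c : ℝ) : DiffeoFamily m ℝ X where
  toFun t := ρ.toFun (c * t)
  invFun t := ρ.invFun (c * t)
  left_inv t := ρ.left_inv (c * t)
  right_inv t := ρ.right_inv (c * t)
  smooth_toFun := ρ.smooth_toFun.comp
    (((contDiff_const.mul contDiff_id).contMDiff.comp contMDiff_fst).prodMk contMDiff_snd)
  smooth_invFun := ρ.smooth_invFun.comp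
    (((contDiff_const.mul contDiff_id).contMDiff.comp contMDiff_fst).prodMk contMDiff_snd)

theorem DiffeoFamily.vel_rescale {m : ℕ} {X : Type*} [TopologicalSpace X] [ChartedSpace (Euc m) X]
    (ρ : DiffeoFamily m ℝ X) (c t : ℝ) (x : X) : (ρ.rescale c).vel t x = c • ρ.vel (c * t) x := by
  have h1 : HasDerivAt (fun t : ℝ => c * t) c t := by
    simpa using (hasDerivAt_id t).const_mul c
  have h2 := curveVel_line (u := fun τ => ρ.toFun τ x)
    ((ρ.contMDiff_curve x).mdifferentiable (by simp) (c * t)) h1 rfl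
  refine h2.trans ?_
  have h3 := (mfderiv 𝓘(ℝ, ℝ) (𝓡 m) (fun τ => ρ.toFun τ x) (c * t)).map_smul c (1 : ℝ)
  have e : (c • (1 : ℝ) : ℝ) = c := by rw [smul_eq_mul, mul_one]
  exact (congrArg _ e.symm).trans h3

namespace IsReebFlow

variable (hρ : IsReebFlow α π R ρ)
include hρ

theorem isContactFlow : IsContactFlow α R (fun _ _ => 1) ρ := by
  refine ⟨hρ.start, fun x => ⟨(ρ.contMDiff_curve x).mdifferentiable (by simp), fun t => ?_,
    fun t v => ?_⟩⟩
  · have := hρ.vel t x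
    rw [DiffeoFamily.vel] at this
    rw [this, hρ.reeb.apply_eq_one]
  · have := hρ.vel t x
    rw [DiffeoFamily.vel] at this
    rw [this, hρ.reeb.d_eq_zero, diff_const, diff_const]
    ring

variable (hπ : IsPrequantization α Ω π)
include hπ

theorem linear_tmap (t : ℝ) (x : V) (v : Euc (2 * n + 1)) :
    α.linear (ρ.toFun t x) (tmap (ρ.toFun t) x v) = α.linear x v :=
  hρ.isContactFlow.linear_tmap_of_invariant hρ.reeb hπ.contact contMDiff_const
    (fun _ x => diff_const 1 x _) t x v

/-- The Reeb flow with speed `c`. -/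
def path (c : ℝ) : contactPaths α :=
  ⟨ρ.rescale c, fun x => by
      change ρ.toFun (c * 0) x = x
      rw [mul_zero, hρ.start],
    fun t => hρ.isContactFlow.preservesContact hρ.reeb hπ.contact contMDiff_const (c * t)⟩

theorem hasContactHamiltonian_path (c : ℝ) :
    HasContactHamiltonian α (hρ.path hπ c) (fun _ _ => c) := fun t x => by
  change α.linear (ρ.toFun (c * t) x) ((ρ.rescale c).vel t x) = c
  rw [DiffeoFamily.vel_rescale, map_smul, hρ.vel, hρ.reeb.apply_eq_one, smul_eq_mul, mul_one]

theorem path_add (c d : ℝ) : hρ.path hπ (c + d) = hρ.path hπ c * hρ.path hπ d :=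
  Subtype.ext (DiffeoFamily.ext_toFun fun t x => by
    change ρ.toFun ((c + d) * t) x = ρ.toFun (c * t) (ρ.toFun (d * t) x)
    rw [add_mul, hρ.add])

variable {μ : ContTilde α → ℝ} (hμ : IsMonotoneQuasimorphism α μ)
include hμ

/-- Reeb flows of different speeds commute, so μ is additive in the speed; it is also monotone in
the speed, hence linear. -/
theorem map_path (c : ℝ) : μ (QuotientGroup.mk (hρ.path hπ c)) =
    c * μ (QuotientGroup.mk (hρ.path hπ 1)) := by
  refine eq_mul_of_additive_monotone (r := fun c => μ (QuotientGroup.mk (hρ.path hπ c)))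
    (fun c d => ?_) (fun c d hcd => ?_) c
  · have hcomm : Commute (QuotientGroup.mk (hρ.path hπ c) : ContTilde α)
        (QuotientGroup.mk (hρ.path hπ d)) := by
      change QuotientGroup.mk (hρ.path hπ c * hρ.path hπ d) =
        QuotientGroup.mk (hρ.path hπ d * hρ.path hπ c)
      rw [← path_add, ← path_add, add_comm c d]
    rw [hρ.path_add hπ, QuotientGroup.mk_mul, hμ.quasi.map_mul_of_commute hcomm]
  · exact hμ.le_of_hamiltonian_le (hρ.hasContactHamiltonian_path hπ c).hasHamiltonianOn
      (hρ.hasContactHamiltonian_path hπ d).hasHamiltonianOn fun _ _ _ => hcd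

/-- By compactness every contact Hamiltonian on [0,1] × V lies between -C and C, so each |μ(a)| is
at most C times the value on the Reeb flow. Were that value zero, μ would vanish identically. -/
theorem map_path_one_pos [CompactSpace V] : 0 < μ (QuotientGroup.mk (hρ.path hπ 1)) := by
  set r := μ (QuotientGroup.mk (hρ.path hπ 1)) with hr
  obtain ⟨a, ha⟩ := hμ.quasi.nonzero
  obtain ⟨φ, rfl⟩ := QuotientGroup.mk_surjective a
  have hcont : Continuous (fun q : ℝ × V => φ.1.pairing α q.1 q.2) :=
    (φ.1.contMDiff_pairing hπ.contact.smooth).continuous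
  obtain ⟨C, hC⟩ := (isCompact_Icc.prod isCompact_univ : IsCompact (Icc (0 : ℝ) 1 ×ˢ
    (univ : Set V))).exists_bound_of_continuousOn hcont.continuousOn
  have hφ : HasHamiltonianOn α φ (fun t x => φ.1.pairing α t (φ.1.invFun t x)) := fun t _ x => by
    simp only
    rw [φ.1.left_inv]
  have hbound : ∀ t ∈ Icc (0 : ℝ) 1, ∀ x, |φ.1.pairing α t (φ.1.invFun t x)| ≤ C :=
    fun t ht x => hC (t, φ.1.invFun t x) ⟨ht, mem_univ _⟩
  have h1 := hμ.le_of_hamiltonian_le hφ (hρ.hasContactHamiltonian_path hπ C).hasHamiltonianOn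
    fun t ht x => (abs_le.1 (hbound t ht x)).2
  have h2 := hμ.le_of_hamiltonian_le (hρ.hasContactHamiltonian_path hπ (-C)).hasHamiltonianOn hφ
    fun t ht x => (abs_le.1 (hbound t ht x)).1
  rw [hρ.map_path hπ hμ] at h1 h2
  have h0 : 0 ≤ r := by
    have := hμ.le_of_hamiltonian_le (hρ.hasContactHamiltonian_path hπ 0).hasHamiltonianOn
      (hρ.hasContactHamiltonian_path hπ 1).hasHamiltonianOn fun _ _ _ => zero_le_one
    rwa [hρ.map_path hπ hμ 0, zero_mul] at this
  refine lt_of_le_of_ne h0 fun h => ha ?_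
  rw [← hr, ← h, mul_zero] at h1 h2
  exact le_antisymm h1 h2

theorem contactClass_const (c : ℝ) : μ (contactClass α (fun _ _ => c)) =
    c * μ (QuotientGroup.mk (hρ.path hπ 1)) := by
  rw [hμ.contactClass_eq (hρ.hasContactHamiltonian_path hπ c), hρ.map_path hπ hμ]

/-- Adding a constant to a basic autonomous contact Hamiltonian. -/
theorem contactClass_basic_add [CompactSpace V] {H : M → ℝ}
    (hH : ContMDiff (𝓡 (2 * n)) 𝓘(ℝ, ℝ) ∞ H) (c : ℝ) :
    μ (contactClass α (fun _ x => H (π x) + c)) =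
      μ (contactClass α (fun _ x => H (π x))) + c * μ (QuotientGroup.mk (hρ.path hπ 1)) := by
  have hHd := hH.mdifferentiable (n := ∞) (by simp)
  have hh : ContMDiff (𝓘(ℝ, ℝ).prod (𝓡 (2 * n + 1))) 𝓘(ℝ, ℝ) ∞
      (fun q : ℝ × V => H (π q.2) + 0) :=
    contMDiff_autonomous ((hH.comp hπ.smooth).add contMDiff_const)
  obtain ⟨φ, hφ⟩ := hρ.reeb.exists_flow hπ.contact (h := fun _ x => H (π x) + 0) hh
  have hφh := hφ.hasContactHamiltonian hρ.reeb hπ.contact hh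
  set φ' := hφ.toPath hρ.reeb hπ.contact hh with hφ'
  have hHπ : (fun (_ : ℝ) x => H (π x)) = fun _ x => H (π x) + 0 := by simp
  have hstrict := hφ.linear_tmap_of_invariant hρ.reeb hπ.contact hh
    fun _ x => hπ.diff_basic_reeb hρ hHd 0 x
  -- Composing with the Reeb flow of speed c adds exactly c to the Hamiltonian because φ preserves
  -- α, not merely its kernel.
  have hprod : HasContactHamiltonian α (φ' * hρ.path hπ c) (fun _ x => H (π x) + c) :=
    fun t x => by
      change (φ * ρ.rescale c).pairing α t x = H (π (φ.toFun t (ρ.toFun (c * t) x))) + c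
      rw [DiffeoFamily.pairing_mul, hφ.pairing_eq, hstrict, DiffeoFamily.vel_rescale, hρ.vel,
        map_smul]
      change H (π (φ.toFun t (ρ.toFun (c * t) x))) + 0 +
        c • α.linear (ρ.toFun (c * t) x) (R (ρ.toFun (c * t) x)) = _
      rw [hρ.reeb.apply_eq_one, smul_eq_mul, mul_one, add_zero]
  -- The Reeb flow preserves α and the projection, so it carries integral curves of the basic
  -- contact field to integral curves. Uniqueness then gives commutation.
  have hcommpt : ∀ s t x, ρ.toFun s (φ.toFun t x) = φ.toFun t (ρ.toFun s x) := fun s t x => by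
    have h1 : IsContactCurve α R (fun _ x => H (π x) + 0) (fun t => ρ.toFun s (φ.toFun t x)) := by
      have hd : MDifferentiable 𝓘(ℝ, ℝ) (𝓡 (2 * n + 1)) (fun t => φ.toFun t x) :=
        (φ.contMDiff_curve x).mdifferentiable (by simp)
      have h2 := (hπ.isContactCurve_iff hρ (F := fun _ => H) (c := fun _ => 0) (fun _ => hHd) hd).1
        (hφ.curve x)
      refine (hπ.isContactCurve_iff hρ (F := fun _ => H) (c := fun _ => 0) (fun _ => hHd)
        (γ := fun t => ρ.toFun s (φ.toFun t x))
        fun t => (ρ.mdifferentiable s _).comp t (hd t)).2 ⟨fun t => ?_, ?_⟩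
      · rw [curveVel_comp (ρ.mdifferentiable s _) (hd t), hρ.linear_tmap hπ, h2.1, hρ.proj]
      · simp only [hρ.proj]
        exact h2.2
    have h3 := hρ.reeb.curve_unique hπ.contact hh h1 (hφ.curve (ρ.toFun s x))
      (by rw [hφ.start, hφ.start])
    exact congrFun h3 t
  have hcomm : Commute (QuotientGroup.mk φ' : ContTilde α) (QuotientGroup.mk (hρ.path hπ c)) := by
    change QuotientGroup.mk (φ' * hρ.path hπ c) = QuotientGroup.mk (hρ.path hπ c * φ')
    congr 1
    exact Subtype.ext (DiffeoFamily.ext_toFun fun t x => (hcommpt (c * t) t x).symm)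
  rw [hμ.contactClass_eq hprod, QuotientGroup.mk_mul, hμ.quasi.map_mul_of_commute hcomm,
    hρ.map_path hπ hμ c, hHπ, hμ.contactClass_eq hφh]

end IsReebFlow

end Reeb

end Prequant

/-! ### Determinants of skew-symmetric matrices -/

/-- Along the segment from the identity to G the determinant does not vanish: as v · G v = 0, a
kernel vector of s G + (1 - s) would satisfy (1 - s) |v|² = 0. The determinant starts at 1, so it
stays positive. -/
theorem Matrix.det_pos_of_transpose_eq_neg {ι : Type*} [Fintype ι] [DecidableEq ι]
    {G : Matrix ι ι ℝ} (hG : G.transpose = -G) (hdet : G.det ≠ 0) : 0 < G.det := by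
  have hskew : ∀ v : ι → ℝ, v ⬝ᵥ G.mulVec v = 0 := fun v => by
    have h1 : v ⬝ᵥ G.mulVec v = v ⬝ᵥ G.transpose.mulVec v := by
      rw [Matrix.mulVec_transpose, dotProduct_comm v (Matrix.vecMul v G),
        ← Matrix.dotProduct_mulVec]
    rw [hG, Matrix.neg_mulVec, dotProduct_neg] at h1
    linarith
  have hne : ∀ s ∈ Icc (0 : ℝ) 1, (s • G + (1 - s) • (1 : Matrix ι ι ℝ)).det ≠ 0 := by
    intro s hs h0
    rcases eq_or_lt_of_le hs.2 with rfl | hs1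
    · simp at h0
      exact hdet h0
    obtain ⟨v, hv, hv0⟩ := Matrix.exists_mulVec_eq_zero_iff.2 h0
    have h1 : v ⬝ᵥ (s • G + (1 - s) • (1 : Matrix ι ι ℝ)).mulVec v = 0 := by
      rw [hv0, dotProduct_zero]
    rw [Matrix.add_mulVec, Matrix.smul_mulVec, Matrix.smul_mulVec, Matrix.one_mulVec,
      dotProduct_add, dotProduct_smul, dotProduct_smul, hskew, smul_zero, zero_add, smul_eq_mul] at h1
    rcases mul_eq_zero.1 h1 with h2 | h2
    · linarith
    · exact hv (dotProduct_self_eq_zero.1 h2)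
  by_contra hle
  push Not at hle
  have hcont : ContinuousOn (fun s : ℝ => (s • G + (1 - s) • (1 : Matrix ι ι ℝ)).det)
      (Icc 0 1) := by
    refine Continuous.continuousOn (Continuous.matrix_det ?_)
    fun_prop
  have h := intermediate_value_Icc' zero_le_one hcont
  simp only [one_smul, sub_self, zero_smul, add_zero, sub_zero, zero_add, Matrix.det_one] at h
  obtain ⟨s, hs, h0⟩ := h ⟨hle, zero_le_one⟩
  exact hne s hs h0

namespace Prequant

/-! ### The symplectic volume density -/

section Density

variable {n : ℕ} {M : Type*} [TopologicalSpace M] [ChartedSpace (Euc (2 * n)) M]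
  [IsManifold (𝓡 (2 * n)) ∞ M] {Ω : Form (2 * n) M 2}

/-- The Gram determinant of a bilinear form on Euclidean space. -/
noncomputable def gramDet {m : ℕ} (B : Euc m →ₗ[ℝ] Euc m →ₗ[ℝ] ℝ) : ℝ :=
  (LinearMap.toMatrix₂ (EuclideanSpace.basisFun (Fin m) ℝ).toBasis
    (EuclideanSpace.basisFun (Fin m) ℝ).toBasis B).det

theorem gramDet_compl₁₂ {m : ℕ} (B : Euc m →ₗ[ℝ] Euc m →ₗ[ℝ] ℝ) (T : Euc m →L[ℝ] Euc m) :
    gramDet (B.compl₁₂ T.toLinearMap T.toLinearMap) = T.det ^ 2 * gramDet B := by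
  rw [gramDet, LinearMap.toMatrix₂_compl₁₂ (EuclideanSpace.basisFun (Fin m) ℝ).toBasis
    (EuclideanSpace.basisFun (Fin m) ℝ).toBasis, Matrix.det_mul, Matrix.det_mul,
    Matrix.det_transpose, LinearMap.det_toMatrix, gramDet, ContinuousLinearMap.det]
  ring

/-- A 2-form in a chart, as a bilinear form. -/
noncomputable def Form.chartBilinear {m : ℕ} {X : Type*} [TopologicalSpace X]
    [ChartedSpace (Euc m) X] (Ω : Form m X 2) (c : X) (y : Euc m) : Euc m →ₗ[ℝ] Euc m →ₗ[ℝ] ℝ :=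
  (Ω.bilinear ((extChartAt (𝓡 m) c).symm y)).compl₁₂ (chartFrame c y).toLinearMap
    (chartFrame c y).toLinearMap

theorem Form.chartBilinear_apply {m : ℕ} {X : Type*} [TopologicalSpace X]
    [ChartedSpace (Euc m) X] [IsManifold (𝓡 m) ∞ X] (Ω : Form m X 2) (c : X) (y u v : Euc m) :
    Ω.chartBilinear c y u v = Ω.inChart c y ![u, v] := by
  refine Form.apply_congr Ω rfl ?_
  funext i; fin_cases i <;> rfl

theorem volumeDensity_eq (Ω : Form (2 * n) M 2) (c : M) (y : Euc (2 * n)) :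
    volumeDensity Ω c y = (n.factorial : ℝ) * Real.sqrt (gramDet (Ω.chartBilinear c y)) := by
  rw [volumeDensity, gramDet]
  congr 3
  ext i j
  rw [LinearMap.toMatrix₂_apply, Form.chartBilinear_apply]
  simp

theorem continuousOn_volumeDensity (hΩ : Ω.IsSmooth) (c : M) :
    ContinuousOn (volumeDensity Ω c) (extChartAt (𝓡 (2 * n)) c).target := by
  refine continuousOn_const.mul (Real.continuous_sqrt.comp_continuousOn ?_)
  refine (continuous_id.matrix_det (n := Fin (2 * n)) (R := ℝ)).comp_continuousOn
    (continuousOn_pi.2 fun i => continuousOn_pi.2 fun j => ?_)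
  exact ((hΩ c).continuousAlternatingMap_apply (g := fun k _ => ![EuclideanSpace.single i (1 : ℝ),
    EuclideanSpace.single j (1 : ℝ)] k) fun _ => contDiffOn_const).continuousOn

/-- The Gram matrix is skew and nondegenerate, so its determinant is positive and the square root
does not take the default value 0 of negative arguments. -/
theorem volumeDensity_pos (hΩ : IsSymplecticForm Ω) (c : M) {y : Euc (2 * n)}
    (hy : y ∈ (extChartAt (𝓡 (2 * n)) c).target) : 0 < volumeDensity Ω c y := by
  rw [volumeDensity_eq]
  refine mul_pos (by positivity) (Real.sqrt_pos.2 ?_)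
  refine Matrix.det_pos_of_transpose_eq_neg ?_ ?_
  · ext i j
    rw [Matrix.transpose_apply, Matrix.neg_apply, LinearMap.toMatrix₂_apply,
      LinearMap.toMatrix₂_apply]
    exact Form.bilinear_swap _ _ _ _
  · rw [← LinearMap.separatingLeft_iff_det_ne_zero]
    intro u hu
    refine (injective_iff_map_eq_zero _).1 (chartFrame_injective c hy) u
      (hΩ.nondegenerate ((extChartAt (𝓡 (2 * n)) c).symm y) _ fun w => ?_)
    obtain ⟨v, hv⟩ := chartFrame_surjective c hy w
    rw [← hv]
    exact hu v

theorem volumeDensity_nonneg (Ω : Form (2 * n) M 2) (c : M) (y : Euc (2 * n)) :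
    0 ≤ volumeDensity Ω c y := mul_nonneg (by positivity) (Real.sqrt_nonneg _)

/-- `ψ` preserves the form `Ω`. -/
def PreservesForm {m : ℕ} {X : Type*} [TopologicalSpace X] [ChartedSpace (Euc m) X]
    (Ω : Form m X 2) (ψ : X → X) : Prop :=
  ∀ x u v, Ω.bilinear (ψ x) (tmap ψ x u) (tmap ψ x v) = Ω.bilinear x u v

/-- The expression of a map in charts. -/
noncomputable def inCharts {m : ℕ} {X : Type*} [TopologicalSpace X] [ChartedSpace (Euc m) X]
    (ψ : X → X) (d c : X) (y : Euc m) : Euc m :=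
  extChartAt (𝓡 m) c (ψ ((extChartAt (𝓡 m) d).symm y))

theorem inCharts_fderiv {m : ℕ} {X : Type*} [TopologicalSpace X] [ChartedSpace (Euc m) X]
    [IsManifold (𝓡 m) ∞ X] {ψ : X → X} (hψ : ContMDiff (𝓡 m) (𝓡 m) ∞ ψ) (d c : X) {y : Euc m}
    (hy : y ∈ (extChartAt (𝓡 m) d).target)
    (hc : ψ ((extChartAt (𝓡 m) d).symm y) ∈ (extChartAt (𝓡 m) c).source) :
    DifferentiableAt ℝ (inCharts ψ d c) y ∧
      ∀ w, tmap ψ ((extChartAt (𝓡 m) d).symm y) (chartFrame d y w) =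
        chartFrame c (inCharts ψ d c y) (fderiv ℝ (inCharts ψ d c) y w) := by
  have hs := mdifferentiableAt_extChartAt_symm_of_boundaryless (I := 𝓡 m) d hy
  have hψ' := hψ.mdifferentiable (by simp) ((extChartAt (𝓡 m) d).symm y)
  have hφ : MDifferentiableAt (𝓡 m) 𝓘(ℝ, Euc m) (extChartAt (𝓡 m) c)
      (ψ ((extChartAt (𝓡 m) d).symm y)) :=
    mdifferentiableAt_extChartAt (by rwa [extChartAt_source] at hc)
  have h1 : MDifferentiableAt 𝓘(ℝ, Euc m) 𝓘(ℝ, Euc m) (inCharts ψ d c) y :=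
    hφ.comp y (hψ'.comp y hs)
  refine ⟨h1.differentiableAt, fun w => ?_⟩
  have e1 := mfderiv_comp_apply (I := 𝓘(ℝ, Euc m)) (I' := 𝓡 m) (I'' := 𝓘(ℝ, Euc m)) y hφ
    (hψ'.comp y hs) w
  have e2 := mfderiv_comp_apply (I := 𝓘(ℝ, Euc m)) (I' := 𝓡 m) (I'' := 𝓡 m) y hψ' hs w
  have e3 : (fderiv ℝ (inCharts ψ d c) y w : Euc m) =
      mfderiv (𝓡 m) 𝓘(ℝ, Euc m) (extChartAt (𝓡 m) c) (ψ ((extChartAt (𝓡 m) d).symm y))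
        (tmap ψ ((extChartAt (𝓡 m) d).symm y) (chartFrame d y w)) := by
    rw [← mfderiv_eq_fderiv]
    exact e1.trans (congrArg (mfderiv (𝓡 m) 𝓘(ℝ, Euc m) (extChartAt (𝓡 m) c)
      (ψ ((extChartAt (𝓡 m) d).symm y))) e2)
  have hz : inCharts ψ d c y ∈ (extChartAt (𝓡 m) c).target := (extChartAt (𝓡 m) c).map_source hc
  have e4 := mfderiv_extChartAt_symm_apply_mfderiv_extChartAt (I := 𝓡 m) c hz
    (tmap ψ ((extChartAt (𝓡 m) d).symm y) (chartFrame d y w))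
  have e5 : (extChartAt (𝓡 m) c).symm (inCharts ψ d c y) = ψ ((extChartAt (𝓡 m) d).symm y) :=
    (extChartAt (𝓡 m) c).left_inv hc
  rw [e5] at e4
  rw [e3]
  exact e4.symm

/-- The Gram determinant scales by the square of the Jacobian determinant, so its square root scales
by the absolute value. -/
theorem volumeDensity_inCharts {ψ : M → M} (hψ : ContMDiff (𝓡 (2 * n)) (𝓡 (2 * n)) ∞ ψ)
    (hΩψ : PreservesForm Ω ψ) (d c : M) {y : Euc (2 * n)}
    (hy : y ∈ (extChartAt (𝓡 (2 * n)) d).target)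
    (hc : ψ ((extChartAt (𝓡 (2 * n)) d).symm y) ∈ (extChartAt (𝓡 (2 * n)) c).source) :
    volumeDensity Ω d y = |(fderiv ℝ (inCharts ψ d c) y).det| *
      volumeDensity Ω c (inCharts ψ d c y) := by
  have h1 : Ω.chartBilinear d y = (Ω.chartBilinear c (inCharts ψ d c y)).compl₁₂
      (fderiv ℝ (inCharts ψ d c) y).toLinearMap (fderiv ℝ (inCharts ψ d c) y).toLinearMap := by
    refine LinearMap.ext₂ fun u v => ?_
    have e5 : (extChartAt (𝓡 (2 * n)) c).symm (inCharts ψ d c y) =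
      ψ ((extChartAt (𝓡 (2 * n)) d).symm y) := (extChartAt (𝓡 (2 * n)) c).left_inv hc
    change Ω.bilinear _ (chartFrame d y u) (chartFrame d y v) =
      Ω.bilinear ((extChartAt (𝓡 (2 * n)) c).symm (inCharts ψ d c y))
        (chartFrame c (inCharts ψ d c y) (fderiv ℝ (inCharts ψ d c) y u))
        (chartFrame c (inCharts ψ d c y) (fderiv ℝ (inCharts ψ d c) y v))
    rw [e5, ← (inCharts_fderiv hψ d c hy hc).2, ← (inCharts_fderiv hψ d c hy hc).2, hΩψ]
  rw [volumeDensity_eq, volumeDensity_eq, h1, gramDet_compl₁₂, Real.sqrt_mul (sq_nonneg _),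
    Real.sqrt_sq_eq_abs]
  ring

end Density


/-! ### Partial derivatives in the parameters -/

section Partial

variable {m : ℕ} {P : Type*} [NormedAddCommGroup P] [NormedSpace ℝ P]
  {X : Type*} [TopologicalSpace X] [ChartedSpace (Euc m) X] [IsManifold (𝓡 m) ∞ X]

/-- The derivative of a function in the direction `e` of the parameter space. -/
noncomputable def paramDeriv (K : P → X → ℝ) (e : P) (p : P) (x : X) : ℝ :=
  fderiv ℝ (fun p => K p x) p e

theorem contDiff_param {K : P → X → ℝ}
    (hK : ContMDiff (𝓘(ℝ, P).prod (𝓡 m)) 𝓘(ℝ, ℝ) ∞ (fun q : P × X => K q.1 q.2)) (x : X) :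
    ContDiff ℝ ∞ (fun p => K p x) :=
  contMDiff_iff_contDiff.1 (hK.comp (contMDiff_id.prodMk contMDiff_const))

end Partial

section PartialSmooth

variable {m : ℕ} {P : Type} [NormedAddCommGroup P] [NormedSpace ℝ P]
  {X : Type*} [TopologicalSpace X] [ChartedSpace (Euc m) X] [IsManifold (𝓡 m) ∞ X]

theorem contMDiff_paramDeriv {K : P → X → ℝ}
    (hK : ContMDiff (𝓘(ℝ, P).prod (𝓡 m)) 𝓘(ℝ, ℝ) ∞ (fun q : P × X => K q.1 q.2)) (e : P) :
    ContMDiff (𝓘(ℝ, P).prod (𝓡 m)) 𝓘(ℝ, ℝ) ∞ (fun q : P × X => paramDeriv K e q.1 q.2) := by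
  refine contMDiff_of_inChart fun c => ?_
  have hs : IsOpen ((univ : Set P) ×ˢ (extChartAt (𝓡 m) c).target) :=
    isOpen_univ.prod (isOpen_extChartAt_target c)
  have h1 := ((contDiffOn_inChart hK c).fderiv_of_isOpen hs (m := ∞) (by simp)).clm_apply
    (contDiffOn_const (c := ((e, 0) : P × Euc m)))
  refine h1.congr fun ⟨p, y⟩ hq => ?_
  have h2 : DifferentiableAt ℝ (fun q : P × Euc m => K q.1 ((extChartAt (𝓡 m) c).symm q.2))
      (p, y) :=
    ((contDiffOn_inChart hK c).contDiffAt (hs.mem_nhds hq)).differentiableAt (by simp)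
  have h4 : HasFDerivAt (fun p : P => (p, y)) (ContinuousLinearMap.inl ℝ P (Euc m)) p :=
    (hasFDerivAt_id p).prodMk (hasFDerivAt_const y p)
  have h3 := HasFDerivAt.comp p (f := fun p : P => (p, y)) h2.hasFDerivAt h4
  exact DFunLike.congr_fun h3.fderiv e

theorem continuous_fderiv_param [FiniteDimensional ℝ P] {K : P → X → ℝ}
    (hK : ContMDiff (𝓘(ℝ, P).prod (𝓡 m)) 𝓘(ℝ, ℝ) ∞ (fun q : P × X => K q.1 q.2)) :
    Continuous (fun q : P × X => fderiv ℝ (fun p => K p q.2) q.1) :=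
  continuous_clm_apply.2 fun e => (contMDiff_paramDeriv hK e).continuous

end PartialSmooth

/-! ### Integration against the symplectic volume -/

section Volume

variable {n : ℕ} {M : Type*} [TopologicalSpace M] [ChartedSpace (Euc (2 * n)) M]
  [IsManifold (𝓡 (2 * n)) ∞ M] [T2Space M] [CompactSpace M] {Ω : Form (2 * n) M 2}

/-- The integral over a chart domain. -/
noncomputable def chartIntegral (Ω : Form (2 * n) M 2) (c : M) (g : M → ℝ) : ℝ :=
  ∫ y in (extChartAt (𝓡 (2 * n)) c).target,
    g ((extChartAt (𝓡 (2 * n)) c).symm y) * volumeDensity Ω c y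

theorem measurableSet_target (c : M) : MeasurableSet (extChartAt (𝓡 (2 * n)) c).target :=
  (isOpen_extChartAt_target c).measurableSet

/-- The density need not be integrable over a whole chart. The support of g is compact inside the
chart domain, and there the integrand is continuous. -/
theorem integrableOn_chart (hΩ : Ω.IsSmooth) (c : M) {g : M → ℝ} (hg : Continuous g)
    (hs : tsupport g ⊆ (extChartAt (𝓡 (2 * n)) c).source) :
    IntegrableOn (fun y => g ((extChartAt (𝓡 (2 * n)) c).symm y) * volumeDensity Ω c y)
      (extChartAt (𝓡 (2 * n)) c).target := by
  have hK : IsCompact (extChartAt (𝓡 (2 * n)) c '' tsupport g) :=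
    (isClosed_tsupport g).isCompact.image_of_continuousOn ((continuousOn_extChartAt c).mono hs)
  have hKt : extChartAt (𝓡 (2 * n)) c '' tsupport g ⊆ (extChartAt (𝓡 (2 * n)) c).target := by
    rintro _ ⟨x, hx, rfl⟩
    exact (extChartAt (𝓡 (2 * n)) c).map_source (hs hx)
  have h1 : ContinuousOn (fun y => g ((extChartAt (𝓡 (2 * n)) c).symm y) * volumeDensity Ω c y)
      (extChartAt (𝓡 (2 * n)) c).target :=
    (hg.comp_continuousOn (continuousOn_extChartAt_symm c)).mul (continuousOn_volumeDensity hΩ c)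
  refine ((h1.mono hKt).integrableOn_compact hK).of_forall_sdiff_eq_zero
    (measurableSet_target c) fun y hy => ?_
  have : g ((extChartAt (𝓡 (2 * n)) c).symm y) = 0 := by
    refine image_eq_zero_of_notMem_tsupport fun hmem => hy.2 ⟨_, hmem, ?_⟩
    exact (extChartAt (𝓡 (2 * n)) c).right_inv hy.1
  rw [this, zero_mul]

theorem tsupport_chartPartition (c : M) :
    tsupport (chartPartition n M c) ⊆ (extChartAt (𝓡 (2 * n)) c).source := by
  rw [extChartAt_source]
  exact (SmoothPartitionOfUnity.exists_isSubordinate_chartAt_source (𝓡 (2 * n)) M).choose_spec c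

theorem tsupport_chartPartition_mul (c : M) (f : M → ℝ) :
    tsupport (fun x => chartPartition n M c x * f x) ⊆ (extChartAt (𝓡 (2 * n)) c).source :=
  (tsupport_mul_subset_left).trans (tsupport_chartPartition c)

theorem continuous_chartPartition (c : M) : Continuous (chartPartition n M c) :=
  (chartPartition n M c).contMDiff.continuous

variable (n M) in
theorem finite_chartPartition :
    {c : M | (Function.support (chartPartition n M c)).Nonempty}.Finite :=
  (chartPartition n M).locallyFinite.finite_nonempty_of_compact

variable (n M) in
/-- The charts which contribute to the chosen partition of unity. -/
noncomputable def activeCharts : Finset M := (finite_chartPartition n M).toFinset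

theorem chartPartition_eq_zero {c : M} (hc : c ∉ activeCharts n M) (x : M) :
    chartPartition n M c x = 0 := by
  by_contra h
  exact hc ((finite_chartPartition n M).mem_toFinset.2 ⟨x, h⟩)

theorem sum_chartPartition (x : M) : ∑ c ∈ activeCharts n M, chartPartition n M c x = 1 := by
  rw [← (chartPartition n M).sum_eq_one (mem_univ x)]
  refine (finsum_eq_sum_of_support_subset _ fun c hc => ?_).symm
  by_contra h
  exact hc (chartPartition_eq_zero h x)

theorem volumeIntegral_eq_sum (Ω : Form (2 * n) M 2) (f : M → ℝ) : volumeIntegral Ω f =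
    ∑ c ∈ activeCharts n M, chartIntegral Ω c (fun x => chartPartition n M c x * f x) := by
  refine finsum_eq_sum_of_support_subset _ fun c hc => ?_
  by_contra h
  refine hc ?_
  simp only [chartPartition_eq_zero h, zero_mul, integral_zero]

/-! #### Invariance -/

/-- This is the change of variables formula on the open set where ψ, read in the charts d and c, is
defined. The support condition on g makes both integrals live on that set and on its image. -/
theorem chartIntegral_comp {ψ ψ' : M → M} (hψ : ContMDiff (𝓡 (2 * n)) (𝓡 (2 * n)) ∞ ψ)
    (hl : ∀ x, ψ' (ψ x) = x) (hr : ∀ x, ψ (ψ' x) = x) (hΩψ : PreservesForm Ω ψ) (d c : M) {g : M → ℝ}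
    (hg : ∀ x, g x ≠ 0 → x ∈ (extChartAt (𝓡 (2 * n)) d).source ∧
      ψ x ∈ (extChartAt (𝓡 (2 * n)) c).source) :
    chartIntegral Ω d g = chartIntegral Ω c (fun x => g (ψ' x)) := by
  set A : Set (Euc (2 * n)) := (extChartAt (𝓡 (2 * n)) d).target ∩
    (fun y => ψ ((extChartAt (𝓡 (2 * n)) d).symm y)) ⁻¹' (extChartAt (𝓡 (2 * n)) c).source with hA
  set B : Set (Euc (2 * n)) := (extChartAt (𝓡 (2 * n)) c).target ∩
    (fun y => ψ' ((extChartAt (𝓡 (2 * n)) c).symm y)) ⁻¹' (extChartAt (𝓡 (2 * n)) d).source with hB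
  have hAo : IsOpen A := (hψ.continuous.comp_continuousOn
    (continuousOn_extChartAt_symm d)).isOpen_inter_preimage (isOpen_extChartAt_target d)
    (isOpen_extChartAt_source c)
  have hAB : inCharts ψ d c '' A = B := by
    ext z
    constructor
    · rintro ⟨y, hy, rfl⟩
      refine ⟨(extChartAt (𝓡 (2 * n)) c).map_source hy.2, ?_⟩
      have e : (extChartAt (𝓡 (2 * n)) c).symm (inCharts ψ d c y) =
        ψ ((extChartAt (𝓡 (2 * n)) d).symm y) := (extChartAt (𝓡 (2 * n)) c).left_inv hy.2
      rw [mem_preimage, e, hl]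
      exact (extChartAt (𝓡 (2 * n)) d).map_target hy.1
    · rintro ⟨hz, hz'⟩
      have e : (extChartAt (𝓡 (2 * n)) d).symm (extChartAt (𝓡 (2 * n)) d
          (ψ' ((extChartAt (𝓡 (2 * n)) c).symm z))) = ψ' ((extChartAt (𝓡 (2 * n)) c).symm z) :=
        (extChartAt (𝓡 (2 * n)) d).left_inv hz'
      refine ⟨extChartAt (𝓡 (2 * n)) d (ψ' ((extChartAt (𝓡 (2 * n)) c).symm z)),
        ⟨(extChartAt (𝓡 (2 * n)) d).map_source hz', ?_⟩, ?_⟩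
      · rw [mem_preimage, e, hr]
        exact (extChartAt (𝓡 (2 * n)) c).map_target hz
      · rw [inCharts, e, hr]
        exact (extChartAt (𝓡 (2 * n)) c).right_inv hz
  have hinj : InjOn (inCharts ψ d c) A := by
    intro y hy y' hy' h
    have h1 := (extChartAt (𝓡 (2 * n)) c).injOn hy.2 hy'.2 h
    have h2 := congrArg ψ' h1
    simp only [hl] at h2
    exact (extChartAt (𝓡 (2 * n)) d).symm.injOn hy.1 hy'.1 h2
  have h1 := integral_image_eq_integral_abs_det_fderiv_smul volume hAo.measurableSet
    (fun y hy => ((inCharts_fderiv hψ d c hy.1 hy.2).1.hasFDerivAt).hasFDerivWithinAt) hinj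
    (fun z => g (ψ' ((extChartAt (𝓡 (2 * n)) c).symm z)) * volumeDensity Ω c z)
  rw [hAB] at h1
  have hd : chartIntegral Ω d g = ∫ y in A, g ((extChartAt (𝓡 (2 * n)) d).symm y) *
      volumeDensity Ω d y := by
    refine setIntegral_eq_of_subset_of_forall_sdiff_eq_zero (measurableSet_target d)
      inter_subset_left fun y hy => ?_
    by_contra hne
    exact hy.2 ⟨hy.1, (hg _ (left_ne_zero_of_mul hne)).2⟩
  have hc : chartIntegral Ω c (fun x => g (ψ' x)) = ∫ y in B,
      g (ψ' ((extChartAt (𝓡 (2 * n)) c).symm y)) * volumeDensity Ω c y := by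
    refine setIntegral_eq_of_subset_of_forall_sdiff_eq_zero (measurableSet_target c)
      inter_subset_left fun y hy => ?_
    by_contra hne
    exact hy.2 ⟨hy.1, (hg _ (left_ne_zero_of_mul hne)).1⟩
  rw [hd, hc, h1]
  refine setIntegral_congr_fun hAo.measurableSet fun y hy => ?_
  have e : (extChartAt (𝓡 (2 * n)) c).symm (inCharts ψ d c y) =
        ψ ((extChartAt (𝓡 (2 * n)) d).symm y) := (extChartAt (𝓡 (2 * n)) c).left_inv hy.2
  simp only [smul_eq_mul]
  rw [volumeDensity_inCharts hψ hΩψ d c hy.1 hy.2, e, hl]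
  ring

theorem chartIntegral_finset_sum (hΩ : Ω.IsSmooth) (c : M) {ι : Type*} (S : Finset ι)
    {g : ι → M → ℝ} (hg : ∀ i ∈ S, Continuous (g i))
    (hs : ∀ i ∈ S, tsupport (g i) ⊆ (extChartAt (𝓡 (2 * n)) c).source) :
    chartIntegral Ω c (fun x => ∑ i ∈ S, g i x) = ∑ i ∈ S, chartIntegral Ω c (g i) := by
  rw [chartIntegral]
  simp only [Finset.sum_mul]
  exact integral_finsetSum _ fun i hi => integrableOn_chart hΩ c (hg i hi) (hs i hi)

/-- Inserting the partition functions pulled back by ψ splits each integral over a chart d into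
pieces that ψ carries into a chart c. After changing variables and swapping the sums, the partition
indexed by d sums to 1. -/
theorem volumeIntegral_comp (hΩ : Ω.IsSmooth) {ψ ψ' : M → M}
    (hψ : ContMDiff (𝓡 (2 * n)) (𝓡 (2 * n)) ∞ ψ)
    (hψ' : Continuous ψ') (hl : ∀ x, ψ' (ψ x) = x) (hr : ∀ x, ψ (ψ' x) = x)
    (hΩψ : PreservesForm Ω ψ) {f : M → ℝ} (hf : Continuous f) :
    volumeIntegral Ω (fun x => f (ψ x)) = volumeIntegral Ω f := by
  have h1 : ∀ d, chartIntegral Ω d (fun x => chartPartition n M d x * f (ψ x)) =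
      ∑ c ∈ activeCharts n M, chartIntegral Ω c
        (fun x => chartPartition n M c x * (chartPartition n M d (ψ' x) * f x)) := fun d => by
    have e : (fun x => chartPartition n M d x * f (ψ x)) = fun x => ∑ c ∈ activeCharts n M,
        chartPartition n M d x * (chartPartition n M c (ψ x) * f (ψ x)) := by
      funext x
      rw [← Finset.mul_sum, ← Finset.sum_mul, sum_chartPartition, one_mul]
    rw [e, chartIntegral_finset_sum hΩ d _
      (g := fun c x => chartPartition n M d x * (chartPartition n M c (ψ x) * f (ψ x)))
      (fun c _ => (continuous_chartPartition d).mul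
        (((continuous_chartPartition c).mul hf).comp hψ.continuous))
      fun c _ => tsupport_chartPartition_mul d _]
    refine Finset.sum_congr rfl fun c _ => ?_
    rw [chartIntegral_comp hψ hl hr hΩψ d c fun x hx => ?_]
    · congr 1
      funext x
      rw [hr]
      ring
    · exact ⟨tsupport_chartPartition d (subset_tsupport _ (left_ne_zero_of_mul hx)),
        tsupport_chartPartition c (subset_tsupport _
          (left_ne_zero_of_mul (right_ne_zero_of_mul hx)))⟩
  rw [volumeIntegral_eq_sum, volumeIntegral_eq_sum, Finset.sum_congr rfl fun d _ => h1 d,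
    Finset.sum_comm]
  refine Finset.sum_congr rfl fun c _ => ?_
  rw [← chartIntegral_finset_sum hΩ c _
    (g := fun d x => chartPartition n M c x * (chartPartition n M d (ψ' x) * f x)) (fun d _ => (continuous_chartPartition c).mul
    (((continuous_chartPartition d).comp hψ').mul hf)) fun d _ => tsupport_chartPartition_mul c _]
  congr 1
  funext x
  rw [← Finset.mul_sum, ← Finset.sum_mul, sum_chartPartition, one_mul]

/-! #### Linearity, positivity and differentiation under the integral sign -/

theorem volumeIntegral_sub (hΩ : Ω.IsSmooth) {f g : M → ℝ} (hf : Continuous f)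
    (hg : Continuous g) :
    volumeIntegral Ω (fun x => f x - g x) = volumeIntegral Ω f - volumeIntegral Ω g := by
  rw [volumeIntegral_eq_sum, volumeIntegral_eq_sum, volumeIntegral_eq_sum,
    ← Finset.sum_sub_distrib]
  refine Finset.sum_congr rfl fun c _ => ?_
  have h1 := integral_sub
    (integrableOn_chart hΩ c ((continuous_chartPartition c).mul hf)
      (tsupport_chartPartition_mul c _))
    (integrableOn_chart hΩ c ((continuous_chartPartition c).mul hg)
      (tsupport_chartPartition_mul c _))
  refine Eq.trans ?_ h1
  rw [chartIntegral]
  congr 1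
  funext y
  simp only [Pi.mul_apply]
  ring

theorem volumeIntegral_const (Ω : Form (2 * n) M 2) (a : ℝ) :
    volumeIntegral Ω (fun _ => a) = a * totalVolume Ω := by
  rw [totalVolume, volumeIntegral_eq_sum, volumeIntegral_eq_sum, Finset.mul_sum]
  refine Finset.sum_congr rfl fun c _ => ?_
  rw [chartIntegral, chartIntegral, ← integral_const_mul]
  congr 1
  funext y
  ring

theorem totalVolume_pos [Nonempty M] (hΩ : IsSymplecticForm Ω) : 0 < totalVolume Ω := by
  rw [totalVolume, volumeIntegral_eq_sum]
  have hnn : ∀ (c : M) y, 0 ≤ chartPartition n M c ((extChartAt (𝓡 (2 * n)) c).symm y) * 1 *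
      volumeDensity Ω c y := fun c y =>
    mul_nonneg (mul_nonneg ((chartPartition n M).nonneg c _) zero_le_one)
      (volumeDensity_nonneg Ω c y)
  obtain ⟨x⟩ := ‹Nonempty M›
  obtain ⟨c, hc, hcx⟩ : ∃ c ∈ activeCharts n M, chartPartition n M c x ≠ 0 := by
    by_contra! h
    have := sum_chartPartition (n := n) x
    rw [Finset.sum_eq_zero h] at this
    exact zero_ne_one this
  refine Finset.sum_pos' (fun c _ => integral_nonneg (hnn c)) ⟨c, hc, ?_⟩
  have hx : x ∈ (extChartAt (𝓡 (2 * n)) c).source :=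
    tsupport_chartPartition c (subset_tsupport _ hcx)
  rw [chartIntegral, setIntegral_pos_iff_support_of_nonneg_ae
    (Eventually.of_forall (hnn c)) (integrableOn_chart hΩ.smooth c
      ((continuous_chartPartition c).mul continuous_const) (tsupport_chartPartition_mul c _))]
  set y := extChartAt (𝓡 (2 * n)) c x with hy
  have hyt := (extChartAt (𝓡 (2 * n)) c).map_source hx
  have hopen : IsOpen ((extChartAt (𝓡 (2 * n)) c).target ∩
      (fun y => chartPartition n M c ((extChartAt (𝓡 (2 * n)) c).symm y)) ⁻¹' {0}ᶜ) :=
    ((continuous_chartPartition c).comp_continuousOn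
      (continuousOn_extChartAt_symm c)).isOpen_inter_preimage (isOpen_extChartAt_target c)
      isOpen_compl_singleton
  refine (hopen.measure_pos volume ⟨y, hyt, ?_⟩).trans_le (measure_mono fun z hz => ⟨?_, hz.1⟩)
  · rw [mem_preimage, hy, (extChartAt (𝓡 (2 * n)) c).left_inv hx]
    exact hcx
  · exact mul_ne_zero (mul_ne_zero hz.2 one_ne_zero) (volumeDensity_pos hΩ c hz.1).ne'

theorem aestronglyMeasurable_chart (c : M) {F : Type*} [NormedAddCommGroup F] [NormedSpace ℝ F]
    {f : M → F} (hf : Continuous f) :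
    AEStronglyMeasurable (fun y => f ((extChartAt (𝓡 (2 * n)) c).symm y))
      (volume.restrict (extChartAt (𝓡 (2 * n)) c).target) :=
  (hf.comp_continuousOn (continuousOn_extChartAt_symm c)).aestronglyMeasurable
    (measurableSet_target c)

theorem hasFDerivAt_volumeIntegral (hΩ : Ω.IsSmooth) {P : Type*} [NormedAddCommGroup P]
    [NormedSpace ℝ P] [FiniteDimensional ℝ P] {K : P → M → ℝ} {K' : P → M → P →L[ℝ] ℝ}
    (hK : ∀ p, Continuous (K p)) (hK' : Continuous (fun q : P × M => K' q.1 q.2))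
    (hd : ∀ p x, HasFDerivAt (fun p => K p x) (K' p x) p) (p : P) :
    ∃ L : P →L[ℝ] ℝ, HasFDerivAt (fun p => volumeIntegral Ω (K p)) L p ∧
      ∀ e, L e = volumeIntegral Ω (fun x => K' p x e) := by
  set w : M → Euc (2 * n) → ℝ := fun c y =>
    chartPartition n M c ((extChartAt (𝓡 (2 * n)) c).symm y) * volumeDensity Ω c y with hw
  have hwi : ∀ c, IntegrableOn (w c) (extChartAt (𝓡 (2 * n)) c).target := fun c =>
    integrableOn_chart hΩ c (continuous_chartPartition c) (tsupport_chartPartition c)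
  have hI : ∀ f, volumeIntegral Ω f = ∑ c ∈ activeCharts n M,
      ∫ y in (extChartAt (𝓡 (2 * n)) c).target, w c y * f ((extChartAt (𝓡 (2 * n)) c).symm y) :=
    fun f => by
      rw [volumeIntegral_eq_sum]
      refine Finset.sum_congr rfl fun c _ => ?_
      rw [chartIntegral]
      congr 1
      funext y
      simp only [hw]
      ring
  -- The derivatives are bounded on the compact set of nearby parameters times M. With the
  -- integrable weight w this gives the dominating function.
  obtain ⟨C, hC⟩ := ((isCompact_closedBall p 1).prod (isCompact_univ (X := M))).exists_bound_of_continuousOn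
    hK'.continuousOn
  have hKp : Continuous (K' p) := hK'.comp (continuous_const.prodMk continuous_id)
  have hbd : ∀ q ∈ ball p 1, ∀ x, ‖K' q x‖ ≤ C := fun q hq x =>
    hC (q, x) ⟨ball_subset_closedBall hq, mem_univ _⟩
  have hKint : ∀ (c : M), Integrable (fun y => w c y • K' p ((extChartAt (𝓡 (2 * n)) c).symm y))
      (volume.restrict (extChartAt (𝓡 (2 * n)) c).target) := fun c =>
    (hwi c).smul_bdd (C := C) (aestronglyMeasurable_chart c hKp)
      (Eventually.of_forall fun y => hbd p (mem_ball_self one_pos) _)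
  have hder : ∀ c, HasFDerivAt (fun p => ∫ y in (extChartAt (𝓡 (2 * n)) c).target,
      w c y * K p ((extChartAt (𝓡 (2 * n)) c).symm y))
      (∫ y in (extChartAt (𝓡 (2 * n)) c).target,
        w c y • K' p ((extChartAt (𝓡 (2 * n)) c).symm y)) p := fun c => by
    obtain ⟨C', hC'⟩ := (isCompact_univ (X := M)).exists_bound_of_continuousOn (hK p).continuousOn
    refine hasFDerivAt_integral_of_dominated_of_fderiv_le (bound := fun y => |w c y| * C)
      (ball_mem_nhds p one_pos) (Eventually.of_forall fun q => ?_) ?_ ?_ ?_ ?_ ?_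
      (F' := fun q y => w c y • K' q ((extChartAt (𝓡 (2 * n)) c).symm y))
    · exact (hwi c).aestronglyMeasurable.mul (aestronglyMeasurable_chart c (hK q))
    · exact (hwi c).mul_bdd (c := C') (aestronglyMeasurable_chart c (hK p)) (Eventually.of_forall fun y => hC' _ (mem_univ _))
    · exact (hKint c).aestronglyMeasurable
    · refine Eventually.of_forall fun y q hq => ?_
      rw [norm_smul, Real.norm_eq_abs]
      exact mul_le_mul_of_nonneg_left (hbd q hq _) (abs_nonneg _)
    · exact (hwi c).norm.mul_const C
    · exact Eventually.of_forall fun y q _ => (hd q _).const_smul (w c y)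
  refine ⟨∑ c ∈ activeCharts n M, ∫ y in (extChartAt (𝓡 (2 * n)) c).target,
    w c y • K' p ((extChartAt (𝓡 (2 * n)) c).symm y), ?_, fun e => ?_⟩
  · simp only [hI]
    exact HasFDerivAt.fun_sum fun c _ => hder c
  · rw [hI, sum_apply]
    refine Finset.sum_congr rfl fun c _ => ?_
    rw [ContinuousLinearMap.integral_apply (hKint c)]
    rfl

/-- Each directional derivative of the integral is the integral of `paramDeriv`, a function of the
same kind as K, so induction on the order closes up. -/
theorem contDiff_volumeIntegral (hΩ : Ω.IsSmooth) {P : Type} [NormedAddCommGroup P]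
    [NormedSpace ℝ P] [FiniteDimensional ℝ P] {K : P → M → ℝ}
    (hK : ContMDiff (𝓘(ℝ, P).prod (𝓡 (2 * n))) 𝓘(ℝ, ℝ) ∞ (fun q : P × M => K q.1 q.2)) :
    ContDiff ℝ ∞ (fun p => volumeIntegral Ω (K p)) := by
  have hd : ∀ K : P → M → ℝ,
      ContMDiff (𝓘(ℝ, P).prod (𝓡 (2 * n))) 𝓘(ℝ, ℝ) ∞ (fun q : P × M => K q.1 q.2) →
      ∀ p, ∃ L : P →L[ℝ] ℝ, HasFDerivAt (fun p => volumeIntegral Ω (K p)) L p ∧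
        ∀ e, L e = volumeIntegral Ω (paramDeriv K e p) := fun K hK p =>
    hasFDerivAt_volumeIntegral hΩ (fun p => (contMDiff_apply_left hK p).continuous)
      (continuous_fderiv_param hK)
      (fun p x => ((contDiff_param hK x).differentiable (by simp) p).hasFDerivAt) p
  refine contDiff_infty.2 fun k => ?_
  induction k generalizing K with
  | zero =>
    refine contDiff_zero.2 (continuous_iff_continuousAt.2 fun p => ?_)
    obtain ⟨L, hL, -⟩ := hd K hK p
    exact hL.continuousAt
  | succ k ih =>
    rw [Nat.cast_add, Nat.cast_one]
    refine (contDiff_succ_iff_fderiv_apply (𝕜 := ℝ) (D := P) (E := ℝ)).2 ⟨fun p => ?_, fun h => ?_, fun e => ?_⟩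
    · obtain ⟨L, hL, -⟩ := hd K hK p
      exact hL.differentiableAt
    · exact absurd h (by simp)
    · have : (fun p => fderiv ℝ (fun p => volumeIntegral Ω (K p)) p e) =
          fun p => volumeIntegral Ω (paramDeriv K e p) := by
        funext p
        obtain ⟨L, hL, hLe⟩ := hd K hK p
        rw [hL.fderiv, hLe]
      rw [this]
      exact ih (contMDiff_paramDeriv hK e)

end Volume


/-! ### Curves and functions with vanishing derivative -/

section Constant

variable {m : ℕ} {X : Type*} [TopologicalSpace X] [ChartedSpace (Euc m) X]
  [IsManifold (𝓡 m) ∞ X]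

/-- Isotopies are compared only on [0,1]. At the end points one-sided derivatives suffice because
both curves are differentiable there. -/
theorem curveVel_congr_Icc {γ γ' : ℝ → X} {t : ℝ} (hγ : MDifferentiableAt 𝓘(ℝ, ℝ) (𝓡 m) γ t)
    (hγ' : MDifferentiableAt 𝓘(ℝ, ℝ) (𝓡 m) γ' t) (h : ∀ t ∈ Icc (0 : ℝ) 1, γ t = γ' t)
    (ht : t ∈ Icc (0 : ℝ) 1) : curveVel (m := m) γ t = curveVel (m := m) γ' t := by
  have hu : UniqueMDiffWithinAt 𝓘(ℝ, ℝ) (Icc (0 : ℝ) 1) t :=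
    (uniqueDiffOn_Icc_zero_one t ht).uniqueMDiffWithinAt
  have h1 := mfderivWithin_eq_mfderiv hu hγ
  have h2 := mfderivWithin_eq_mfderiv hu hγ'
  have h3 := mfderivWithin_congr_of_mem (I := 𝓘(ℝ, ℝ)) (I' := 𝓡 m) h ht
  have h4 : (mfderiv 𝓘(ℝ, ℝ) (𝓡 m) γ t : ℝ →L[ℝ] Euc m) =
    (mfderiv 𝓘(ℝ, ℝ) (𝓡 m) γ' t : ℝ →L[ℝ] Euc m) := h1.symm.trans (h3.trans h2)
  exact DFunLike.congr_fun h4 (1 : ℝ)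

/-- On the open interval the curve is an integral curve of the zero field, hence constant;
continuity extends this to the end points. Vanishing velocity is required only inside because
homotopies are controlled only for s in [0,1]. -/
theorem eq_of_curveVel_eq_zero [T2Space X] {γ : ℝ → X} (hγ : ContMDiff 𝓘(ℝ, ℝ) (𝓡 m) ∞ γ)
    (h : ∀ s ∈ Ioo (0 : ℝ) 1, curveVel (m := m) γ s = 0) {s : ℝ} (hs : s ∈ Icc (0 : ℝ) 1) :
    γ s = γ 0 := by
  have hd : MDifferentiable 𝓘(ℝ, ℝ) (𝓡 m) γ := hγ.mdifferentiable (by simp)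
  have hmid : (1 / 2 : ℝ) ∈ Ioo (0 : ℝ) 1 := by norm_num
  have h1 : EqOn γ (fun _ => γ (1 / 2)) (Ioo 0 1) := by
    have : IsManifold (𝓡 m) 1 X := IsManifold.of_le (n := ∞) (by simp)
    refine isMIntegralCurveOn_Ioo_eqOn_of_contMDiff_boundaryless (I := 𝓡 m) (v := fun _ => 0) hmid
      (Bundle.contMDiff_zeroSection ℝ (TangentSpace (𝓡 m) : X → Type _)) (fun t ht => ?_) (fun t ht => ?_) rfl
    · have := hasMFDerivAt_curveVel (hd t)
      rw [h t ht] at this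
      exact this.hasMFDerivWithinAt
    · refine ((hasMFDerivAt_const (I := 𝓘(ℝ, ℝ)) (I' := 𝓡 m) (γ (1 / 2))
        t).hasMFDerivWithinAt).congr_mfderiv ?_
      ext
      simp
      rfl
  have h2 : EqOn γ (fun _ => γ (1 / 2)) (Icc 0 1) := by
    have := h1.closure hγ.continuous continuous_const
    rwa [closure_Ioo zero_ne_one] at this
  rw [h2 hs, h2 ⟨le_rfl, zero_le_one⟩]

theorem eq_of_diff_eq_zero [PreconnectedSpace X] {F : X → ℝ} (hF : ContMDiff (𝓡 m) 𝓘(ℝ, ℝ) ∞ F)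
    (h : ∀ x v, diff (m := m) F x v = 0) (x y : X) : F x = F y := by
  have hl : IsLocallyConstant F := by
    refine (IsLocallyConstant.iff_eventually_eq F).2 fun c => ?_
    have h1 : DifferentiableOn ℝ (fun y => F ((extChartAt (𝓡 m) c).symm y))
        (extChartAt (𝓡 m) c).target := fun y hy => by
      have h2 : MDifferentiableAt 𝓘(ℝ, Euc m) 𝓘(ℝ, ℝ) (fun y => F ((extChartAt (𝓡 m) c).symm y)) y :=
        (hF.mdifferentiable (by simp) _).comp y
          (mdifferentiableAt_extChartAt_symm_of_boundaryless (I := 𝓡 m) c hy)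
      exact h2.differentiableAt.differentiableWithinAt
    have h2 : EqOn (fderiv ℝ (fun y => F ((extChartAt (𝓡 m) c).symm y))) 0
        (extChartAt (𝓡 m) c).target := fun y hy => by
      ext v
      have h3 := mfderiv_comp_apply (I := 𝓘(ℝ, Euc m)) (I' := 𝓡 m) (I'' := 𝓘(ℝ, ℝ)) y
        (hF.mdifferentiable (by simp) ((extChartAt (𝓡 m) c).symm y))
        (mdifferentiableAt_extChartAt_symm_of_boundaryless (I := 𝓡 m) c hy) v
      rw [← mfderiv_eq_fderiv]
      exact h3.trans (h _ _)
    have h3 := (isOpen_extChartAt_target c).isOpen_inter_preimage_of_fderiv_eq_zero h1 h2 {F c}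
    have hc := mem_extChartAt_source (I := 𝓡 m) c
    have h4 : extChartAt (𝓡 m) c c ∈ (extChartAt (𝓡 m) c).target ∩
        (fun y => F ((extChartAt (𝓡 m) c).symm y)) ⁻¹' {F c} :=
      ⟨mem_extChartAt_target c, by simp⟩
    filter_upwards [(continuousAt_extChartAt (I := 𝓡 m) c).preimage_mem_nhds (h3.mem_nhds h4),
      (isOpen_extChartAt_source (I := 𝓡 m) c).mem_nhds hc] with z hz hz'
    have := hz.2
    rw [mem_preimage, (extChartAt (𝓡 m) c).left_inv hz'] at this
    exact this
  exact hl.apply_eq_of_preconnectedSpace x y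

end Constant

/-! ### Chain rule along parametrized curves and naturality of dα -/

section Chain

variable {m : ℕ} {P : Type} [NormedAddCommGroup P] [NormedSpace ℝ P]
  {X : Type*} [TopologicalSpace X] [ChartedSpace (Euc m) X] [IsManifold (𝓡 m) ∞ X]

theorem hasDerivAt_param_curve {h : P → X → ℝ}
    (hh : ContMDiff (𝓘(ℝ, P).prod (𝓡 m)) 𝓘(ℝ, ℝ) ∞ (fun q : P × X => h q.1 q.2)) {p : ℝ → P} {e : P}
    {γ : ℝ → X} {s : ℝ} (hp : HasDerivAt p e s) (hγ : MDifferentiableAt 𝓘(ℝ, ℝ) (𝓡 m) γ s) :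
    HasDerivAt (fun σ => h (p σ) (γ σ))
      (paramDeriv h e (p s) (γ s) + diff (m := m) (h (p s)) (γ s) (curveVel γ s)) s := by
  have hd : MDifferentiableAt (𝓘(ℝ, P).prod (𝓡 m)) 𝓘(ℝ, ℝ) (fun q : P × X => h q.1 q.2)
      (p s, γ s) := hh.mdifferentiable (by simp) _
  have h1 := hd.hasMFDerivAt.comp s (hp.hasFDerivAt.hasMFDerivAt.prodMk (hasMFDerivAt_curveVel hγ))
  have h2 : HasFDerivAt (fun σ => h (p σ) (γ σ)) _ s := h1.hasFDerivAt
  have h3 : HasDerivAt (fun σ => h (p σ) (γ σ)) _ s :=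
    HasFDerivAt.hasDerivAt (𝕜 := ℝ) (F := ℝ) h2
  have e1 : ((1 : ℝ →L[ℝ] ℝ).smulRight (curveVel γ s) : ℝ →L[ℝ] Euc m) 1 = curveVel γ s :=
    one_smul ℝ _
  have e2 : (ContinuousLinearMap.toSpanSingleton ℝ e) 1 = e := one_smul ℝ _
  have e3 : mfderiv 𝓘(ℝ, P) 𝓘(ℝ, ℝ) (fun z => h z (γ s)) (p s) =
    fderiv ℝ (fun z => h z (γ s)) (p s) := mfderiv_eq_fderiv
  refine h3.congr_deriv ((mfderiv_prod_eq_add_apply hd).trans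
    (congrArg₂ (fun a b : ℝ => a + b) ?_ ?_))
  · exact (congrArg (mfderiv 𝓘(ℝ, P) 𝓘(ℝ, ℝ) (fun z => h z (γ s)) (p s)) e2).trans
      (DFunLike.congr_fun e3 e)
  · exact congrArg (diff (m := m) (h (p s)) (γ s)) e1

/-- A map which preserves a 1-form preserves its exterior derivative. -/
theorem Form.IsSmooth.bilinear_d_tmap {α : Form m X 1} (hα : α.IsSmooth) {ψ : X → X}
    (hψ : ContMDiff (𝓡 m) (𝓡 m) ∞ ψ)
    (h : ∀ x v, α.linear (ψ x) (tmap ψ x v) = α.linear x v) (x : X) (u v : Euc m) :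
    α.d.bilinear (ψ x) (tmap ψ x u) (tmap ψ x v) = α.d.bilinear x u v := by
  obtain ⟨c, y, hy, rfl⟩ : ∃ c, ∃ y ∈ (extChartAt (𝓡 m) c).target,
      (extChartAt (𝓡 m) c).symm y = x := ⟨x, _, mem_extChartAt_target x, extChartAt_to_inv x⟩
  obtain ⟨u, rfl⟩ := chartFrame_surjective c hy u
  obtain ⟨v, rfl⟩ := chartFrame_surjective c hy v
  set f : Euc m → X := fun z => ψ ((extChartAt (𝓡 m) c).symm z) with hf
  have ho := isOpen_extChartAt_target (I := 𝓡 m) c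
  have hs := contMDiffOn_extChartAt_symm (I := 𝓡 m) (n := ∞) c
  have hfs : ContMDiffOn 𝓘(ℝ, Euc m) (𝓡 m) ∞ f (extChartAt (𝓡 m) c).target :=
    hψ.comp_contMDiffOn hs
  have hder : ∀ z ∈ (extChartAt (𝓡 m) c).target, ∀ w,
      (mfderiv 𝓘(ℝ, Euc m) (𝓡 m) f z w : Euc m) =
        tmap ψ ((extChartAt (𝓡 m) c).symm z) (chartFrame c z w) := fun z hz w =>
    mfderiv_comp_apply (I := 𝓘(ℝ, Euc m)) (I' := 𝓡 m) (I'' := 𝓡 m) z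
      (hψ.mdifferentiable (by simp) _)
      (mdifferentiableAt_extChartAt_symm_of_boundaryless (I := 𝓡 m) c hz) w
  have h1 : α.pullbackTo f =ᶠ[𝓝 y] α.pullbackTo (extChartAt (𝓡 m) c).symm := by
    filter_upwards [ho.mem_nhds hy] with z hz
    ext w
    have ew : w = ![w 0] := by
      ext i; fin_cases i; rfl
    rw [ew]
    exact (α.pullbackTo_one_apply f z (w 0)).trans ((congrArg (α.linear (f z))
      (hder z hz (w 0))).trans ((h _ _).trans (α.pullbackTo_one_apply _ z (w 0)).symm))
  have h2 := h1.extDeriv_eq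
  rw [hα.extDeriv_pullbackTo ho hfs hy, hα.extDeriv_pullbackTo ho hs hy] at h2
  have h3 := DFunLike.congr_fun h2 ![u, v]
  exact (congrArg₂ (fun a b : Euc m => α.d.bilinear (f y) a b) (hder y hy u)
    (hder y hy v)).symm.trans ((α.d.pullbackTo_two_apply f y u v).symm.trans
      (h3.trans (α.d.pullbackTo_two_apply _ y u v)))

end Chain


theorem curveVel_const {m : ℕ} {X : Type*} [TopologicalSpace X] [ChartedSpace (Euc m) X] (x : X)
    (t : ℝ) : curveVel (m := m) (fun _ => x) t = 0 := by
  have : mfderiv 𝓘(ℝ, ℝ) (𝓡 m) (fun _ : ℝ => x) t = 0 := mfderiv_const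
  exact DFunLike.congr_fun this (1 : ℝ)

section IntervalIntegral

variable {n : ℕ} {M : Type*} [TopologicalSpace M] [ChartedSpace (Euc (2 * n)) M]
  [IsManifold (𝓡 (2 * n)) ∞ M] [T2Space M] [CompactSpace M] {Ω : Form (2 * n) M 2}

/-- An exchange of integrals obtained by differentiating in t: the derivative of the left side is
the integral of κ over M at time t, which is zero, and at t = 0 the left side vanishes. -/
theorem volumeIntegral_intervalIntegral_eq_zero (hΩ : Ω.IsSmooth) {κ : ℝ → M → ℝ}
    (hκ : Continuous (fun q : ℝ × M => κ q.1 q.2)) (h : ∀ t, volumeIntegral Ω (κ t) = 0) (t : ℝ) :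
    volumeIntegral Ω (fun y => ∫ τ in (0 : ℝ)..t, κ τ y) = 0 := by
  have hκy : ∀ y, Continuous (fun t => κ t y) := fun y =>
    hκ.comp (continuous_id.prodMk continuous_const)
  have hd : ∀ t, HasDerivAt (fun t => volumeIntegral Ω (fun y => ∫ τ in (0 : ℝ)..t, κ τ y)) 0 t := by
    intro t
    obtain ⟨L, hL, hLe⟩ := hasFDerivAt_volumeIntegral hΩ
      (K := fun t y => ∫ τ in (0 : ℝ)..t, κ τ y)
      (K' := fun t y => ContinuousLinearMap.toSpanSingleton ℝ (κ t y))
      (fun t => intervalIntegral.continuous_parametric_intervalIntegral_of_continuous'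
        (f := fun y τ => κ τ y) (hκ.comp continuous_swap) 0 t)
      ((ContinuousLinearMap.toSpanSingletonCLE (𝕜 := ℝ) (E := ℝ)).continuous.comp hκ)
      (fun t y => (intervalIntegral.integral_hasDerivAt_right ((hκy y).intervalIntegrable _ _)
        ((hκy y).stronglyMeasurableAtFilter _ _) (hκy y).continuousAt).hasFDerivAt) t
    have := hLe 1
    simp only [ContinuousLinearMap.toSpanSingleton_apply, one_smul] at this
    rw [h t] at this
    exact hL.hasDerivAt.congr_deriv this
  have h1 := is_const_of_deriv_eq_zero (fun t => (hd t).differentiableAt) (fun t => (hd t).deriv) t 0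
  refine h1.trans ?_
  simp only [intervalIntegral.integral_same]
  rw [volumeIntegral_const, zero_mul]

end IntervalIntegral

/-! ### Lifts of homotopies of Hamiltonian isotopies -/

section Homotopy

variable {n : ℕ}
  {V : Type*} [TopologicalSpace V] [ChartedSpace (Euc (2 * n + 1)) V]
  [IsManifold (𝓡 (2 * n + 1)) ∞ V]
  {M : Type*} [TopologicalSpace M] [ChartedSpace (Euc (2 * n)) M] [IsManifold (𝓡 (2 * n)) ∞ M]
  {α : Form (2 * n + 1) V 1} {Ω : Form (2 * n) M 2} {π : V → M}
  {R : V → Euc (2 * n + 1)} {ρ : DiffeoFamily (2 * n + 1) ℝ V}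

/-- The two-parameter family `Ψ` of diffeomorphisms of `V` consists of the lifts of the
Hamiltonian isotopies `t ↦ Φ (s, t)` which are generated by the Hamiltonians `K (s, t)`. -/
structure IsLiftedHomotopy (α : Form (2 * n + 1) V 1) (Ω : Form (2 * n) M 2) (π : V → M)
    (R : V → Euc (2 * n + 1)) (K : ℝ × ℝ → M → ℝ) (Φ : DiffeoFamily (2 * n) (ℝ × ℝ) M)
    (Ψ : DiffeoFamily (2 * n + 1) (ℝ × ℝ) V) : Prop where
  smooth : ContMDiff (𝓘(ℝ, ℝ × ℝ).prod (𝓡 (2 * n))) 𝓘(ℝ, ℝ) ∞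
    (fun q : (ℝ × ℝ) × M => K q.1 q.2)
  generates : ∀ s, IsGeneratedBy Ω (Φ.slice s) (fun t => K (s, t))
  start : ∀ s ∈ Icc (0 : ℝ) 1, ∀ y, Φ.toFun (s, 0) y = y
  flow : ∀ s, IsContactFlow α R (fun t x => K (s, t) (π x)) (Ψ.slice s)

/-- The path of diffeomorphisms at a fixed second parameter. -/
def DiffeoFamily.coslice {m : ℕ} {X : Type*} [TopologicalSpace X] [ChartedSpace (Euc m) X]
    (Φ : DiffeoFamily m (ℝ × ℝ) X) (t : ℝ) : DiffeoFamily m ℝ X where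
  toFun s := Φ.toFun (s, t)
  invFun s := Φ.invFun (s, t)
  left_inv s := Φ.left_inv (s, t)
  right_inv s := Φ.right_inv (s, t)
  smooth_toFun := Φ.smooth_toFun.comp
    ((contMDiff_fst.prodMk_space contMDiff_const).prodMk contMDiff_snd)
  smooth_invFun := Φ.smooth_invFun.comp
    ((contMDiff_fst.prodMk_space contMDiff_const).prodMk contMDiff_snd)

theorem IsPrequantization.contMDiff_basic {P : Type*} [NormedAddCommGroup P] [NormedSpace ℝ P]
    (hπ : IsPrequantization α Ω π) {K : P → M → ℝ}
    (hK : ContMDiff (𝓘(ℝ, P).prod (𝓡 (2 * n))) 𝓘(ℝ, ℝ) ∞ (fun q : P × M => K q.1 q.2)) :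
    ContMDiff (𝓘(ℝ, P).prod (𝓡 (2 * n + 1))) 𝓘(ℝ, ℝ) ∞ (fun q : P × V => K q.1 (π q.2)) :=
  hK.comp (contMDiff_fst.prodMk (hπ.smooth.comp contMDiff_snd))

namespace IsLiftedHomotopy

variable {K : ℝ × ℝ → M → ℝ} {Φ : DiffeoFamily (2 * n) (ℝ × ℝ) M}
  {Ψ : DiffeoFamily (2 * n + 1) (ℝ × ℝ) V} (h : IsLiftedHomotopy α Ω π R K Φ Ψ)
  (hπ : IsPrequantization α Ω π) (hρ : IsReebFlow α π R ρ)

include h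

theorem mdifferentiable_ham (p : ℝ × ℝ) : MDifferentiable (𝓡 (2 * n)) 𝓘(ℝ, ℝ) (K p) :=
  (contMDiff_apply_left h.smooth p).mdifferentiable (by simp)

include hπ hρ

theorem diff_ham_reeb (p : ℝ × ℝ) (x : V) : diff (fun x => K p (π x)) x (R x) = 0 := by
  have := hπ.diff_basic_reeb hρ (h.mdifferentiable_ham p) 0 x
  simpa only [add_zero] using this

/-- The projection of an integral curve of the basic contact field is an integral curve of the
Hamiltonian field with the same starting point, so uniqueness on M identifies it. -/
theorem proj [T2Space M] {s : ℝ} (hs : s ∈ Icc (0 : ℝ) 1) (t : ℝ) (x : V) :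
    π (Ψ.toFun (s, t) x) = Φ.toFun (s, t) (π x) := by
  have h1 := (h.flow s).curve x
  have h2 := (hπ.isContactCurve_iff hρ (F := fun t => K (s, t)) (c := fun _ => 0)
    (fun t => h.mdifferentiable_ham (s, t)) h1.mdifferentiable).1 (by
      simpa only [add_zero] using h1)
  have h3 := hπ.symplectic.curve_unique (contMDiff_slice h.smooth s) h2.2
    ((h.generates s).isHamCurve (π x)) (by
      change π ((Ψ.slice s).toFun 0 x) = Φ.toFun (s, 0) (π x)
      rw [(h.flow s).start, h.start s hs])
  exact congrFun h3 t

theorem linear_tmap (p : ℝ × ℝ) (x : V) (v : Euc (2 * n + 1)) :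
    α.linear (Ψ.toFun p x) (tmap (Ψ.toFun p) x v) = α.linear x v :=
  (h.flow p.1).linear_tmap_of_invariant hρ.reeb hπ.contact
    (contMDiff_slice (h := fun p x => K p (π x)) (hπ.contMDiff_basic h.smooth) p.1) (fun t x => h.diff_ham_reeb hπ hρ (p.1, t) x)
    p.2 x v

/-- The lift preserves α, hence dα, which is the pullback of Ω. Surjectivity of π and of its
derivative transfers this to M. -/
theorem preservesForm [T2Space M] {s : ℝ} (hs : s ∈ Icc (0 : ℝ) 1) (t : ℝ) :
    PreservesForm Ω (Φ.toFun (s, t)) := by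
  intro y u v
  obtain ⟨x, rfl⟩ := hπ.surjective y
  obtain ⟨u, rfl⟩ := hπ.tmap_surjective hρ x u
  obtain ⟨v, rfl⟩ := hπ.tmap_surjective hρ x v
  have hΦd : MDifferentiable (𝓡 (2 * n)) (𝓡 (2 * n)) (Φ.toFun (s, t)) :=
    (Φ.smooth_apply (s, t)).mdifferentiable (by simp)
  have hΨd : MDifferentiable (𝓡 (2 * n + 1)) (𝓡 (2 * n + 1)) (Ψ.toFun (s, t)) :=
    (Ψ.smooth_apply (s, t)).mdifferentiable (by simp)
  have key : ∀ w, tmap (m := 2 * n) (k := 2 * n) (Φ.toFun (s, t)) (π x)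
      (tmap (m := 2 * n + 1) (k := 2 * n) π x w) =
      tmap (m := 2 * n + 1) (k := 2 * n) π (Ψ.toFun (s, t) x) (tmap (Ψ.toFun (s, t)) x w) :=
    fun w => by
      rw [← tmap_comp (hΦd _) (hπ.mdifferentiable x), ← tmap_comp (hπ.mdifferentiable _) (hΨd x)]
      exact tmap_congr (fun x => (h.proj hπ hρ hs t x).symm) x w
  rw [key, key, ← h.proj hπ hρ hs, hπ.bilinear_tmap, hπ.bilinear_tmap]
  exact hπ.contact.smooth.bilinear_d_tmap (Ψ.smooth_apply (s, t)) (h.linear_tmap hπ hρ (s, t)) x u v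

/-- By Cartan's formula on the surface, ∂_t α(∂_s Ψ) is the s-derivative of K(s,t)(π Ψ) plus dα(∂_t
Ψ, ∂_s Ψ). The chain rule term dK(∂_s Ψ) of the former cancels the latter, leaving the explicit
derivative of K in s. -/
theorem hasDerivAt_pairing_coslice (s t : ℝ) (x : V) :
    HasDerivAt (fun τ => (Ψ.coslice τ).pairing α s x)
      (paramDeriv K (1, 0) (s, t) (π (Ψ.toFun (s, t) x))) t := by
  have hh := hπ.contMDiff_basic h.smooth
  have hu : ContMDiff 𝓘(ℝ, ℝ × ℝ) (𝓡 (2 * n + 1)) ∞ (fun p => Ψ.toFun p x) :=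
    Ψ.smooth_toFun.comp (contMDiff_id.prodMk contMDiff_const)
  have h1 := hasDerivAt_param_curve (h := fun p x => K p (π x)) hh (p := fun σ => (σ, t)) (s := s)
    ((hasDerivAt_id s).prodMk (hasDerivAt_const s t))
    (((Ψ.coslice t).contMDiff_curve x).mdifferentiable (by simp) s)
  have h2 := hasDerivAt_linear_surface hπ.contact.smooth hu s t
    (f := fun p => K p (π (Ψ.toFun p x))) (fun s t => ((h.flow s).curve x).linear_curveVel t) h1
  have h3 := ((h.flow s).curve x).bilinear_curveVel t
    (curveVel (fun σ => Ψ.toFun (σ, t) x) s)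
  have h4 : α.d.bilinear (Ψ.toFun (s, t) x) (curveVel (fun τ => Ψ.toFun (s, τ) x) t)
      (curveVel (fun σ => Ψ.toFun (σ, t) x) s) = -diff (m := 2 * n + 1)
        (fun x => K (s, t) (π x)) (Ψ.toFun (s, t) x) (curveVel (fun σ => Ψ.toFun (σ, t) x) s) := by
    refine h3.trans ?_
    have := h.diff_ham_reeb hπ hρ (s, t) ((Ψ.slice s).toFun t x)
    rw [this, zero_mul, add_zero]
    rfl
  rw [h4] at h2
  refine h2.congr_deriv ?_
  exact add_neg_cancel_right _ _

theorem pairing_coslice_zero (s : ℝ) (x : V) : (Ψ.coslice 0).pairing α s x = 0 := by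
  have e : (fun σ => (Ψ.coslice 0).toFun σ x) = fun _ => x := funext fun σ => (h.flow σ).start x
  have e2 : (Ψ.coslice 0).vel s x = 0 := by
    rw [DiffeoFamily.vel, e]
    exact curveVel_const x s
  rw [DiffeoFamily.pairing, e2, map_zero]

theorem pairing_coslice_eq_integral [T2Space M] {s : ℝ} (hs : s ∈ Icc (0 : ℝ) 1) (t : ℝ) (x : V) :
    (Ψ.coslice t).pairing α s x =
      ∫ τ in (0 : ℝ)..t, paramDeriv K (1, 0) (s, τ) (Φ.toFun (s, τ) (π x)) := by
  have hd : ∀ t, HasDerivAt (fun τ => (Ψ.coslice τ).pairing α s x)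
      (paramDeriv K (1, 0) (s, t) (Φ.toFun (s, t) (π x))) t := fun t => by
    rw [← h.proj hπ hρ hs]
    exact h.hasDerivAt_pairing_coslice hπ hρ s t x
  have hc : Continuous (fun t => paramDeriv K (1, 0) (s, t) (Φ.toFun (s, t) (π x))) := by
    have h1 := (contMDiff_paramDeriv h.smooth (1, 0)).continuous
    have h2 : Continuous (fun t : ℝ => Φ.toFun (s, t) (π x)) :=
      ((Φ.slice s).contMDiff_curve (π x)).continuous
    exact h1.comp ((continuous_const.prodMk continuous_id).prodMk h2)
  rw [intervalIntegral.integral_eq_sub_of_hasDerivAt (fun t _ => hd t)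
    (hc.intervalIntegrable _ _), h.pairing_coslice_zero hπ hρ, sub_zero]

variable [T2Space M] {f : M → M} (hf : ∀ s ∈ Icc (0 : ℝ) 1, ∀ y, Φ.toFun (s, 1) y = f y)
include hf

/-- The lifts have end points which differ by the Reeb flow. -/
theorem vel_coslice_one {s : ℝ} (hs : s ∈ Ioo (0 : ℝ) 1) (x : V) :
    (Ψ.coslice 1).vel s x = (Ψ.coslice 1).pairing α s x • R (Ψ.toFun (s, 1) x) := by
  refine hπ.eq_of_tmap_eq hρ (x := Ψ.toFun (s, 1) x) ?_ ?_
  · rw [map_smul, hρ.reeb.apply_eq_one, smul_eq_mul, mul_one]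
    rfl
  · rw [map_smul, hπ.tmap_reeb hρ, smul_zero]
    have h1 := curveVel_comp (m := 2 * n + 1) (k := 2 * n)
      (γ := fun σ => (Ψ.coslice 1).toFun σ x) (t := s)
      (hπ.mdifferentiable _) (((Ψ.coslice 1).contMDiff_curve x).mdifferentiable (by simp) s)
    refine h1.symm.trans ?_
    -- The time one map on M is fixed only for s in [0,1], so it is locally constant in s only at
    -- interior points.
    have h2 : (fun σ => π ((Ψ.coslice 1).toFun σ x)) =ᶠ[𝓝 s] fun _ => f (π x) := by
      filter_upwards [isOpen_Ioo.mem_nhds hs] with σ hσ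
      exact (h.proj hπ hρ (Ioo_subset_Icc_self hσ) 1 x).trans (hf σ (Ioo_subset_Icc_self hσ) _)
    have h3 := DFunLike.congr_fun (h2.mfderiv_eq (I := 𝓘(ℝ, ℝ)) (I' := 𝓡 (2 * n))) (1 : ℝ)
    exact Eq.trans h3 (curveVel_const (f (π x)) s)

/-- Differentiating in s the identity that Ψ(s,1) preserves α gives 0 = dw + dα(w R, ·), where w is
the pairing, and the last term vanishes for the Reeb field. -/
theorem diff_pairing_coslice_one {s : ℝ} (hs : s ∈ Ioo (0 : ℝ) 1) (x : V)
    (v : Euc (2 * n + 1)) : diff ((Ψ.coslice 1).pairing α s) x v = 0 := by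
  have h1 := (Ψ.coslice 1).hasDerivAt_linear_tmap hπ.contact.smooth s x v
  have h2 : (fun σ => α.linear ((Ψ.coslice 1).toFun σ x) (tmap ((Ψ.coslice 1).toFun σ) x v)) =
      fun _ => α.linear x v := funext fun σ => h.linear_tmap hπ hρ (σ, 1) x v
  rw [h2] at h1
  have h3 := h1.unique (hasDerivAt_const s _)
  rw [h.vel_coslice_one hπ hρ hf hs, map_smul, LinearMap.smul_apply] at h3
  have h4 := hρ.reeb.d_eq_zero (Ψ.toFun (s, 1) x) (tmap ((Ψ.coslice 1).toFun s) x v)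
  have h5 : α.d.bilinear ((Ψ.coslice 1).toFun s x) (R (Ψ.toFun (s, 1) x))
    (tmap ((Ψ.coslice 1).toFun s) x v) = 0 := h4
  rwa [h5, smul_zero, add_zero] at h3

variable [CompactSpace M] [T2Space V] [ConnectedSpace V]
  (hnorm : ∀ p, volumeIntegral Ω (K p) = 0)
include hnorm

/-- The pairing is constant on the connected V and descends to a time integral of (∂_s K)∘Φ on M.
Each integrand has mean zero, since Φ preserves volume and the integral of K is identically zero. So
the constant times the positive total volume is 0. -/
theorem pairing_coslice_one {s : ℝ} (hs : s ∈ Ioo (0 : ℝ) 1) (x : V) :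
    (Ψ.coslice 1).pairing α s x = 0 := by
  have hs' := Ioo_subset_Icc_self hs
  have hΩ := hπ.symplectic.smooth
  have hconst := eq_of_diff_eq_zero ((Ψ.coslice 1).contMDiff_pairing_apply hπ.contact.smooth s)
    (h.diff_pairing_coslice_one hπ hρ hf hs)
  set w := (Ψ.coslice 1).pairing α s x with hw
  have hK1 := contMDiff_paramDeriv h.smooth ((1, 0) : ℝ × ℝ)
  have hzero : ∀ p, volumeIntegral Ω (paramDeriv K (1, 0) p) = 0 := fun p => by
    obtain ⟨L, hL, hLe⟩ := hasFDerivAt_volumeIntegral hΩ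
      (fun p => (contMDiff_apply_left h.smooth p).continuous) (continuous_fderiv_param h.smooth)
      (fun p x => ((contDiff_param h.smooth x).differentiable (by simp) p).hasFDerivAt) p
    simp only [hnorm] at hL
    have := hLe (1, 0)
    rw [hL.unique (hasFDerivAt_const 0 p)] at this
    exact this.symm
  have h1 := volumeIntegral_intervalIntegral_eq_zero hΩ
    (κ := fun t y => paramDeriv K (1, 0) (s, t) (Φ.toFun (s, t) y))
    (hK1.continuous.comp ((continuous_const.prodMk continuous_fst).prodMk
      (Φ.slice s).smooth_toFun.continuous)) (fun t => by
      have h2 := volumeIntegral_comp hΩ (Φ.smooth_apply (s, t))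
        (DiffeoFamily.smooth_apply Φ⁻¹ (s, t)).continuous (Φ.left_inv (s, t)) (Φ.right_inv (s, t))
        (h.preservesForm hπ hρ hs' t) (contMDiff_apply_left hK1 (s, t)).continuous
      exact h2.trans (hzero (s, t))) 1
  have h2 : (fun y => ∫ τ in (0 : ℝ)..1, paramDeriv K (1, 0) (s, τ) (Φ.toFun (s, τ) y)) =
      fun _ => w := funext fun y => by
    obtain ⟨x', rfl⟩ := hπ.surjective y
    rw [← h.pairing_coslice_eq_integral hπ hρ hs', hconst x' x]
  rw [h2, volumeIntegral_const] at h1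
  have : Nonempty M := ⟨π x⟩
  exact (mul_eq_zero.1 h1).resolve_right (totalVolume_pos hπ.symplectic).ne'

/-- The lifts of homotopic Hamiltonian isotopies by normalized Hamiltonians have the same end
points. -/
theorem eq_coslice_one {s : ℝ} (hs : s ∈ Icc (0 : ℝ) 1) (x : V) :
    Ψ.toFun (s, 1) x = Ψ.toFun (0, 1) x :=
  eq_of_curveVel_eq_zero ((Ψ.coslice 1).contMDiff_curve x) (fun s hs => by
    have := h.vel_coslice_one hπ hρ hf hs x
    rw [h.pairing_coslice_one hπ hρ hf hnorm hs, zero_smul] at this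
    exact this) hs

end IsLiftedHomotopy

end Homotopy


/-! ### Normalized Hamiltonians -/

section Normalization

variable {n : ℕ}
  {V : Type*} [TopologicalSpace V] [ChartedSpace (Euc (2 * n + 1)) V]
  {M : Type*} [TopologicalSpace M] [ChartedSpace (Euc (2 * n)) M] [IsManifold (𝓡 (2 * n)) ∞ M]
  [T2Space M] [CompactSpace M] {Ω : Form (2 * n) M 2} {π : V → M}

theorem diff_sub {m : ℕ} {X : Type*} [TopologicalSpace X] [ChartedSpace (Euc m) X] {F G : X → ℝ}
    {x : X} (hF : MDifferentiableAt (𝓡 m) 𝓘(ℝ, ℝ) F x) (hG : MDifferentiableAt (𝓡 m) 𝓘(ℝ, ℝ) G x)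
    (v : Euc m) : diff (m := m) (fun x => F x - G x) x v = diff F x v - diff G x v :=
  DFunLike.congr_fun (hF.hasMFDerivAt.sub hG.hasMFDerivAt).mfderiv v

/-- The normalization of a family of functions with respect to the symplectic volume. -/
noncomputable def normalize (Ω : Form (2 * n) M 2) {P : Type*} (K : P → M → ℝ) (p : P) (y : M) : ℝ :=
  K p y - volumeIntegral Ω (K p) / totalVolume Ω

theorem contMDiff_normalize (hΩ : Ω.IsSmooth) {P : Type} [NormedAddCommGroup P] [NormedSpace ℝ P]
    [FiniteDimensional ℝ P] {K : P → M → ℝ}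
    (hK : ContMDiff (𝓘(ℝ, P).prod (𝓡 (2 * n))) 𝓘(ℝ, ℝ) ∞ (fun q : P × M => K q.1 q.2)) :
    ContMDiff (𝓘(ℝ, P).prod (𝓡 (2 * n))) 𝓘(ℝ, ℝ) ∞ (fun q : P × M => normalize Ω K q.1 q.2) :=
  hK.sub (((contDiff_volumeIntegral hΩ hK).div_const _).contMDiff.comp contMDiff_fst)

theorem volumeIntegral_normalize (hΩ : IsSymplecticForm Ω) {P : Type*} {K : P → M → ℝ} {p : P}
    (hK : Continuous (K p)) : volumeIntegral Ω (normalize Ω K p) = 0 := by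
  -- For empty M the total volume is 0 and the division is meaningless, but every integral vanishes.
  rcases isEmpty_or_nonempty M with hM | hM
  · rw [show normalize Ω K p = fun _ => 0 from funext fun y => hM.elim y, volumeIntegral_const,
      zero_mul]
  · have := volumeIntegral_sub hΩ.smooth hK
      (continuous_const (y := volumeIntegral Ω (K p) / totalVolume Ω))
    rw [volumeIntegral_const, div_mul_cancel₀ _ (totalVolume_pos hΩ).ne', sub_self] at this
    exact this

theorem normalize_eq_of_sub_const (hΩ : IsSymplecticForm Ω) {P P' : Type*} {K : P → M → ℝ}
    {L : P' → M → ℝ} {p : P} {q : P'} (hK : Continuous (K p)) (hL : Continuous (L q))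
    (h : ∀ x y, K p x - L q x = K p y - L q y) (y : M) : normalize Ω K p y = normalize Ω L q y := by
  have : Nonempty M := ⟨y⟩
  have h1 := volumeIntegral_sub hΩ.smooth hK hL
  have e : (fun x => K p x - L q x) = fun _ => K p y - L q y := funext fun x => h x y
  rw [e, volumeIntegral_const] at h1
  have h2 := (totalVolume_pos hΩ).ne'
  have h3 : volumeIntegral Ω (K p) / totalVolume Ω =
      volumeIntegral Ω (L q) / totalVolume Ω + (K p y - L q y) := by
    field_simp
    linarith
  rw [normalize, normalize, h3]
  ring

theorem IsGeneratedBy.normalize {f : DiffeoFamily (2 * n) ℝ M} {F : ℝ → M → ℝ}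
    (h : IsGeneratedBy Ω f F) (hF : ∀ t, MDifferentiable (𝓡 (2 * n)) 𝓘(ℝ, ℝ) (F t)) {c : ℝ → ℝ} :
    IsGeneratedBy Ω f (fun t y => F t y - c t) := fun t x v => by
  refine (h t x v).trans (congrArg Neg.neg ?_)
  have h1 := diff_sub (hF t (f.toFun t x)) (mdifferentiableAt_const (c := c t)) v
  exact (h1.trans ((congrArg (_ - ·) (diff_const (c t) _ v)).trans (sub_zero _))).symm

/-- The normalized Hamiltonian is determined by the isotopy. -/
theorem normalize_eq_of_isGeneratedBy [PreconnectedSpace M] (hΩ : IsSymplecticForm Ω)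
    {f g : DiffeoFamily (2 * n) ℝ M} {F G : ℝ → M → ℝ} (hf : IsGeneratedBy Ω f F)
    (hg : IsGeneratedBy Ω g G) (hF : ∀ t, ContMDiff (𝓡 (2 * n)) 𝓘(ℝ, ℝ) ∞ (F t))
    (hG : ∀ t, ContMDiff (𝓡 (2 * n)) 𝓘(ℝ, ℝ) ∞ (G t))
    (h : ∀ t ∈ Icc (0 : ℝ) 1, ∀ x, f.toFun t x = g.toFun t x) {t : ℝ} (ht : t ∈ Icc (0 : ℝ) 1)
    (y : M) : normalize Ω F t y = normalize Ω G t y := by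
  refine normalize_eq_of_sub_const hΩ (hF t).continuous (hG t).continuous
    (eq_of_diff_eq_zero ((hF t).sub (hG t)) fun y v => ?_) y
  refine (diff_sub ((hF t).mdifferentiable (by simp) y) ((hG t).mdifferentiable (by simp) y)
    v).trans ?_
  obtain ⟨x, rfl⟩ : ∃ x, f.toFun t x = y := ⟨f.invFun t y, f.right_inv t y⟩
  have h1 := (hf.isHamCurve x).bilinear_curveVel t v
  have h2 := (hg.isHamCurve x).bilinear_curveVel t v
  rw [← curveVel_congr_Icc ((f.contMDiff_curve x).mdifferentiable (by simp) t)
    ((g.contMDiff_curve x).mdifferentiable (by simp) t) (fun t ht => h t ht x) ht] at h2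
  simp only [← h t ht x] at h2
  rw [h1] at h2
  linarith

end Normalization

/-! ### Independence of the lift from the chosen representative -/

section WellDefined

variable {n : ℕ}
  {V : Type*} [TopologicalSpace V] [ChartedSpace (Euc (2 * n + 1)) V]
  [IsManifold (𝓡 (2 * n + 1)) ∞ V] [T2Space V] [CompactSpace V] [ConnectedSpace V]
  {M : Type*} [TopologicalSpace M] [ChartedSpace (Euc (2 * n)) M] [IsManifold (𝓡 (2 * n)) ∞ M]
  [T2Space M] [CompactSpace M]
  {α : Form (2 * n + 1) V 1} {Ω : Form (2 * n) M 2} {π : V → M}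

/-- The loop φ⁻¹ψ is contracted by Ψ(0,t)⁻¹ Ψ(s,t), a loop in t for each s because the end points do
not depend on s. -/
theorem mk_eq_of_family {Ψ : DiffeoFamily (2 * n + 1) (ℝ × ℝ) V}
    (hΨ : ∀ p, PreservesContact α (Ψ.toFun p)) (h0 : ∀ s x, Ψ.toFun (s, 0) x = x)
    (h1 : ∀ s ∈ Icc (0 : ℝ) 1, ∀ x, Ψ.toFun (s, 1) x = Ψ.toFun (0, 1) x) {φ ψ : contactPaths α}
    (hφ : φ.1 = Ψ.slice 0) (hψ : ψ.1 = Ψ.slice 1) :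
    (QuotientGroup.mk φ : ContTilde α) = QuotientGroup.mk ψ := by
  refine QuotientGroup.eq.2 ⟨(Ψ.slice 0).unslice⁻¹ * Ψ, fun p => ?_, fun s _ x => ?_,
    fun s hs x => ?_, fun t _ x => ?_, fun t _ x => ?_⟩
  · refine PreservesContact.comp (f := ((Ψ.slice 0).unslice⁻¹).toFun p) ?_ (hΨ p)
      (DiffeoFamily.smooth_apply _ p) (Ψ.smooth_apply p)
    exact (hΨ (0, p.2)).of_inverse (Ψ.smooth_apply (0, p.2))
      (DiffeoFamily.smooth_apply ((Ψ.slice 0).unslice⁻¹) p) (Ψ.right_inv (0, p.2))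
  · change Ψ.invFun (0, 0) (Ψ.toFun (s, 0) x) = x
    rw [h0, ← h0 0 x, Ψ.left_inv, h0]
  · change Ψ.invFun (0, 1) (Ψ.toFun (s, 1) x) = x
    rw [h1 s hs, Ψ.left_inv]
  · exact Ψ.left_inv (0, t) x
  · change Ψ.invFun (0, t) (Ψ.toFun (1, t) x) = φ.1.invFun t (ψ.1.toFun t x)
    rw [hφ, hψ]
    rfl

variable (hπ : IsPrequantization α Ω π)
  {μ : ContTilde α → ℝ} (hμ : IsMonotoneQuasimorphism α μ)
include hπ hμ

theorem IsPrequantization.contactClass_congr {h k : ℝ → V → ℝ}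
    (hh : ContMDiff (𝓘(ℝ, ℝ).prod (𝓡 (2 * n + 1))) 𝓘(ℝ, ℝ) ∞ (fun q : ℝ × V => h q.1 q.2))
    (hk : ContMDiff (𝓘(ℝ, ℝ).prod (𝓡 (2 * n + 1))) 𝓘(ℝ, ℝ) ∞ (fun q : ℝ × V => k q.1 q.2))
    (heq : ∀ t ∈ Icc (0 : ℝ) 1, ∀ x, h t x = k t x) :
    μ (contactClass α h) = μ (contactClass α k) := by
  obtain ⟨R, ρ, hρ⟩ := hπ.exists_reebFlow
  exact le_antisymm
    (hρ.reeb.contactClass_le hπ.contact hμ hh hk fun t ht x => (heq t ht x).le)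
    (hρ.reeb.contactClass_le hπ.contact hμ hk hh fun t ht x => (heq t ht x).ge)

/-- The lift of Hamiltonian isotopies to the prequantization is compatible with homotopies with
fixed end points. -/
theorem IsPrequantization.contactClass_sigma_eq {f g : HamIsotopy Ω} (hfg : HamHomotopic Ω f g) :
    μ (contactClass α (sigma Ω π f.ham)) = μ (contactClass α (sigma Ω π g.ham)) := by
  obtain ⟨R, ρ, hρ⟩ := hπ.exists_reebFlow
  obtain ⟨Φ, K, hK, hgen, hstart, hfin, hbot, htop⟩ := hfg
  have hΩ := hπ.symplectic
  have : ConnectedSpace M := hπ.surjective.connectedSpace hπ.smooth.continuous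
  have hKc : ∀ s t, ContMDiff (𝓡 (2 * n)) 𝓘(ℝ, ℝ) ∞ (K s t) := fun s t =>
    contMDiff_apply_left (F := fun p : ℝ × ℝ => K p.1 p.2) hK (s, t)
  have hN := contMDiff_normalize hΩ.smooth (K := fun p : ℝ × ℝ => K p.1 p.2) hK
  have hNV := hπ.contMDiff_basic hN
  obtain ⟨Ψ, hΨ⟩ := hρ.reeb.exists_family hπ.contact
    (h := fun p x => normalize Ω (fun p : ℝ × ℝ => K p.1 p.2) p (π x)) hNV
  have hlift : IsLiftedHomotopy α Ω π R (normalize Ω (fun p : ℝ × ℝ => K p.1 p.2)) Φ Ψ :=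
    ⟨hN, fun s => (hgen s).normalize fun t => (hKc s t).mdifferentiable (by simp), hstart, hΨ⟩
  have hend : ∀ s ∈ Icc (0 : ℝ) 1, ∀ x, Ψ.toFun (s, 1) x = Ψ.toFun (0, 1) x := fun s hs x =>
    hlift.eq_coslice_one hπ hρ hfin
      (fun p => volumeIntegral_normalize hΩ (hKc p.1 p.2).continuous) hs x
  have hsl : ∀ s, ContMDiff (𝓘(ℝ, ℝ).prod (𝓡 (2 * n + 1))) 𝓘(ℝ, ℝ) ∞
      (fun q : ℝ × V => sigma Ω π (K s) q.1 q.2) := fun s =>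
    contMDiff_slice (h := fun p x => normalize Ω (fun p : ℝ × ℝ => K p.1 p.2) p (π x)) hNV s
  -- At the two ends of the homotopy the Hamiltonian from K and the given one generate the same
  -- isotopy on [0,1]. Their normalizations therefore agree there, which is all that μ sees.
  have hside : ∀ (e : HamIsotopy Ω) (s : ℝ),
      (∀ t ∈ Icc (0 : ℝ) 1, ∀ x, Φ.toFun (s, t) x = e.flow.toFun t x) →
      μ (contactClass α (sigma Ω π e.ham)) = μ (contactClass α (sigma Ω π (K s))) := by
    intro e s hes
    have heN := hπ.contMDiff_basic (contMDiff_normalize hΩ.smooth e.smooth_ham)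
    refine hπ.contactClass_congr hμ heN (hsl s) fun t ht x => ?_
    exact (normalize_eq_of_isGeneratedBy hΩ (hgen s) e.generates (hKc s)
      (contMDiff_apply_left e.smooth_ham) hes ht (π x)).symm
  have hclass : ∀ s, μ (contactClass α (sigma Ω π (K s))) =
      μ (QuotientGroup.mk ((hΨ s).toPath hρ.reeb hπ.contact (hsl s))) := fun s =>
    hμ.contactClass_eq ((hΨ s).hasContactHamiltonian hρ.reeb hπ.contact (hsl s))
  rw [hside f 0 hbot, hside g 1 htop, hclass, hclass]
  exact congrArg μ (mk_eq_of_family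
    (fun p => (hΨ p.1).preservesContact hρ.reeb hπ.contact (hsl p.1) p.2)
    (fun s x => (hΨ s).start x) hend rfl rfl)

/-- The representative picked by `Quot.out` is linked to an isotopy generated by H only through the
equivalence relation generated by homotopy. Invariance under a single homotopy extends along such
chains. -/
theorem IsPrequantization.map_pullback {H : M → ℝ} (hH : ContMDiff (𝓡 (2 * n)) 𝓘(ℝ, ℝ) ∞ H) :
    μ (pullback α Ω π (hamClass Ω (fun _ => H))) =
      μ (contactClass α (sigma Ω π (fun _ => H))) := by
  have hex := hπ.symplectic.exists_hamIsotopy hH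
  have key : ∀ f g : HamIsotopy Ω, Relation.EqvGen (HamHomotopic Ω) f g →
      μ (contactClass α (sigma Ω π f.ham)) = μ (contactClass α (sigma Ω π g.ham)) := by
    intro f g h
    induction h with
    | rel f g h => exact hπ.contactClass_sigma_eq hμ h
    | refl f => rfl
    | symm f g _ ih => exact ih.symm
    | trans f g k _ _ ih ih' => exact ih.trans ih'
  obtain ⟨f, hf, hfe⟩ : ∃ f : HamIsotopy Ω, f.ham = (fun _ => H) ∧
      hamClass Ω (fun _ => H) = Quot.mk (HamHomotopic Ω) f :=
    ⟨hex.choose, hex.choose_spec, dif_pos hex⟩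
  rw [pullback, key _ f (Quot.eqvGen_exact ((Quot.out_eq _).trans hfe)), hf]

end WellDefined


/-- A smooth approximation of the positive part. -/
theorem exists_contDiff_approx_posPart {ε : ℝ} (hε : 0 < ε) :
    ∃ χ : ℝ → ℝ, ContDiff ℝ ∞ χ ∧ (∀ s ≤ 0, χ s = 0) ∧ ∀ s, s - ε ≤ χ s := by
  -- The function vanishes for s ≤ 0 and equals s for s ≥ ε; in between it is nonnegative while s -
  -- ε ≤ 0.
  refine ⟨fun s => s * Real.smoothTransition (s / ε),
    contDiff_id.mul (Real.smoothTransition.contDiff.comp (contDiff_id.div_const ε)),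
    fun s hs => ?_, fun s => ?_⟩
  · simp only
    rw [Real.smoothTransition.zero_of_nonpos (div_nonpos_of_nonpos_of_nonneg hs hε.le), mul_zero]
  · rcases le_or_gt s ε with h | h
    · rcases le_or_gt s 0 with h' | h'
      · simp only
        rw [Real.smoothTransition.zero_of_nonpos (div_nonpos_of_nonpos_of_nonneg h' hε.le)]
        linarith
      · have := mul_nonneg h'.le (Real.smoothTransition.nonneg (s / ε))
        simp only
        linarith
    · simp only
      rw [Real.smoothTransition.one_of_one_le ((one_le_div hε).2 h.le)]
      linarith

/-! ### The quasi-state in terms of μ, and the two implications -/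

section Main

variable {n : ℕ}
  {V : Type*} [TopologicalSpace V] [ChartedSpace (Euc (2 * n + 1)) V]
  [IsManifold (𝓡 (2 * n + 1)) ∞ V] [T2Space V] [CompactSpace V]
  {M : Type*} [TopologicalSpace M] [ChartedSpace (Euc (2 * n)) M] [IsManifold (𝓡 (2 * n)) ∞ M]
  {α : Form (2 * n + 1) V 1} {Ω : Form (2 * n) M 2} {π : V → M}
  {μ : ContTilde α → ℝ}

section Basic

variable (hπ : IsPrequantization α Ω π) (hμ : IsMonotoneQuasimorphism α μ)
include hπ hμ

theorem IsPrequantization.contactClass_one_pos : 0 < μ (contactClass α (fun _ _ => 1)) := by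
  obtain ⟨R, ρ, hρ⟩ := hπ.exists_reebFlow
  rw [hρ.contactClass_const hπ hμ, one_mul]
  exact hρ.map_path_one_pos hπ hμ

theorem IsPrequantization.contactClass_add_const {H : M → ℝ}
    (hH : ContMDiff (𝓡 (2 * n)) 𝓘(ℝ, ℝ) ∞ H) (c : ℝ) :
    μ (contactClass α (fun _ x => H (π x) + c)) =
      μ (contactClass α (fun _ x => H (π x))) + c * μ (contactClass α (fun _ _ => 1)) := by
  obtain ⟨R, ρ, hρ⟩ := hπ.exists_reebFlow
  rw [hρ.contactClass_const hπ hμ 1, one_mul, hρ.contactClass_basic_add hπ hμ hH]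

theorem IsPrequantization.contactClass_mono {h k : V → ℝ}
    (hh : ContMDiff (𝓡 (2 * n + 1)) 𝓘(ℝ, ℝ) ∞ h) (hk : ContMDiff (𝓡 (2 * n + 1)) 𝓘(ℝ, ℝ) ∞ k)
    (hle : ∀ x, h x ≤ k x) : μ (contactClass α (fun _ => h)) ≤ μ (contactClass α (fun _ => k)) := by
  obtain ⟨R, ρ, hρ⟩ := hπ.exists_reebFlow
  exact hρ.reeb.contactClass_le hπ.contact hμ (contMDiff_autonomous hh) (contMDiff_autonomous hk)
    fun _ _ => hle

/-- H∘π is at most χ(H∘π - a) plus the constant a + ε, where ε = δ / μ(φ_1) makes the loss exactly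
δ. The first summand vanishes on Y and so contributes nothing to μ. -/
theorem IsSubheavy.contactClass_basic_le {Y : Set V} (hY : IsSubheavy α μ Y) {H : M → ℝ}
    (hH : ContMDiff (𝓡 (2 * n)) 𝓘(ℝ, ℝ) ∞ H) {a : ℝ} (ha : ∀ y ∈ Y, H (π y) ≤ a) :
    μ (contactClass α (fun _ x => H (π x))) ≤ a * μ (contactClass α (fun _ _ => 1)) := by
  have hr := hπ.contactClass_one_pos hμ
  refine le_of_forall_pos_le_add fun δ hδ => ?_
  obtain ⟨χ, hχ, hχ0, hχε⟩ := exists_contDiff_approx_posPart (div_pos hδ hr)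
  have hG : ContMDiff (𝓡 (2 * n)) 𝓘(ℝ, ℝ) ∞ (fun x => χ (H x - a)) :=
    hχ.contMDiff.comp (hH.sub contMDiff_const)
  have h0 := hY.2 ⟨fun x => χ (H (π x) - a), hG.comp hπ.smooth⟩
    fun y hy => hχ0 _ (sub_nonpos.2 (ha y hy))
  have h1 := hπ.contactClass_add_const hμ hG (a + δ / μ (contactClass α (fun _ _ => 1)))
  have h2 := hπ.contactClass_mono hμ (hH.comp hπ.smooth)
    ((hG.comp hπ.smooth).add (contMDiff_const
      (c := a + δ / μ (contactClass α (fun _ _ => 1))))) fun x => by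
      have := hχε (H (π x) - a)
      simp only [Function.comp_apply, Pi.add_apply]
      linarith
  refine h2.trans (h1.trans ?_).le
  have h3 : μ (contactClass α (fun _ x => χ (H (π x) - a))) = 0 := h0
  rw [h3, zero_add, add_mul, div_mul_cancel₀ _ hr.ne']

theorem IsSubheavy.le_contactClass_basic {Y : Set V} (hY : IsSubheavy α μ Y) {H : M → ℝ}
    (hH : ContMDiff (𝓡 (2 * n)) 𝓘(ℝ, ℝ) ∞ H) {b : ℝ} (hb : ∀ y ∈ Y, b ≤ H (π y)) :
    b * μ (contactClass α (fun _ _ => 1)) ≤ μ (contactClass α (fun _ x => H (π x))) := by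
  have hr := hπ.contactClass_one_pos hμ
  refine le_of_forall_pos_le_add fun δ hδ => ?_
  obtain ⟨χ, hχ, hχ0, hχε⟩ := exists_contDiff_approx_posPart (div_pos hδ hr)
  have hG : ContMDiff (𝓡 (2 * n)) 𝓘(ℝ, ℝ) ∞ (fun x => -χ (b - H x)) :=
    (hχ.contMDiff.comp (contMDiff_const.sub hH)).neg
  have h0 := hY.2 ⟨fun x => -χ (b - H (π x)), hG.comp hπ.smooth⟩
    fun y hy => neg_eq_zero.2 (hχ0 _ (sub_nonpos.2 (hb y hy)))
  have h1 := hπ.contactClass_add_const hμ hG (b - δ / μ (contactClass α (fun _ _ => 1)))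
  have h2 := hπ.contactClass_mono hμ
    ((hG.comp hπ.smooth).add (contMDiff_const
      (c := b - δ / μ (contactClass α (fun _ _ => 1))))) (hH.comp hπ.smooth) fun x => by
      have := hχε (b - H (π x))
      simp only [Function.comp_apply, Pi.add_apply]
      linarith
  have h3 : μ (contactClass α (fun _ x => -χ (b - H (π x)))) = 0 := h0
  rw [h3, zero_add, sub_mul, div_mul_cancel₀ _ hr.ne'] at h1
  exact sub_le_iff_le_add.1 (h1.symm.le.trans h2)

/-- For empty Y the constant 1 would satisfy the vanishing condition, contradicting μ(φ_1) > 0. -/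
theorem IsSubheavy.nonempty {Y : Set V} (hY : IsSubheavy α μ Y) : Y.Nonempty := by
  by_contra h
  rw [not_nonempty_iff_eq_empty] at h
  refine (hπ.contactClass_one_pos hμ).ne' (hY.2 ⟨fun _ => 1, contMDiff_const⟩ fun y hy => ?_)
  rw [h] at hy
  exact hy.elim

end Basic

variable [T2Space M] [CompactSpace M] [ConnectedSpace V]
  (hπ : IsPrequantization α Ω π) (hμ : IsMonotoneQuasimorphism α μ)
include hπ hμ

/-- Subtracting the mean of H from H∘π changes μ by the mean times μ(φ_1). In the definition of ζ
this cancels the integral of H, and the normalizing factor -Vol(M)/μ(φ_1) leaves the quotient. -/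
theorem IsPrequantization.quasiState_eq (H : C^∞⟮𝓡 (2 * n), M; ℝ⟯) :
    quasiState Ω (inducedQuasimorphism α Ω π μ) H =
      μ (contactClass α (fun _ x => H (π x))) / μ (contactClass α (fun _ _ => 1)) := by
  obtain ⟨x⟩ := (inferInstance : Nonempty V)
  have : Nonempty M := ⟨π x⟩
  have hvol := (totalVolume_pos hπ.symplectic).ne'
  have hr := (hπ.contactClass_one_pos hμ).ne'
  have h1 := hπ.contactClass_add_const hμ H.contMDiff (-(volumeIntegral Ω H / totalVolume Ω))
  have h2 : μ (pullback α Ω π (hamClass Ω (fun _ => H))) =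
      μ (contactClass α (fun _ x => H (π x) + -(volumeIntegral Ω H / totalVolume Ω))) := by
    rw [hπ.map_pullback hμ H.contMDiff]
    simp only [← sub_eq_add_neg]
    rfl
  rw [quasiState, inducedQuasimorphism, h2, h1]
  field_simp
  ring

theorem IsSubheavy.isSuperheavy_image {Y : Set V} (hY : IsSubheavy α μ Y) :
    IsSuperheavy (quasiState Ω (inducedQuasimorphism α Ω π μ)) (π '' Y) := by
  have hr := hπ.contactClass_one_pos hμ
  have hc : IsCompact (π '' Y) := hY.1.isCompact.image hπ.smooth.continuous
  refine ⟨hc.isClosed, (hY.nonempty hπ hμ).image π, fun H => ?_⟩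
  have hHc := hc.image H.contMDiff.continuous
  rw [hπ.quasiState_eq hμ, le_div_iff₀ hr, div_le_iff₀ hr]
  exact ⟨hY.le_contactClass_basic hπ hμ H.contMDiff fun y hy =>
      csInf_le hHc.bddBelow (mem_image_of_mem H (mem_image_of_mem π hy)),
    hY.contactClass_basic_le hπ hμ H.contMDiff fun y hy =>
      le_csSup hHc.bddAbove (mem_image_of_mem H (mem_image_of_mem π hy))⟩

/-- Superheaviness only tests functions on M, so h is bounded below by a basic function that is
still positive on X. -/
theorem IsSuperheavy.isContactSuperheavy_preimage {X : Set M}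
    (hX : IsSuperheavy (quasiState Ω (inducedQuasimorphism α Ω π μ)) X) :
    IsContactSuperheavy α μ (π ⁻¹' X) := by
  have hπc := hπ.smooth.continuous
  have hXc : IsClosed (π ⁻¹' X) := hX.1.preimage hπc
  refine ⟨hXc, fun h hpos => ?_⟩
  have hhc : Continuous h := h.contMDiff.continuous
  obtain ⟨x₀, hx₀, hmin⟩ := hXc.isCompact.exists_isMinOn
    (hX.2.1.preimage hπ.surjective) hhc.continuousOn
  have hδ := hpos x₀ hx₀
  set δ := h x₀
  obtain ⟨C, hC⟩ := isCompact_univ.exists_bound_of_continuousOn hhc.continuousOn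
  have hC' : ∀ x, -C ≤ h x := fun x => (abs_le.1 (hC x (mem_univ x))).1
  have hF : IsClosed (π '' {x | h x ≤ δ / 2}) :=
    ((isClosed_le hhc continuous_const).isCompact.image hπc).isClosed
  have hdisj : Disjoint (π '' {x | h x ≤ δ / 2}) X := by
    rw [disjoint_left]
    rintro _ ⟨x, hx, rfl⟩ hxX
    have h1 : δ ≤ h x := hmin hxX
    have h2 : h x ≤ δ / 2 := hx
    linarith
  obtain ⟨χ, hχ0, hχ1, hχ⟩ := exists_contMDiffMap_zero_one_of_isClosed (n := ⊤) (𝓡 (2 * n)) hF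
    hX.1 hdisj
  -- H interpolates between the lower bound -C of h on the image of {h ≤ δ/2} and δ/2 on X. Off the
  -- preimage of that image h exceeds δ/2, the largest possible value of H, so H∘π ≤ h throughout.
  let H : C^∞⟮𝓡 (2 * n), M; ℝ⟯ := ⟨fun y => (δ / 2 + C) * χ y - C,
    (contMDiff_const.mul χ.contMDiff).sub contMDiff_const⟩
  have hHX : ∀ y ∈ X, H y = δ / 2 := fun y hy => by
    change (δ / 2 + C) * χ y - C = δ / 2
    rw [hχ1 hy]
    simp
  have hle : ∀ x, H (π x) ≤ h x := fun x => by
    change (δ / 2 + C) * χ (π x) - C ≤ h x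
    have h3 := hC' x
    have h4 := hC' x₀
    rcases le_or_gt (h x) (δ / 2) with h1 | h1
    · rw [hχ0 (mem_image_of_mem π h1)]
      simpa using h3
    · have h5 := (hχ (π x)).2
      have h6 : |δ| ≤ C := hC x₀ (mem_univ x₀)
      have h7 := (abs_nonneg δ).trans h6
      have := mul_le_mul_of_nonneg_left h5 (by linarith : 0 ≤ δ / 2 + C)
      linarith
  have hr := hπ.contactClass_one_pos hμ
  have h1 := (hX.2.2 H).1
  rw [hπ.quasiState_eq hμ, le_div_iff₀ hr] at h1
  have h2 : δ / 2 ≤ sInf (H '' X) := by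
    refine le_csInf (hX.2.1.image H) ?_
    rintro _ ⟨y, hy, rfl⟩
    exact (hHX y hy).ge
  have h3 := hπ.contactClass_mono hμ (H.contMDiff.comp hπ.smooth) h.contMDiff hle
  exact (mul_pos (by linarith) hr).trans_le (h1.trans h3)

end Main

end Prequant

end

open Prequant in
theorem mainTheorem7 (n : ℕ)
    {V : Type*} [TopologicalSpace V] [ChartedSpace (Euc (2 * n + 1)) V]
    [IsManifold (𝓡 (2 * n + 1)) ∞ V] [T2Space V] [CompactSpace V] [ConnectedSpace V]
    {M : Type*} [TopologicalSpace M] [ChartedSpace (Euc (2 * n)) M]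
    [IsManifold (𝓡 (2 * n)) ∞ M] [T2Space M] [CompactSpace M]
    (α : Form (2 * n + 1) V 1) (Ω : Form (2 * n) M 2) (π : V → M)
    (hπ : IsPrequantization α Ω π)
    (μ : ContTilde α → ℝ) (hμ : IsMonotoneQuasimorphism α μ) :
    (∀ Y : Set V, IsSubheavy α μ Y →
      IsSuperheavy (quasiState Ω (inducedQuasimorphism α Ω π μ)) (π '' Y)) ∧
    (∀ X : Set M, IsSuperheavy (quasiState Ω (inducedQuasimorphism α Ω π μ)) X →
      IsContactSuperheavy α μ (π ⁻¹' X)) := by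
  exact ⟨fun _ hY => hY.isSuperheavy_image hπ hμ, fun _ hX => hX.isContactSuperheavy_preimage hπ hμ⟩
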